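/- **Maps.** A rooted planar map is a connected planar map with a distinguished oriented edge (the root edge), taken up to orientation-preserving homeomorphism fixing the root edge (combinatorially: darts with an involution and a face permutation, connected, satisfying Euler's formula, up to relabelling of the darts). The root vertex is the origin of the root edge and the infinite face is the face on the right of the root edge; the other faces are finite. For a finite face $f$ of $m$, let $\Phi(m,f)$ be the map obtained by drawing a new vertex in $f$ and joining it to the corners of $f$. Let $\triangle_2$ consist of the rooted triangle $\Theta$ and, for $k\ge 1$, let $\triangle_{2(k+1)}$ be the set of all $\Phi(m,f)$, $m\in\triangle_{2k}$, $f$ a finite face of $m$; the elements of $\triangle_{2k}$ are the stack-triangulations with $2k$ faces. A vertex is internal if it is not incident to the infinite face. $d_m$ is the graph distance and $\deg_m$ the vertex degree. A history of $m\in\triangle_{2k}$ is a sequence $((m_i,f_i))_{1\le i\le k-1}$ with $m_i\in\triangle_{2i}$, $f_i$ a finite face of $m_i$, $m_{i+1}=\Phi(m_i,f_i)$, $m_k=m$ (pairs $(m_i,f_i)$ being taken up to isomorphism). $H_\triangle(k)$ is the set of all histories of elements of $\triangle_{2k}$. **Trees.** A planar tree is a set $t$ of finite words on $\{1,2,\dots\}$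 that contains the empty word and such that, if $ui\in t$ with $i$ a letter, then $u\in t$ and $uj\in t$ for $1\le j\le i$. A node without child is a leaf ($\partial t$ is the set of leaves), the others are internal nodes ($t^\circ$). $\mathcal T^{\rm ter}_n$ is the set of planar trees with $n$ nodes in which every node has $0$ or $3$ children. For $u\in\partial t$ let $\phi(t,u)=t\cup\{u1,u2,u3\}$. A history of $t\in\mathcal T^{\rm ter}_{3k-2}$ is a sequence $((t_i,u_i))_{1\le i\le k-1}$ with $t_1=\{\varnothing\}$, $u_i\in\partial t_i$, $t_{i+1}=\phi(t_i,u_i)$, $t_k=t$. $H_{\mathcal T}(k)$ is the set of all histories of elements of $\mathcal T^{\rm ter}_{3k-2}$. **Passage function.** For a word $u=u_1\cdots u_n$ on $\{1,2,3\}$ put $\tau_1(u)=0$, $\tau_2(u)=\inf\{i>0: u_i=1\}$ and, for $j\ge 3$, $\tau_j(u)=\inf\{i>\tau_{j-1}(u): u_{1+\tau_{j-1}(u)}\cdots u_i \text{ contains each of } 1,2,3\}$ (with $\inf\emptyset=\infty$), and $\Gamma(u)=\max\{i:\tau_i(u)\le |u|\}$. For two words $u=wa$, $v=wb$, where $w$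 is their longest common prefix, $\Gamma(u,v)=\Gamma(a)+\Gamma(b)$. **Statement.** There are maps $\Psi_K$, $\psi_K$ ($K\ge1$) such that for every $K\ge 1$, $\Psi_K$ is a bijection from $\triangle_{2K}$ onto $\mathcal T^{\rm ter}_{3K-2}$ and the following holds. Let $m\in\triangle_{2K}$ and $t=\Psi_K(m)$. Then all faces of $m$ are triangles, their number is $2K$, and: 1. (a) there is a bijection $u\mapsto u'$ from the internal vertices of $m$ onto $t^\circ$; (b) there is a bijection $f\mapsto\ell_m(f)$ from the finite faces of $m$ onto $\partial t$; 2. for every internal vertex $u$ of $m$, $d_m(\text{root vertex},u)=\Gamma(u')$; for all internal vertices $u,v$ of $m$, $|d_m(u,v)-\Gamma(u',v')|\le 4$; 3. for every internal vertex $u$ of $m$, $$\deg_m(u)=3+\#\{v'\in t^\circ : v'=u'w',\ w'\in 1\{2,3\}^\star\cup 2\{1,3\}^\star\cup 3\{1,2\}^\star\},$$ where $\{a,b\}^\star$ is the set of all finite words, including the empty one, on the letters $a,b$. Moreover, $\psi_K$ is a bijection from $H_\triangle(K)$ onto $H_{\mathcal T}(K)$ that sends every history $((m_i,f_i))_i$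 of $m$ to the history $((\Psi_i(m_i),\ell_{m_i}(f_i)))_i$ of $\Psi_K(m)$. It is consistent: for $1\le j\le K$, $\psi_j$ sends the first $j-1$ terms of $h\in H_\triangle(K)$ to the first $j-1$ terms of $\psi_K(h)$. It is robust: $h_1,h_2\in H_\triangle(K)$ are histories of the same map if and only if $\psi_K(h_1),\psi_K(h_2)$ are histories of the same tree. -/

import Mathlib

/-! ## Rooted planar maps

A map on an oriented surface is described by its darts (oriented edges), the involution `inv`
reversing a dart, and the permutation `next` sending a dart `d` to the dart that follows `d` on the
boundary of the face lying to the left of `d`.  Faces are the cycles of `next`; vertices are the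
cycles of `rot = inv ∘ next⁻¹`, the counterclockwise rotation around the origin of a dart.  The map
is planar when it is connected and satisfies Euler's formula.  Two rooted maps are identified when
they differ by a relabelling of the darts, which is the same as an orientation preserving
homeomorphism of the sphere fixing the root. -/

/-- Faces of the combinatorial map with face permutation `next`: the cycles of `next`. -/
abbrev FaceOrbit {D : Type} (next : Equiv.Perm D) : Type :=
  Quotient (Equiv.Perm.SameCycle.setoid next)

/-- Vertices of a combinatorial map: the cycles of the rotation `inv ∘ next⁻¹`. -/
abbrev VertexOrbit {D : Type} (inv next : Equiv.Perm D) : Type :=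
  Quotient (Equiv.Perm.SameCycle.setoid (inv * next⁻¹))

/-- Rooted planar maps. -/
structure RootedMap where
  /-- oriented edges -/
  Dart : Type
  finite_dart : Finite Dart
  /-- reversal of a dart -/
  inv : Equiv.Perm Dart
  /-- the next dart around the face on the left of a dart -/
  next : Equiv.Perm Dart
  /-- the root edge; the infinite face lies on its right -/
  root : Dart
  inv_inv : ∀ d, inv (inv d) = d
  inv_ne : ∀ d, inv d ≠ d
  connected : ∀ d d' : Dart, Relation.EqvGen (fun a b => b = inv a ∨ b = next a) d d'
  /-- Euler's formula `V + F = E + 2`, where `2 E` is the number of darts -/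
  euler : 2 * (Nat.card (VertexOrbit inv next) + Nat.card (FaceOrbit next)) = Nat.card Dart + 4

namespace RootedMap

variable (m : RootedMap)

/-- The vertices of a map. -/
abbrev Vertex : Type := VertexOrbit m.inv m.next

/-- The faces of a map. -/
abbrev Face : Type := FaceOrbit m.next

/-- The vertex from which a dart starts. -/
def origin (d : m.Dart) : m.Vertex := Quotient.mk _ d

/-- The face on the left of a dart. -/
def faceOf (d : m.Dart) : m.Face := Quotient.mk _ d

/-- The root vertex. -/
def rootVertex : m.Vertex := m.origin m.root

/-- The infinite face is the face on the right of the root. -/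
def outerFace : m.Face := m.faceOf (m.inv m.root)

/-- The finite faces. -/
def finiteFaces : Set m.Face := {f | f ≠ m.outerFace}

/-- The degree of a face: its number of sides. -/
noncomputable def faceDegree (f : m.Face) : ℕ := Nat.card {d : m.Dart // m.faceOf d = f}

/-- The internal vertices: those that are not incident to the infinite face. -/
def internalVertices : Set m.Vertex := {v | ∀ d, m.origin d = v → m.faceOf d ≠ m.outerFace}

/-- The degree of a vertex. -/
noncomputable def degree (v : m.Vertex) : ℕ := Nat.card {d : m.Dart // m.origin d = v}

/-- The graph carried by a map. -/
def graph : SimpleGraph m.Vertex where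
  Adj v w := v ≠ w ∧ ∃ d, m.origin d = v ∧ m.origin (m.inv d) = w
  symm := ⟨by
    rintro v w ⟨hne, d, h1, h2⟩
    exact ⟨hne.symm, m.inv d, h2, by rw [m.inv_inv]; exact h1⟩⟩
  loopless := ⟨fun _ h => h.1 rfl⟩

/-- The graph distance in a map. -/
noncomputable def dist (v w : m.Vertex) : ℕ := m.graph.dist v w

variable {m} in
theorem faceOf_next (d : m.Dart) : m.faceOf (m.next d) = m.faceOf d :=
  Quotient.sound (s := Equiv.Perm.SameCycle.setoid m.next)
    (show m.next.SameCycle (m.next d) d from Equiv.Perm.sameCycle_apply_left.2 (.refl _ _))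

variable {m} in
theorem faceOf_next_symm (d : m.Dart) : m.faceOf (m.next.symm d) = m.faceOf d := by
  have := faceOf_next (m := m) (m.next.symm d)
  rw [Equiv.apply_symm_apply] at this
  exact this.symm

/-- The darts after the insertion of a point `x` joined to every corner of `f`: to the old darts
one adds, for every side `d` of `f`, the dart `(d, false)` from the origin of `d` to `x` and the
dart `(d, true)` from `x` to the origin of `d`. -/
abbrev InsertDart (f : m.Face) : Type := m.Dart ⊕ ({d : m.Dart // m.faceOf d = f} × Bool)

/-- Reversal of darts after the insertion. -/
def insertInv (f : m.Face) : Equiv.Perm (m.InsertDart f) :=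
  Equiv.sumCongr m.inv (Equiv.prodCongr (Equiv.refl _) Equiv.boolNot)

open Classical in
/-- The face permutation after the insertion: every side `d` of `f` becomes the side of a
triangle `d, (next d, false), (d, true)`; the other faces are unchanged. -/
noncomputable def insertNext (f : m.Face) : Equiv.Perm (m.InsertDart f) where
  toFun
    | .inl d => if h : m.faceOf d = f then .inr (⟨m.next d, (faceOf_next d).trans h⟩, false)
        else .inl (m.next d)
    | .inr (d, false) => .inr (⟨m.next.symm d, (faceOf_next_symm _).trans d.2⟩, true)
    | .inr (d, true) => .inl d
  invFun
    | .inl d => if h : m.faceOf d = f then .inr (⟨d, h⟩, true) else .inl (m.next.symm d)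
    | .inr (d, false) => .inl (m.next.symm d)
    | .inr (d, true) => .inr (⟨m.next d, (faceOf_next _).trans d.2⟩, false)
  left_inv := by
    rintro (d | ⟨⟨d, hd⟩, _ | _⟩)
    · by_cases h : m.faceOf d = f
      · simp [h]
      · simp [h, faceOf_next]
    · simp
    · simp [hd]
  right_inv := by
    rintro (d | ⟨⟨d, hd⟩, _ | _⟩)
    · by_cases h : m.faceOf d = f
      · simp [h]
      · simp [h, faceOf_next_symm]
    · simp [hd, faceOf_next_symm]
    · simp

theorem sameCycle_map {D D' : Type} (p : Equiv.Perm D) (q : Equiv.Perm D') (j : D → D')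
    (h : ∀ d, q.SameCycle (j d) (j (p d))) {a b : D} (hab : p.SameCycle a b) :
    q.SameCycle (j a) (j b) := by
  obtain ⟨i, rfl⟩ := hab
  induction i using Int.induction_on with
  | zero => exact .refl _ _
  | succ n ih =>
    have := h ((p ^ (n : ℤ)) a)
    rw [← Equiv.Perm.mul_apply, ← zpow_one_add, add_comm] at this
    exact ih.trans this
  | pred n ih =>
    have := h ((p ^ (-(n : ℤ) - 1)) a)
    rw [← Equiv.Perm.mul_apply, ← zpow_one_add, add_sub_cancel] at this
    exact ih.trans this.symm

theorem card_orbits {D X : Type} (p : Equiv.Perm D) (g : D → X) (hs : Function.Surjective g)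
    (hinv : ∀ a, g (p a) = g a) (hsep : ∀ a b, g a = g b → p.SameCycle a b) :
    Nat.card (Quotient (Equiv.Perm.SameCycle.setoid p)) = Nat.card X := by
  have key : ∀ a b, p.SameCycle a b → g a = g b := by
    intro a b hab
    have := sameCycle_map p (1 : Equiv.Perm X) g (fun d => by rw [hinv]) hab
    simpa using this
  refine Nat.card_congr (Equiv.ofBijective (Quotient.lift g key) ⟨?_, ?_⟩)
  · intro a b
    induction a using Quotient.inductionOn
    induction b using Quotient.inductionOn
    intro h
    exact Quotient.sound (hsep _ _ h)
  · intro x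
    obtain ⟨a, rfl⟩ := hs x
    exact ⟨Quotient.mk _ a, rfl⟩

open Classical in
theorem insertNext_inl (f : m.Face) (d : m.Dart) : m.insertNext f (.inl d) =
    if h : m.faceOf d = f then .inr (⟨m.next d, (faceOf_next d).trans h⟩, false)
        else .inl (m.next d) := rfl

theorem insertNext_inr_false (f : m.Face) (d : {d : m.Dart // m.faceOf d = f}) :
    m.insertNext f (.inr (d, false)) =
      .inr (⟨m.next.symm d, (faceOf_next_symm _).trans d.2⟩, true) := rfl

theorem insertNext_inr_true (f : m.Face) (d : {d : m.Dart // m.faceOf d = f}) :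
    m.insertNext f (.inr (d, true)) = .inl d.1 := rfl

open Classical in
theorem insertRot_inl (f : m.Face) (d : m.Dart) :
    (m.insertInv f * (m.insertNext f)⁻¹) (.inl d) =
      if h : m.faceOf d = f then .inr (⟨d, h⟩, false) else .inl ((m.inv * m.next⁻¹) d) := by
  rw [Equiv.Perm.mul_apply]
  show m.insertInv f ((m.insertNext f).symm (.inl d)) = _
  by_cases h : m.faceOf d = f
  · simp [h, insertNext, insertInv]
  · simp [h, insertNext, insertInv, Equiv.Perm.inv_def]

theorem insertRot_inr_false (f : m.Face) (d : {d : m.Dart // m.faceOf d = f}) :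
    (m.insertInv f * (m.insertNext f)⁻¹) (.inr (d, false)) = .inl ((m.inv * m.next⁻¹) d.1) := rfl

theorem insertRot_inr_true (f : m.Face) (d : {d : m.Dart // m.faceOf d = f}) :
    (m.insertInv f * (m.insertNext f)⁻¹) (.inr (d, true)) =
      .inr (⟨m.next d, (faceOf_next _).trans d.2⟩, true) := rfl

theorem insert_card_vertex (f : m.Face) :
    Nat.card (VertexOrbit (m.insertInv f) (m.insertNext f)) = Nat.card m.Vertex + 1 := by
  classical
  have := m.finite_dart
  have horig : ∀ d, m.origin ((m.inv * m.next⁻¹) d) = m.origin d := fun d =>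
    Quotient.sound (s := Equiv.Perm.SameCycle.setoid (m.inv * m.next⁻¹))
      (show (m.inv * m.next⁻¹).SameCycle _ _ from Equiv.Perm.sameCycle_apply_left.2 (.refl _ _))
  have h1 : ∀ d h, (m.insertInv f * (m.insertNext f)⁻¹).SameCycle
      (.inl d) (.inr (⟨d, h⟩, false)) := by
    intro d h
    have := insertRot_inl m f d
    rw [dif_pos h] at this
    rw [← this]
    exact Equiv.Perm.sameCycle_apply_right.2 (.refl _ _)
  have h2 : ∀ a b, (m.inv * m.next⁻¹).SameCycle a b →
      (m.insertInv f * (m.insertNext f)⁻¹).SameCycle (.inl a) (.inl b) := by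
    intro a b hab
    refine sameCycle_map _ _ (fun d => (Sum.inl d : m.InsertDart f)) (fun d => ?_) hab
    by_cases h : m.faceOf d = f
    · refine (h1 d h).trans ?_
      rw [show (Sum.inl ((m.inv * m.next⁻¹) d) : m.InsertDart f) = _ from
        (insertRot_inr_false m f ⟨d, h⟩).symm]
      exact Equiv.Perm.sameCycle_apply_right.2 (.refl _ _)
    · have := insertRot_inl m f d
      rw [dif_neg h] at this
      show Equiv.Perm.SameCycle _ _ (Sum.inl ((m.inv * m.next⁻¹) d) : m.InsertDart f)
      rw [← this]
      exact Equiv.Perm.sameCycle_apply_right.2 (.refl _ _)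
  have h3 : ∀ a b : {d : m.Dart // m.faceOf d = f},
      (m.insertInv f * (m.insertNext f)⁻¹).SameCycle (.inr (a, true)) (.inr (b, true)) := by
    rintro ⟨a, ha⟩ ⟨b, hb⟩
    have hab : m.next.SameCycle a b :=
      Quotient.exact (s := Equiv.Perm.SameCycle.setoid m.next) (ha.trans hb.symm)
    have := sameCycle_map m.next (m.insertInv f * (m.insertNext f)⁻¹)
      (fun d => if h : m.faceOf d = f then (Sum.inr (⟨d, h⟩, true) : m.InsertDart f)
        else .inr (⟨a, ha⟩, true)) (fun d => by
        by_cases h : m.faceOf d = f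
        · rw [dif_pos h, dif_pos ((faceOf_next _).trans h)]
          rw [← insertRot_inr_true m f ⟨d, h⟩]
          exact Equiv.Perm.sameCycle_apply_right.2 (.refl _ _)
        · rw [dif_neg h, dif_neg (fun h' => h ((faceOf_next _).symm.trans h'))]) hab
    simpa only [dif_pos ha, dif_pos hb] using this
  rw [← Finite.card_option]
  refine card_orbits _ (fun d : m.InsertDart f => match d with
    | .inl d => some (m.origin d)
    | .inr (d, false) => some (m.origin d.1)
    | .inr (_, true) => none) ?_ ?_ ?_
  · rintro (_ | v)
    · obtain ⟨d, hd⟩ := Quotient.exists_rep f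
      exact ⟨.inr (⟨d, hd⟩, true), rfl⟩
    · obtain ⟨d, rfl⟩ := Quotient.exists_rep v
      exact ⟨.inl d, rfl⟩
  · rintro (d | ⟨d, _ | _⟩)
    · rw [insertRot_inl]
      by_cases h : m.faceOf d = f
      · rw [dif_pos h]
      · rw [dif_neg h]
        exact congrArg some (horig d)
    · rw [insertRot_inr_false]
      exact congrArg some (horig d.1)
    · rw [insertRot_inr_true]
  · have hx : ∀ a b, m.origin a = m.origin b →
        (m.insertInv f * (m.insertNext f)⁻¹).SameCycle (.inl a) (.inl b) := fun a b h =>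
      h2 a b (Quotient.exact (s := Equiv.Perm.SameCycle.setoid (m.inv * m.next⁻¹)) h)
    rintro (a | ⟨a, _ | _⟩) (b | ⟨b, _ | _⟩) h
    · exact hx a b (Option.some.inj h)
    · exact (hx a b.1 (Option.some.inj h)).trans (h1 b.1 b.2)
    · exact absurd h (by simp)
    · exact (h1 a.1 a.2).symm.trans (hx a.1 b (Option.some.inj h))
    · exact ((h1 a.1 a.2).symm.trans (hx a.1 b.1 (Option.some.inj h))).trans (h1 b.1 b.2)
    · exact absurd h (by simp)
    · exact absurd h (by simp)
    · exact absurd h (by simp)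
    · exact h3 a b

theorem insert_card_face (f : m.Face) :
    Nat.card (FaceOrbit (m.insertNext f)) + 1 = Nat.card m.Face + m.faceDegree f := by
  classical
  have := m.finite_dart
  have hcard : Nat.card {g : m.Face // g ≠ f} + 1 = Nat.card m.Face := by
    rw [← Finite.card_option]
    exact Nat.card_congr (Equiv.optionSubtypeNe f)
  have hn1 : ∀ d h, m.insertNext f (.inr (⟨d, h⟩, true)) = .inl d := fun _ _ => rfl
  have h1 : ∀ d h, (m.insertNext f).SameCycle (.inr (⟨d, h⟩, true)) (.inl d) := fun d h => by
    rw [← hn1 d h]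
    exact Equiv.Perm.sameCycle_apply_right.2 (.refl _ _)
  have h2 : ∀ d : {d : m.Dart // m.faceOf d = f}, (m.insertNext f).SameCycle (.inr (d, false))
      (.inr (⟨m.next.symm d, (faceOf_next_symm _).trans d.2⟩, true)) := fun d => by
    rw [← insertNext_inr_false]
    exact Equiv.Perm.sameCycle_apply_right.2 (.refl _ _)
  have hx : ∀ a b, m.faceOf a ≠ f → m.faceOf a = m.faceOf b →
      (m.insertNext f).SameCycle (.inl a) (.inl b) := by
    intro a b ha hab
    have hs : m.next.SameCycle a b :=
      Quotient.exact (s := Equiv.Perm.SameCycle.setoid m.next) hab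
    have := sameCycle_map m.next (m.insertNext f)
      (fun d => if m.faceOf d = f then (Sum.inl a : m.InsertDart f) else .inl d) (fun d => by
        by_cases h : m.faceOf d = f
        · rw [if_pos h, if_pos ((faceOf_next _).trans h)]
        · rw [if_neg h, if_neg (fun h' => h ((faceOf_next _).symm.trans h'))]
          have := insertNext_inl m f d
          rw [dif_neg h] at this
          rw [← this]
          exact Equiv.Perm.sameCycle_apply_right.2 (.refl _ _)) hs
    simpa only [if_neg ha, if_neg (hab ▸ ha)] using this
  have := card_orbits (m.insertNext f)
    (X := {g : m.Face // g ≠ f} ⊕ {d : m.Dart // m.faceOf d = f})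
    (fun d : m.InsertDart f => match d with
    | .inl d => if h : m.faceOf d = f then .inr ⟨d, h⟩ else .inl ⟨m.faceOf d, h⟩
    | .inr (d, false) => .inr ⟨m.next.symm d, (faceOf_next_symm _).trans d.2⟩
    | .inr (d, true) => .inr d) ?_ ?_ ?_
  · unfold faceDegree
    rw [this, Nat.card_sum]
    omega
  · rintro (⟨g, hg⟩ | d)
    · obtain ⟨d, rfl⟩ := Quotient.exists_rep g
      exact ⟨.inl d, dif_neg hg⟩
    · exact ⟨.inr (d, true), rfl⟩
  · rintro (d | ⟨d, _ | _⟩)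
    · rw [insertNext_inl]
      by_cases h : m.faceOf d = f
      · simp only [dif_pos h, Equiv.symm_apply_apply]
      · simp only [dif_neg h, faceOf_next]
    · rw [insertNext_inr_false]
    · rw [insertNext_inr_true]
      exact dif_pos d.2
  · have hall : ∀ x : m.InsertDart f,
        (∃ d, m.faceOf d ≠ f ∧ x = .inl d) ∨ ∃ d : {d : m.Dart // m.faceOf d = f},
        (m.insertNext f).SameCycle x (.inr (d, true)) ∧ (match x with
          | .inl d => if h : m.faceOf d = f then .inr ⟨d, h⟩ else .inl ⟨m.faceOf d, h⟩
          | .inr (d, false) => .inr ⟨m.next.symm d, (faceOf_next_symm _).trans d.2⟩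
          | .inr (d, true) => .inr d :
            {g : m.Face // g ≠ f} ⊕ {d : m.Dart // m.faceOf d = f}) = .inr d := by
      rintro (d | ⟨d, _ | _⟩)
      · by_cases h : m.faceOf d = f
        · exact .inr ⟨⟨d, h⟩, (h1 d h).symm, dif_pos h⟩
        · exact .inl ⟨d, h, rfl⟩
      · exact .inr ⟨_, h2 d, rfl⟩
      · exact .inr ⟨d, .refl _ _, rfl⟩
    intro a b hab
    obtain ⟨a, ha, rfl⟩ | ⟨da, ha, ha'⟩ := hall a <;>
      obtain ⟨b, hb, rfl⟩ | ⟨db, hb, hb'⟩ := hall b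
    · simp only [dif_neg ha, dif_neg hb] at hab
      exact hx a b ha (congrArg Subtype.val (Sum.inl.inj hab))
    · have hab' := hab.trans hb'
      simp only [dif_neg ha] at hab'
      cases hab'
    · have hab' := ha'.symm.trans hab
      simp only [dif_neg hb] at hab'
      cases hab'
    · cases Sum.inr.inj (ha'.symm.trans (hab.trans hb'))
      exact ha.trans hb.symm

/-- The map obtained by drawing a new vertex inside the face `f` and joining it to every corner
of `f`. -/
noncomputable def insert (f : m.Face) : RootedMap where
  Dart := m.InsertDart f
  finite_dart := by
    have := m.finite_dart
    infer_instance
  inv := m.insertInv f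
  next := m.insertNext f
  root := .inl m.root
  inv_inv := by
    rintro (d | ⟨d, _ | _⟩) <;> simp [insertInv, m.inv_inv]
  inv_ne := by
    rintro (d | ⟨d, _ | _⟩) <;> simp [insertInv, m.inv_ne]
  connected := by
    classical
    set R := fun a b : m.InsertDart f => b = m.insertInv f a ∨ b = m.insertNext f a
    have h1 : ∀ d, Relation.EqvGen R (.inr (d, true)) (.inl d.1) := fun d => .rel _ _ (.inr rfl)
    have h2 : ∀ d, Relation.EqvGen R (.inr (d, true)) (.inr (d, false)) := fun d =>
      .rel _ _ (.inl rfl)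
    have h3 : ∀ d d', Relation.EqvGen R (.inl d) (.inl d') := by
      intro d d'
      induction m.connected d d' with
      | rel a b hab =>
        rcases hab with rfl | rfl
        · exact .rel _ _ (.inl rfl)
        · have := insertNext_inl m f a
          by_cases h : m.faceOf a = f
          · rw [dif_pos h] at this
            exact (Relation.EqvGen.rel _ _ (.inr this.symm)).trans _ _ _
              (((h2 _).symm _ _).trans _ _ _ (h1 _))
          · rw [dif_neg h] at this
            exact .rel _ _ (.inr this.symm)
      | refl a => exact .refl _
      | symm a b _ ih => exact ih.symm _ _
      | trans a b c _ _ ih1 ih2 => exact ih1.trans _ _ _ ih2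
    have h4 : ∀ x, Relation.EqvGen R x (.inl m.root) := by
      rintro (d | ⟨d, _ | _⟩)
      · exact h3 _ _
      · exact ((h2 d).symm _ _).trans _ _ _ ((h1 d).trans _ _ _ (h3 _ _))
      · exact (h1 d).trans _ _ _ (h3 _ _)
    exact fun a b => (h4 a).trans _ _ _ ((h4 b).symm _ _)
  euler := by
    have := m.finite_dart
    have h1 := m.insert_card_vertex f
    have h2 := m.insert_card_face f
    have h3 := m.euler
    have h4 : Nat.card (m.InsertDart f) = Nat.card m.Dart + m.faceDegree f * 2 := by
      rw [Nat.card_sum, Nat.card_prod, Nat.card_eq_fintype_card (α := Bool), Fintype.card_bool]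
      rfl
    rw [h4, h1]
    unfold Vertex Face at *
    omega

/-- The rooted triangle.  Its vertices are numbered counterclockwise by `Fin 3`; `(i, true)` is the
edge from `i` to `i + 1` and `(i, false)` is the edge from `i + 1` to `i`. -/
def triangle : RootedMap where
  Dart := Fin 3 × Bool
  finite_dart := inferInstance
  inv := Equiv.prodCongr (Equiv.refl _) Equiv.boolNot
  next :=
    { toFun := fun d => (if d.2 then d.1 + 1 else d.1 - 1, d.2)
      invFun := fun d => (if d.2 then d.1 - 1 else d.1 + 1, d.2)
      left_inv := by decide
      right_inv := by decide }
  root := (0, true)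
  inv_inv := by decide
  inv_ne := by decide
  connected := by
    have h : ∀ (i : Fin 3) (b : Bool), Relation.EqvGen
        (fun x y : Fin 3 × Bool => y = (x.1, !x.2) ∨ y = (if x.2 then x.1 + 1 else x.1 - 1, x.2))
        (i, b) (0, true) := by
      have h0 : ∀ i : Fin 3, Relation.EqvGen
          (fun x y : Fin 3 × Bool => y = (x.1, !x.2) ∨ y = (if x.2 then x.1 + 1 else x.1 - 1, x.2))
          (i, true) (i + 1, true) := fun i => .rel _ _ (.inr rfl)
      have h1 : ∀ i : Fin 3, Relation.EqvGen
          (fun x y : Fin 3 × Bool => y = (x.1, !x.2) ∨ y = (if x.2 then x.1 + 1 else x.1 - 1, x.2))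
          (i, true) (0, true) := by
        intro i
        fin_cases i
        · exact .refl _
        · exact (h0 1).trans _ _ _ (h0 2)
        · exact h0 2
      intro i b
      cases b
      · exact (Relation.EqvGen.rel _ _ (.inl rfl)).trans _ _ _ (h1 i)
      · exact h1 i
    exact fun d d' => (h d.1 d.2).trans _ _ _ ((h d'.1 d'.2).symm _ _)
  euler := by
    have h3 : ∀ (p : Equiv.Perm (Fin 3 × Bool)) a b, (b = a ∨ b = p a ∨ b = p (p a)) →
        p.SameCycle a b := by
      rintro p a b (rfl | rfl | rfl)
      · exact .refl _ _
      · exact Equiv.Perm.sameCycle_apply_right.2 (.refl _ _)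
      · exact Equiv.Perm.sameCycle_apply_right.2 (Equiv.Perm.sameCycle_apply_right.2 (.refl _ _))
    rw [card_orbits _ (fun d : Fin 3 × Bool => if d.2 then d.1 else d.1 + 1) (by decide)
      (by decide) (fun a b h => h3 _ a b (by revert a b; decide)),
      card_orbits _ (fun d : Fin 3 × Bool => d.2) (by decide)
      (by decide) (fun a b h => h3 _ a b (by revert a b; decide))]
    simp

/-- Two rooted maps are isomorphic when a relabelling of the darts preserves all the structure. -/
def Iso (m m' : RootedMap) (e : m.Dart ≃ m'.Dart) : Prop :=
  (∀ d, e (m.inv d) = m'.inv (e d)) ∧ (∀ d, e (m.next d) = m'.next (e d)) ∧ e m.root = m'.root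

theorem Iso.refl (m : RootedMap) : Iso m m (Equiv.refl _) := ⟨fun _ => rfl, fun _ => rfl, rfl⟩

theorem Iso.symm {m m' : RootedMap} {e : m.Dart ≃ m'.Dart} (h : Iso m m' e) :
    Iso m' m e.symm :=
  ⟨fun d => by rw [Equiv.symm_apply_eq, h.1, Equiv.apply_symm_apply],
   fun d => by rw [Equiv.symm_apply_eq, h.2.1, Equiv.apply_symm_apply],
   by rw [Equiv.symm_apply_eq, h.2.2]⟩

theorem Iso.trans {m₁ m₂ m₃ : RootedMap} {e : m₁.Dart ≃ m₂.Dart} {e' : m₂.Dart ≃ m₃.Dart}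
    (h : Iso m₁ m₂ e) (h' : Iso m₂ m₃ e') : Iso m₁ m₃ (e.trans e') :=
  ⟨fun d => by simp [h.1, h'.1], fun d => by simp [h.2.1, h'.2.1], by simp [h.2.2, h'.2.2]⟩

instance isoSetoid : Setoid RootedMap where
  r m m' := ∃ e, Iso m m' e
  iseqv := ⟨fun m => ⟨_, Iso.refl m⟩, fun ⟨_, h⟩ => ⟨_, h.symm⟩,
    fun ⟨_, h⟩ ⟨_, h'⟩ => ⟨_, h.trans h'⟩⟩

end RootedMap

/-- A rooted planar map with a distinguished finite face. -/
structure MarkedMap where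
  map : RootedMap
  face : map.Face
  finite_face : face ∈ map.finiteFaces

/-- Marked maps are identified when an isomorphism of rooted maps matches the marked faces. -/
instance MarkedMap.isoSetoid : Setoid MarkedMap where
  r M M' := ∃ e, RootedMap.Iso M.map M'.map e ∧
    ∀ d, M.map.faceOf d = M.face ↔ M'.map.faceOf (e d) = M'.face
  iseqv := ⟨fun M => ⟨_, .refl M.map, fun _ => Iff.rfl⟩,
    fun ⟨e, h, hf⟩ => ⟨_, h.symm, fun d => by rw [hf, Equiv.apply_symm_apply]⟩,
    fun ⟨_, h, hf⟩ ⟨_, h', hf'⟩ => ⟨_, h.trans h', fun d => (hf d).trans (hf' _)⟩⟩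

/-- Rooted planar maps up to isomorphism. -/
abbrev MapClass : Type 1 := Quotient RootedMap.isoSetoid

/-- Rooted planar maps with a distinguished finite face, up to isomorphism. -/
abbrev MarkedClass : Type 1 := Quotient MarkedMap.isoSetoid

/-- The map underlying a marked map. -/
def MarkedClass.map : MarkedClass → MapClass :=
  Quotient.map MarkedMap.map fun _ _ ⟨e, h, _⟩ => ⟨e, h⟩

/-- The operation `Φ`: insert a vertex in the distinguished finite face. -/
noncomputable def MarkedClass.grow : MarkedClass → MapClass :=
  Quotient.map (fun M => M.map.insert M.face) fun M M' ⟨e, h, hf⟩ => by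
    classical
    refine ⟨Equiv.sumCongr e (Equiv.prodCongr (e.subtypeEquiv hf) (Equiv.refl _)), ?_, ?_, ?_⟩
    · rintro (d | ⟨d, _ | _⟩)
      · exact congrArg Sum.inl (h.1 d)
      · rfl
      · rfl
    · have hs : ∀ d, e (M.map.next.symm d) = M'.map.next.symm (e d) := fun d => by
        rw [Equiv.eq_symm_apply, ← h.2.1, Equiv.apply_symm_apply]
      rintro (d | ⟨d, _ | _⟩)
      · show Equiv.sumCongr _ _ (M.map.insertNext M.face (.inl d)) =
          M'.map.insertNext M'.face (.inl (e d))
        rw [RootedMap.insertNext_inl, RootedMap.insertNext_inl]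
        by_cases hd : M.map.faceOf d = M.face
        · rw [dif_pos hd, dif_pos ((hf d).1 hd)]
          exact congrArg Sum.inr (Prod.ext (Subtype.ext (h.2.1 d)) rfl)
        · rw [dif_neg hd, dif_neg (fun h' => hd ((hf d).2 h'))]
          exact congrArg Sum.inl (h.2.1 d)
      · exact congrArg Sum.inr (Prod.ext (Subtype.ext (hs d)) rfl)
      · rfl
    · exact congrArg Sum.inl h.2.2

/-! ## Stack-triangulations -/

/-- `stackTriangulations k` is the set of stack-triangulations with `2 k` faces, for `k ≥ 1`. -/
def stackTriangulations : ℕ → Set MapClass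
  | 0 => ∅
  | 1 => {Quotient.mk _ RootedMap.triangle}
  | k + 2 => {c | ∃ M : MarkedClass, M.map ∈ stackTriangulations (k + 1) ∧ M.grow = c}

/-- `IsMapHistory h c`: the sequence `h = ((m₁, f₁), …, (m_{k-1}, f_{k-1}))` is a history of `c`,
that is, `m₁` is the triangle, `m_{i+1} = Φ(m_i, f_i)` and `c = Φ(m_{k-1}, f_{k-1})`
(`c` is the triangle when `h` is empty). -/
inductive IsMapHistory : List MarkedClass → MapClass → Prop
  | nil : IsMapHistory [] (Quotient.mk _ RootedMap.triangle)
  | snoc (h : List MarkedClass) (M : MarkedClass) :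
      IsMapHistory h M.map → IsMapHistory (h ++ [M]) M.grow

/-- The histories of the stack-triangulations with `2 k` faces. -/
def mapHistories (k : ℕ) : Set (List MarkedClass) :=
  {h | ∃ c ∈ stackTriangulations k, IsMapHistory h c}

/-! ## Trees -/

/-- Words on the positive integers (positivity of the letters is required in `IsPlanarTree`). -/
abbrev Word : Type := List ℕ

/-- Planar trees as sets of words. -/
structure IsPlanarTree (t : Set Word) : Prop where
  root_mem : [] ∈ t
  parent_mem : ∀ (u : Word) (i : ℕ), u ++ [i] ∈ t → u ∈ t
  pos : ∀ (u : Word) (i : ℕ), u ++ [i] ∈ t → 1 ≤ i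
  sibling_mem : ∀ (u : Word) (i : ℕ), u ++ [i] ∈ t → ∀ j, 1 ≤ j → j ≤ i → u ++ [j] ∈ t

/-- The ranks of the children of `u` in `t`. -/
def childRanks (t : Set Word) (u : Word) : Set ℕ := {i | u ++ [i] ∈ t}

/-- The leaves of a tree. -/
def leaves (t : Set Word) : Set Word := {u | u ∈ t ∧ childRanks t u = ∅}

/-- The internal nodes of a tree. -/
def internalNodes (t : Set Word) : Set Word := {u | u ∈ t ∧ childRanks t u ≠ ∅}

/-- The ternary trees with `n` nodes: every node has `0` or `3` children. -/
def ternaryTrees (n : ℕ) : Set (Set Word) :=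
  {t | IsPlanarTree t ∧ (∀ u ∈ t, childRanks t u = ∅ ∨ childRanks t u = {1, 2, 3}) ∧
    t.encard = n}

/-- Replace the leaf `u` by an internal node with three children. -/
def growTree (t : Set Word) (u : Word) : Set Word := t ∪ {u ++ [1], u ++ [2], u ++ [3]}

/-- `IsTreeHistory h t`: the sequence `h = ((t₁, u₁), …, (t_{k-1}, u_{k-1}))` is a history of `t`,
that is, `t₁` is the tree reduced to its root, `u_i` is a leaf of `t_i`, `t_{i+1}` is obtained from
`t_i` by growing `u_i`, and `t` is obtained in this way from the last pair
(`t` is reduced to its root when `h` is empty). -/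
inductive IsTreeHistory : List (Set Word × Word) → Set Word → Prop
  | nil : IsTreeHistory [] {[]}
  | snoc (h : List (Set Word × Word)) (t : Set Word) (u : Word) :
      IsTreeHistory h t → u ∈ leaves t → IsTreeHistory (h ++ [(t, u)]) (growTree t u)

/-- The histories of the ternary trees with `3 k - 2` nodes, for `k ≥ 1`. -/
def treeHistories (k : ℕ) : Set (List (Set Word × Word)) :=
  {h | ∃ t ∈ ternaryTrees (3 * k - 2), IsTreeHistory h t}

/-! ## The passage function -/

/-- `letterIn u a p q`: the letter `a` occurs in `u_{p+1} … u_q` (letters numbered from `1`). -/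
def letterIn (u : Word) (a : ℕ) (p : ℕ∞) (q : ℕ) : Prop :=
  ∃ r : ℕ, p ≤ r ∧ r < q ∧ u[r]? = some a

/-- The times `τ_j(u)`, `j ≥ 1` (the value at `j = 0` is not used), with `inf ∅ = ∞`. -/
noncomputable def tau (u : Word) : ℕ → ℕ∞
  | 0 => 0
  | 1 => 0
  | 2 => sInf {i : ℕ∞ | ∃ n : ℕ, i = n ∧ 0 < n ∧ u[n - 1]? = some 1}
  | j + 3 => sInf {i : ℕ∞ | ∃ n : ℕ, i = n ∧ n ≤ u.length ∧ tau u (j + 2) < n ∧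
      letterIn u 1 (tau u (j + 2)) n ∧ letterIn u 2 (tau u (j + 2)) n ∧
      letterIn u 3 (tau u (j + 2)) n}

/-- The passage function `Γ(u) = max {i | τ_i(u) ≤ |u|}`. -/
noncomputable def passage (u : Word) : ℕ := sSup {i : ℕ | 1 ≤ i ∧ tau u i ≤ u.length}

/-- The longest common prefix of two words. -/
def meet : Word → Word → Word
  | a :: u, b :: v => if a = b then a :: meet u v else []
  | _, _ => []

/-- The two-parameter passage function: `Γ(w a, w b) = Γ(a) + Γ(b)`, where `w` is the longest
common prefix of the two words. -/
noncomputable def passage₂ (u v : Word) : ℕ :=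
  passage (u.drop (meet u v).length) + passage (v.drop (meet u v).length)

/-- The words `a w` where all the letters of `w` lie in `{b, c}`. -/
def startThen (a b c : ℕ) : Set Word := {w | ∃ x : Word, w = a :: x ∧ ∀ i ∈ x, i = b ∨ i = c}

/-- The "binary" forest below the node `u`: the nodes `u w` of `s` with
`w ∈ 1 {2,3}* ∪ 2 {1,3}* ∪ 3 {1,2}*`. -/
def binaryForest (s : Set Word) (u : Word) : Set Word :=
  {v ∈ s | ∃ w ∈ startThen 1 2 3 ∪ startThen 2 1 3 ∪ startThen 3 1 2, v = u ++ w}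

/-! Every triangle that ever appears during the insertions is coded by a word on 1, 2, 3. The empty
word codes the outer triangle. Inserting a vertex in the triangle `u` creates a vertex labelled `u`
and three triangles; in the child of rank `letter s` the new vertex replaces the corner `s`. Finite
faces are then the leaves, internal vertices are the internal nodes, and the corner `s` of a
triangle is the prefix standing before the last occurrence of `letter s` in its word
(`corner_eq_inl_iff`).

A `Coding` labels the darts of a map by the sides of the leaves and of the infinite face. A label is
determined by its two end points (`labels_inj`), which forces the reversal of darts: maps coded by
the same tree are isomorphic, and since rooted maps have no nontrivial automorphism the labelling is
unique. Growing a leaf corresponds to inserting a vertex in the matching face (`Coding.insert`).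
Conversely, a map has only one tree (`Coding.tree_unique`): the vertex inserted last has degree
three, in any other coding it is a node whose children are all leaves, so it can be deleted on both
sides. Hence the tree does not depend on the order of the insertions, and histories correspond pair
by pair.

Degrees: dividing a triangle that has `w` as a corner raises the degree of `w` by one, and the
divided triangles with corner `w` form the binary forest below `w` (`ncard_star`).

Distances: a new vertex lies one step beyond the closest corner of its triangle, so the distances of
the three corners evolve along a word by `step`. Seen from the root vertex they start as 0, 1, 1,
stay so until the letter 1 is read, become 1, 1, 1, and have all increased by one each time the
three letters have been seen again. This is what the passage function counts (`exists_state`,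
`passage_eq_val`). Upper bounds come from explicit paths, lower bounds from functions varying by at
most one along edges (`Coding.sub_le_dist`). For two internal vertices one splits at the longest
common prefix `w`: each remaining word measures, up to one, the distance to the corners of a
triangle below `w`, and the vertex `w` is a corner of these triangles. -/

namespace StackTri

/-- The letter attached to a corner of a triangle. -/
def letter (s : Fin 3) : ℕ := s + 1

@[simp] theorem letter_inj {s s' : Fin 3} : letter s = letter s' ↔ s = s' := by
  simp [letter, Fin.ext_iff]

theorem exists_letter_iff {a : ℕ} : (∃ s, letter s = a) ↔ a ∈ ({1, 2, 3} : Set ℕ) := by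
  constructor
  · rintro ⟨s, rfl⟩
    fin_cases s <;> simp [letter]
  · rintro (rfl | rfl | rfl)
    exacts [⟨0, rfl⟩, ⟨1, rfl⟩, ⟨2, rfl⟩]

/-! ### Corners of the triangle coded by a word -/

/-- Labels of vertices: a word for an internal vertex, an element of `Fin 3` for an outer one. -/
abbrev VLabel : Type := Word ⊕ Fin 3

/-- The corners of the triangle coded by the reversal of a word. -/
def cornerRev : Word → Fin 3 → VLabel
  | [], s => .inr s
  | a :: w, s => if a = letter s then .inl w.reverse else cornerRev w s

/-- The corners of the triangle coded by a word: the child of rank `letter s` of a triangle is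
obtained by replacing the corner `s` by the vertex inserted in the triangle. -/
def corner (u : Word) (s : Fin 3) : VLabel := cornerRev u.reverse s

@[simp] theorem corner_nil (s : Fin 3) : corner [] s = .inr s := rfl

theorem corner_snoc (u : Word) (a : ℕ) (s : Fin 3) :
    corner (u ++ [a]) s = if a = letter s then .inl u else corner u s := by
  simp [corner, cornerRev]

theorem corner_snoc_self (u : Word) (s : Fin 3) : corner (u ++ [letter s]) s = .inl u := by
  simp [corner_snoc]

theorem corner_snoc_of_ne (u : Word) {a : ℕ} {s : Fin 3} (h : a ≠ letter s) :
    corner (u ++ [a]) s = corner u s := by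
  simp [corner_snoc, h]

theorem corner_append_of_notMem (w y : Word) (s : Fin 3) (h : letter s ∉ y) :
    corner (w ++ y) s = corner w s := by
  induction y using List.reverseRecOn with
  | nil => simp
  | append_singleton y a ih =>
    simp only [List.mem_append, List.mem_singleton, not_or] at h
    rw [← List.append_assoc, corner_snoc_of_ne _ (Ne.symm h.2), ih h.1]

theorem corner_append_cons (w y : Word) (s : Fin 3) (h : letter s ∉ y) :
    corner (w ++ letter s :: y) s = .inl w := by
  rw [List.append_cons, corner_append_of_notMem _ _ _ h, corner_snoc_self]

/-- Only the letter `letter s` overwrites the corner `s`, so its last occurrence in the word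
decides. -/
theorem corner_eq_inl_iff {u w : Word} {s : Fin 3} :
    corner u s = .inl w ↔ ∃ y, u = w ++ letter s :: y ∧ letter s ∉ y := by
  constructor
  · intro h
    induction u using List.reverseRecOn with
    | nil => simp at h
    | append_singleton u a ih =>
      rw [corner_snoc] at h
      split_ifs at h with ha
      · cases h
        exact ⟨[], by simp [ha], by simp⟩
      · obtain ⟨y, rfl, hy⟩ := ih h
        exact ⟨y ++ [a], by simp, by simp [hy, Ne.symm ha]⟩
  · rintro ⟨y, rfl, hy⟩
    exact corner_append_cons _ _ _ hy

theorem corner_eq_inr_iff {u : Word} {s i : Fin 3} :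
    corner u s = .inr i ↔ i = s ∧ letter s ∉ u := by
  constructor
  · intro h
    induction u using List.reverseRecOn with
    | nil => simpa [eq_comm] using h
    | append_singleton u a ih =>
      rw [corner_snoc] at h
      split_ifs at h with ha
      have := ih h
      simp [this, Ne.symm ha]
  · rintro ⟨rfl, h⟩
    simpa using corner_append_of_notMem [] u i h

theorem corner_injective (u : Word) : Function.Injective (corner u) := by
  induction u using List.reverseRecOn with
  | nil => exact fun s s' h => by simpa using h
  | append_singleton u a ih =>
    -- Internal corners of `u` are strict prefixes of `u`, so the vertex `u` inserted in it is new.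
    have key : ∀ s, corner u s ≠ .inl u := by
      intro s h
      obtain ⟨y, hy, -⟩ := corner_eq_inl_iff.1 h
      simpa using congrArg List.length hy
    intro s s' h
    rw [corner_snoc, corner_snoc] at h
    split_ifs at h with h1 h2 h2
    · exact letter_inj.1 (h1.symm.trans h2)
    · exact absurd h.symm (key _)
    · exact absurd h (key _)
    · exact ih h

/-! ### Ternary trees -/

/-- Finite ternary trees. -/
structure Tern (t : Set Word) : Prop where
  planar : IsPlanarTree t
  kids : ∀ u ∈ t, childRanks t u = ∅ ∨ childRanks t u = {1, 2, 3}
  finite : t.Finite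

theorem mem_leaves_iff {t : Set Word} {u : Word} : u ∈ leaves t ↔ u ∈ t ∧ ∀ a, u ++ [a] ∉ t := by
  simp [leaves, childRanks, Set.eq_empty_iff_forall_notMem]

theorem mem_internalNodes_iff {t : Set Word} {u : Word} :
    u ∈ internalNodes t ↔ u ∈ t ∧ ∃ a, u ++ [a] ∈ t := by
  simp [internalNodes, childRanks, Set.eq_empty_iff_forall_notMem]

theorem mem_leaves_or {t : Set Word} {u : Word} (h : u ∈ t) :
    u ∈ leaves t ∨ u ∈ internalNodes t := by
  by_cases hc : childRanks t u = ∅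
  · exact .inl ⟨h, hc⟩
  · exact .inr ⟨h, hc⟩

namespace Tern

variable {t : Set Word}

theorem nil_mem (ht : Tern t) : [] ∈ t := ht.planar.root_mem

theorem prefix_mem (ht : Tern t) {u v : Word} (h : u ++ v ∈ t) : u ∈ t := by
  induction v using List.reverseRecOn with
  | nil => simpa using h
  | append_singleton v a ih =>
    rw [← List.append_assoc] at h
    exact ih (ht.planar.parent_mem _ _ h)

theorem exists_letter (ht : Tern t) {u : Word} {a : ℕ} (h : u ++ [a] ∈ t) :
    ∃ s, letter s = a := by
  rw [exists_letter_iff]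
  rcases ht.kids u (ht.prefix_mem h) with h' | h'
  · exact absurd (show a ∈ childRanks t u from h) (by simp [h'])
  · rw [← h']
    exact h

theorem exists_letter_of_mem (ht : Tern t) {u : Word} {a : ℕ} (h : u ∈ t) (ha : a ∈ u) :
    ∃ s, letter s = a := by
  obtain ⟨x, y, rfl⟩ := List.append_of_mem ha
  rw [List.append_cons] at h
  exact ht.exists_letter (ht.prefix_mem h)

theorem snoc_mem (ht : Tern t) {u : Word} (h : u ∈ internalNodes t) (s : Fin 3) :
    u ++ [letter s] ∈ t := by
  rcases ht.kids u h.1 with h' | h'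
  · exact absurd h' h.2
  · have : letter s ∈ childRanks t u := by
      rw [h', ← exists_letter_iff]
      exact ⟨s, rfl⟩
    exact this

theorem mem_internalNodes_of_append (ht : Tern t) {u v : Word} {a : ℕ} (h : u ++ a :: v ∈ t) :
    u ∈ internalNodes t := by
  rw [List.append_cons] at h
  exact mem_internalNodes_iff.2 ⟨ht.prefix_mem (ht.prefix_mem h), a, ht.prefix_mem h⟩

theorem eq_nil_of_leaf (ht : Tern t) {u v : Word} (hu : u ∈ leaves t) (h : u ++ v ∈ t) :
    v = [] := by
  cases v with
  | nil => rfl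
  | cons a v => exact absurd hu.2 (ht.mem_internalNodes_of_append h).2

/-- Descending always through the same letter visits distinct nodes, so finiteness stops the
descent. -/
theorem exists_leaf (ht : Tern t) {w : Word} (hw : w ∈ t) (c : Fin 3) :
    ∃ k, w ++ List.replicate k (letter c) ∈ leaves t := by
  by_contra! hno
  have hall : ∀ k, w ++ List.replicate k (letter c) ∈ t := by
    intro k
    induction k with
    | zero => simpa using hw
    | succ k ih =>
      have := ht.snoc_mem ((mem_leaves_or ih).resolve_left (hno k)) c
      rwa [List.append_assoc, ← List.replicate_succ'] at this
  refine Set.infinite_of_injective_forall_mem (f := fun k => w ++ List.replicate k (letter c))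
    (fun a b hab => ?_) hall ht.finite
  simpa using congrArg List.length hab

/-- Two corners leave a third letter free, and descending along it disturbs neither of them. This is
why a side of an intermediate triangle is still an edge of the final map. -/
theorem exists_leaf_corner (ht : Tern t) {w : Word} (hw : w ∈ t) (s s' : Fin 3) :
    ∃ u ∈ leaves t, corner u s = corner w s ∧ corner u s' = corner w s' := by
  obtain ⟨c, hc, hc'⟩ : ∃ c : Fin 3, c ≠ s ∧ c ≠ s' := by revert s s'; decide
  obtain ⟨k, hk⟩ := ht.exists_leaf hw c
  have : ∀ r, c ≠ r → letter r ∉ List.replicate k (letter c) := by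
    intro r hr h
    exact hr (letter_inj.1 (List.eq_of_mem_replicate h).symm)
  exact ⟨_, hk, corner_append_of_notMem _ _ _ (this _ hc),
    corner_append_of_notMem _ _ _ (this _ hc')⟩

theorem singleton : Tern {[]} where
  planar := ⟨rfl, by simp, by simp, by simp⟩
  kids u hu := .inl (by simp [childRanks])
  finite := Set.finite_singleton _

end Tern

theorem mem_growTree_iff {t : Set Word} {u v : Word} :
    v ∈ growTree t u ↔ v ∈ t ∨ ∃ s, v = u ++ [letter s] := by
  constructor
  · rintro (h | rfl | rfl | rfl)
    exacts [.inl h, .inr ⟨0, rfl⟩, .inr ⟨1, rfl⟩, .inr ⟨2, rfl⟩]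
  · rintro (h | ⟨s, rfl⟩)
    · exact .inl h
    · right
      fin_cases s <;> simp [letter]

theorem snoc_mem_growTree_iff {t : Set Word} {u v : Word} {a : ℕ} :
    v ++ [a] ∈ growTree t u ↔ v ++ [a] ∈ t ∨ (v = u ∧ ∃ s, letter s = a) := by
  rw [mem_growTree_iff]
  refine or_congr_right ⟨?_, ?_⟩
  · rintro ⟨s, h⟩
    obtain ⟨rfl, h⟩ := List.append_inj' h rfl
    exact ⟨rfl, s, by simpa using h.symm⟩
  · rintro ⟨rfl, s, rfl⟩
    exact ⟨s, rfl⟩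

theorem Tern.snoc_snoc_notMem {t : Set Word} (ht : Tern t) {u : Word} (hu : u ∈ leaves t)
    (a b : ℕ) : u ++ [a] ++ [b] ∉ t := fun h =>
  (mem_leaves_iff.1 hu).2 a (ht.prefix_mem h)

theorem childRanks_growTree_self {t : Set Word} {u : Word} (hu : u ∈ leaves t) :
    childRanks (growTree t u) u = {1, 2, 3} := by
  ext a
  change u ++ [a] ∈ growTree t u ↔ _
  simp only [snoc_mem_growTree_iff, (mem_leaves_iff.1 hu).2, exists_letter_iff, true_and, false_or]

theorem childRanks_growTree_of_ne {t : Set Word} {u v : Word} (h : v ≠ u) :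
    childRanks (growTree t u) v = childRanks t v := by
  ext a
  simp [childRanks, snoc_mem_growTree_iff, h]

theorem childRanks_growTree_snoc {t : Set Word} (ht : Tern t) {u : Word} (hu : u ∈ leaves t)
    (a : ℕ) : childRanks (growTree t u) (u ++ [a]) = ∅ := by
  rw [childRanks_growTree_of_ne (by simp)]
  exact Set.eq_empty_of_forall_notMem fun b => ht.snoc_snoc_notMem hu a b

theorem Tern.growTree {t : Set Word} (ht : Tern t) {u : Word} (hu : u ∈ leaves t) :
    Tern (growTree t u) where
  planar := by
    refine ⟨.inl ht.nil_mem, fun v i h => ?_, fun v i h => ?_, fun v i h j hj hji => ?_⟩ <;>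
      rw [snoc_mem_growTree_iff] at h
    · rcases h with h | ⟨rfl, -⟩
      · exact .inl (ht.planar.parent_mem _ _ h)
      · exact .inl hu.1
    · rcases h with h | ⟨rfl, s, rfl⟩
      · exact ht.planar.pos _ _ h
      · simp [letter]
    · rcases h with h | ⟨rfl, s, rfl⟩
      · exact .inl (ht.planar.sibling_mem _ _ h j hj hji)
      · refine snoc_mem_growTree_iff.2 (.inr ⟨rfl, exists_letter_iff.2 ?_⟩)
        have : letter s ≤ 3 := by simp only [letter]; omega
        simp only [Set.mem_insert_iff, Set.mem_singleton_iff]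
        omega
  kids v hv := by
    rcases mem_growTree_iff.1 hv with h | ⟨s, rfl⟩
    · by_cases hvu : v = u
      · subst hvu
        exact .inr (childRanks_growTree_self hu)
      · rw [childRanks_growTree_of_ne hvu]
        exact ht.kids v h
    · exact .inl (childRanks_growTree_snoc ht hu _)
  finite := ht.finite.union (by simp)

theorem leaves_growTree {t : Set Word} (ht : Tern t) {u : Word} (hu : u ∈ leaves t) {v : Word} :
    v ∈ leaves (growTree t u) ↔ (v ∈ leaves t ∧ v ≠ u) ∨ ∃ s, v = u ++ [letter s] := by
  have hnot : ∀ s, u ++ [letter s] ∉ t := fun s => (mem_leaves_iff.1 hu).2 _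
  constructor
  · rintro ⟨h, h'⟩
    by_cases hvu : v = u
    · subst hvu
      rw [childRanks_growTree_self hu] at h'
      exact absurd h' (Set.insert_nonempty _ _).ne_empty
    · rw [childRanks_growTree_of_ne hvu] at h'
      rcases mem_growTree_iff.1 h with h | h
      · exact .inl ⟨⟨h, h'⟩, hvu⟩
      · exact .inr h
  · rintro (⟨h, hvu⟩ | ⟨s, rfl⟩)
    · refine ⟨.inl h.1, ?_⟩
      rw [childRanks_growTree_of_ne hvu]
      exact h.2
    · exact ⟨mem_growTree_iff.2 (.inr ⟨s, rfl⟩), childRanks_growTree_snoc ht hu _⟩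

theorem internalNodes_growTree {t : Set Word} (ht : Tern t) {u : Word} (hu : u ∈ leaves t) :
    internalNodes (growTree t u) = insert u (internalNodes t) := by
  ext v
  rw [Set.mem_insert_iff]
  constructor
  · rintro ⟨h, h'⟩
    by_cases hvu : v = u
    · exact .inl hvu
    · right
      rcases mem_growTree_iff.1 h with h | ⟨s, rfl⟩
      · rw [childRanks_growTree_of_ne hvu] at h'
        exact ⟨h, h'⟩
      · exact absurd (childRanks_growTree_snoc ht hu _) h'
  · rintro (rfl | h)
    · exact ⟨.inl hu.1, by
        rw [childRanks_growTree_self hu]; exact (Set.insert_nonempty _ _).ne_empty⟩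
    · have hvu : v ≠ u := by rintro rfl; exact h.2 hu.2
      exact ⟨.inl h.1, by rw [childRanks_growTree_of_ne hvu]; exact h.2⟩

theorem encard_growTree {t : Set Word} {u : Word} (hu : u ∈ leaves t) :
    (growTree t u).encard = t.encard + 3 := by
  have hnot := (mem_leaves_iff.1 hu).2
  rw [growTree, Set.encard_union_eq]
  · congr 1
    rw [Set.encard_insert_of_notMem (by simp), Set.encard_pair (by simp)]
    norm_num
  · rw [Set.disjoint_left]
    rintro v hv (rfl | rfl | rfl)
    exacts [hnot _ hv, hnot _ hv, hnot _ hv]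

/-- Cutting the children of an internal node all of whose children are leaves. -/
theorem Tern.exists_eq_growTree {t : Set Word} (ht : Tern t) {w : Word} (hw : w ∈ internalNodes t)
    (hc : ∀ s, w ++ [letter s] ∉ internalNodes t) :
    ∃ t₀, Tern t₀ ∧ w ∈ leaves t₀ ∧ t = _root_.growTree t₀ w := by
  set t₀ : Set Word := {v | v ∈ t ∧ ∀ s, v ≠ w ++ [letter s]} with ht₀
  have hsnoc : ∀ v a, v ++ [a] ∈ t → v ∈ t₀ := by
    intro v a h
    refine ⟨ht.prefix_mem h, ?_⟩
    rintro s rfl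
    exact hc s (mem_internalNodes_iff.2 ⟨ht.prefix_mem h, a, h⟩)
  have hne : ∀ v, v ≠ w → ∀ a, v ++ [a] ∈ t₀ ↔ v ++ [a] ∈ t := by
    intro v hv a
    refine ⟨fun h => h.1, fun h => ⟨h, fun s hs => hv (List.append_inj' hs rfl).1⟩⟩
  have hself : ∀ a, w ++ [a] ∉ t₀ := by
    rintro a ⟨h, h'⟩
    obtain ⟨s, rfl⟩ := ht.exists_letter h
    exact h' s rfl
  have hkids : ∀ v, v ≠ w → childRanks t₀ v = childRanks t v := fun v hv =>
    Set.ext fun a => hne v hv a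
  have hwmem : w ∈ t₀ := ⟨hw.1, fun s hs => by simpa using congrArg List.length hs⟩
  refine ⟨t₀, ⟨⟨⟨ht.nil_mem, fun s hs => by simp at hs⟩, fun v i h => hsnoc v i h.1,
    fun v i h => ht.planar.pos v i h.1, fun v i h j hj hji => ?_⟩, fun v hv => ?_,
    ht.finite.subset fun v hv => hv.1⟩, mem_leaves_iff.2 ⟨hwmem, hself⟩, ?_⟩
  · have hvw : v ≠ w := by rintro rfl; exact hself _ h
    exact (hne v hvw j).2 (ht.planar.sibling_mem v i h.1 j hj hji)
  · by_cases hvw : v = w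
    · subst hvw
      exact .inl (Set.eq_empty_of_forall_notMem hself)
    · rw [hkids v hvw]
      exact ht.kids v hv.1
  · ext v
    rw [mem_growTree_iff]
    constructor
    · intro h
      by_cases h' : ∃ s, v = w ++ [letter s]
      · exact .inr h'
      · exact .inl ⟨h, fun s hs => h' ⟨s, hs⟩⟩
    · rintro (h | ⟨s, rfl⟩)
      · exact h.1
      · exact ht.snoc_mem hw s

theorem Tern.eq_singleton {t : Set Word} (ht : Tern t) (h : internalNodes t = ∅) : t = {[]} := by
  ext v
  constructor
  · intro hv
    cases v with
    | nil => rfl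
    | cons a v =>
      have := ht.mem_internalNodes_of_append (u := []) hv
      simp [h] at this
  · rintro rfl
    exact ht.nil_mem

/-- The children of a longest internal node are leaves, hence can be cut. -/
theorem Tern.exists_eq_growTree_of_nonempty {t : Set Word} (ht : Tern t)
    (h : (internalNodes t).Nonempty) :
    ∃ t₀ w, Tern t₀ ∧ w ∈ leaves t₀ ∧ t = _root_.growTree t₀ w := by
  obtain ⟨w, hw, hmax⟩ := Set.exists_max_image (internalNodes t) List.length
    (ht.finite.subset fun v hv => hv.1) h
  obtain ⟨t₀, h⟩ := ht.exists_eq_growTree hw fun s hs => by simpa using hmax _ hs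
  exact ⟨t₀, w, h⟩

theorem Tern.induction {P : Set Word → Prop} (base : P {[]})
    (step : ∀ t u, Tern t → u ∈ leaves t → P t → P (_root_.growTree t u))
    {t : Set Word} (ht : Tern t) : P t := by
  induction hn : t.ncard using Nat.strong_induction_on generalizing t with
  | _ n ih =>
    rcases (internalNodes t).eq_empty_or_nonempty with h | h
    · rw [ht.eq_singleton h]
      exact base
    · obtain ⟨t₀, w, ht₀, hw, rfl⟩ := ht.exists_eq_growTree_of_nonempty h
      refine step _ _ ht₀ hw (ih _ ?_ ht₀ rfl)
      rw [← hn]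
      refine Set.ncard_lt_ncard ⟨fun v hv => .inl hv, fun hsub => ?_⟩ ht.finite
      exact (mem_leaves_iff.1 hw).2 _ (hsub (.inr (.inl rfl)))

/-! ### Sides of the triangles -/

/-- The labels of the darts of the map coded by `t`: the three sides of every leaf, and the three
sides of the infinite face. -/
def labels (t : Set Word) : Set (Option Word × Fin 3) := {p | ∀ u, p.1 = some u → u ∈ leaves t}

/-- The origin of the dart with a given label. -/
def org : Option Word × Fin 3 → VLabel
  -- The infinite face is on the other side of the outer triangle and runs around it in the opposite
  -- direction, hence the sign.
  | (none, s) => .inr (-s)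
  | (some u, s) => corner u s

/-- The label of the next side of the same face. -/
def nxt (p : Option Word × Fin 3) : Option Word × Fin 3 := (p.1, p.2 + 1)

theorem some_mem_labels {t : Set Word} {u : Word} {s : Fin 3} :
    (some u, s) ∈ labels t ↔ u ∈ leaves t :=
  ⟨fun h => h u rfl, fun h v hv => by cases hv; exact h⟩

theorem none_mem_labels {t : Set Word} {s : Fin 3} : (none, s) ∈ labels t :=
  fun _ h => by cases h

theorem eq_replicate_of_notMem {t : Set Word} (ht : Tern t) {s : Fin 3} {x y : Word}
    (h : x ++ y ∈ t) (h0 : letter s ∉ y) (h1 : letter (s + 1) ∉ y) :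
    y = List.replicate y.length (letter (s + 2)) := by
  refine List.eq_replicate_of_mem fun a ha => ?_
  obtain ⟨r, rfl⟩ := ht.exists_letter_of_mem h (List.mem_append_right _ ha)
  have hr0 : r ≠ s := by rintro rfl; exact h0 ha
  have hr1 : r ≠ s + 1 := by rintro rfl; exact h1 ha
  rw [letter_inj]
  clear h0 h1 ha
  revert r s; decide

/-- Avoiding two letters leaves only powers of the third. Two leaves below `x` of this kind are
comparable for the prefix order, hence equal. So a side is kept, on a given side of it, by a single
leaf. -/
theorem leaf_eq_of_notMem {t : Set Word} (ht : Tern t) {s : Fin 3} {x y z : Word}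
    (hy : x ++ y ∈ leaves t) (hz : x ++ z ∈ leaves t) (hy0 : letter s ∉ y)
    (hy1 : letter (s + 1) ∉ y) (hz0 : letter s ∉ z) (hz1 : letter (s + 1) ∉ z) :
    x ++ y = x ++ z := by
  have e1 := eq_replicate_of_notMem ht hy.1 hy0 hy1
  have e2 := eq_replicate_of_notMem ht hz.1 hz0 hz1
  wlog h : y.length ≤ z.length generalizing y z
  · exact (this hz hy hz0 hz1 hy0 hy1 e2 e1 (by omega)).symm
  obtain ⟨k, hk⟩ := Nat.exists_eq_add_of_le h
  have : z = y ++ List.replicate k (letter (s + 2)) := by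
    rw [e2, hk, List.replicate_add, ← e1]
  rw [this, ← List.append_assoc] at hz
  have := ht.eq_nil_of_leaf hy hz.1
  rw [‹z = _›, this, List.append_nil]

theorem append_cons_eq {u w w' y y' : Word} {a b : ℕ} (h : u = w ++ a :: y)
    (h' : u = w' ++ b :: y') (hl : w.length < w'.length) :
    ∃ z, w' = w ++ a :: z ∧ y = z ++ b :: y' := by
  rw [h] at h'
  rcases List.append_eq_append_iff.1 h' with ⟨z, h1, h2⟩ | ⟨z, h1, h2⟩
  · cases z with
    | nil => simp [h1] at hl
    | cons c z =>
      rw [List.cons_append, List.cons.injEq] at h2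
      exact ⟨z, by rw [h1, h2.1], h2.2⟩
  · simp [h1] at hl

/-- A dart is determined by its end points. -/
theorem labels_inj {t : Set Word} (ht : Tern t) {p p' : Option Word × Fin 3} (hp : p ∈ labels t)
    (hp' : p' ∈ labels t) (h : org p = org p') (h1 : org (nxt p) = org (nxt p')) : p = p' := by
  obtain ⟨_ | u, s⟩ := p <;> obtain ⟨_ | u', s'⟩ := p'
  · simpa [org] using h
  -- The infinite face and an inner face run along an outer edge in opposite directions: equal end
  -- points would give 2 = 0 in `Fin 3`.
  · exfalso
    have e0 := (corner_eq_inr_iff.1 h.symm).1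
    have e1 : -(s + 1) = s' + 1 := (corner_eq_inr_iff.1 h1.symm).1
    clear h h1 hp hp'
    revert s s'; decide
  · exfalso
    have e0 := (corner_eq_inr_iff.1 h).1
    have e1 : -(s' + 1) = s + 1 := (corner_eq_inr_iff.1 h1).1
    clear h h1 hp hp'
    revert s s'; decide
  · rw [some_mem_labels] at hp hp'
    change corner u s = corner u' s' at h
    change corner u (s + 1) = corner u' (s' + 1) at h1
    suffices h : u = u' by
      subst h
      rw [corner_injective u h]
    cases e0 : corner u s with
    | inr i =>
      obtain ⟨rfl, hi⟩ := corner_eq_inr_iff.1 e0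
      obtain ⟨rfl, hi'⟩ := corner_eq_inr_iff.1 (h.symm.trans e0)
      cases e1 : corner u (i + 1) with
      | inr j =>
        obtain ⟨-, hj⟩ := corner_eq_inr_iff.1 e1
        obtain ⟨-, hj'⟩ := corner_eq_inr_iff.1 (h1.symm.trans e1)
        exact leaf_eq_of_notMem ht (x := []) hp hp' hi hj hi' hj'
      | inl w =>
        obtain ⟨y, rfl, hy⟩ := corner_eq_inl_iff.1 e1
        obtain ⟨z, rfl, hz⟩ := corner_eq_inl_iff.1 (h1.symm.trans e1)
        simp only [List.mem_append, List.mem_cons, not_or] at hi hi'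
        rw [List.append_cons] at hp hp'
        simpa using leaf_eq_of_notMem ht hp hp' hi.2.2 hy hi'.2.2 hz
    | inl w =>
      obtain ⟨y, hu, hy⟩ := corner_eq_inl_iff.1 e0
      obtain ⟨z, hu', hz⟩ := corner_eq_inl_iff.1 (h.symm.trans e0)
      cases e1 : corner u (s + 1) with
      | inr j =>
        obtain ⟨rfl, hj⟩ := corner_eq_inr_iff.1 e1
        obtain ⟨e, hj'⟩ := corner_eq_inr_iff.1 (h1.symm.trans e1)
        obtain rfl : s = s' := add_right_cancel e
        subst hu hu'
        simp only [List.mem_append, List.mem_cons, not_or] at hj hj'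
        rw [List.append_cons] at hp hp'
        simpa using leaf_eq_of_notMem ht hp hp' hy hj.2.2 hz hj'.2.2
      | inl w' =>
        obtain ⟨y1, hu1, hy1⟩ := corner_eq_inl_iff.1 e1
        obtain ⟨z1, hu1', hz1⟩ := corner_eq_inl_iff.1 (h1.symm.trans e1)
        -- The longer label is the end point inserted later. Both leaves lie below the same child of
        -- it, and beyond that child they avoid the letters of both end points, so
        -- `leaf_eq_of_notMem` applies.
        rcases lt_trichotomy w.length w'.length with hl | hl | hl
        · obtain ⟨x, hx, rfl⟩ := append_cons_eq hu hu1 hl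
          obtain ⟨x', hx', rfl⟩ := append_cons_eq hu' hu1' hl
          obtain rfl : s = s' := by
            rw [hx] at hx'
            simpa using (List.cons.inj (List.append_cancel_left hx')).1
          simp only [List.mem_append, List.mem_cons, not_or] at hy hz
          rw [List.append_cons] at hu1 hu1'
          rw [hu1] at hp ⊢
          rw [hu1'] at hp' ⊢
          exact leaf_eq_of_notMem ht hp hp' hy.2.2 hy1 hz.2.2 hz1
        · have hw : w = w' := (List.append_inj (hu.symm.trans hu1) hl).1
          subst hw
          exact absurd (corner_injective u (e0.trans e1.symm)) (by simp)
        · obtain ⟨x, hx, rfl⟩ := append_cons_eq hu1 hu hl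
          obtain ⟨x', hx', rfl⟩ := append_cons_eq hu1' hu' hl
          obtain rfl : s = s' := by
            rw [hx] at hx'
            simpa using (List.cons.inj (List.append_cancel_left hx')).1
          simp only [List.mem_append, List.mem_cons, not_or] at hy1 hz1
          rw [List.append_cons] at hu hu'
          rw [hu] at hp ⊢
          rw [hu'] at hp' ⊢
          exact leaf_eq_of_notMem ht hp hp' hy hy1.2.2 hz hz1.2.2

/-! ### Generalities on rooted maps -/

section RootedMap

variable {m m' : RootedMap}

theorem origin_eq_iff_sameCycle {d d' : m.Dart} :
    m.origin d = m.origin d' ↔ (m.inv * m.next⁻¹).SameCycle d d' :=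
  Quotient.eq (r := Equiv.Perm.SameCycle.setoid (m.inv * m.next⁻¹))

theorem faceOf_eq_iff_sameCycle {d d' : m.Dart} :
    m.faceOf d = m.faceOf d' ↔ m.next.SameCycle d d' :=
  Quotient.eq (r := Equiv.Perm.SameCycle.setoid m.next)

theorem origin_surjective (v : m.Vertex) : ∃ d, m.origin d = v := Quotient.exists_rep v

theorem faceOf_surjective (f : m.Face) : ∃ d, m.faceOf d = f := Quotient.exists_rep f

/-- Both darts leave the end point of `d`: one rotation takes `next d` to `inv d`. -/
theorem origin_inv (d : m.Dart) : m.origin (m.inv d) = m.origin (m.next d) := by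
  rw [origin_eq_iff_sameCycle]
  have : m.inv d = (m.inv * m.next⁻¹) (m.next d) := by simp
  rw [this]
  exact Equiv.Perm.sameCycle_apply_left.2 (.refl _ _)

theorem eq_of_sameCycle {D X : Type} {p : Equiv.Perm D} {g : D → X} (h : ∀ d, g (p d) = g d)
    {a b : D} (hab : p.SameCycle a b) : g a = g b := by
  simpa using RootedMap.sameCycle_map p (1 : Equiv.Perm X) g (fun d => by rw [h]) hab

/-- A function of darts that agrees on `inv d` and `next d` is a function of the origin. -/
theorem eq_of_origin_eq {X : Type} {g : m.Dart → X} (h : ∀ d, g (m.inv d) = g (m.next d))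
    {a b : m.Dart} (hab : m.origin a = m.origin b) : g a = g b := by
  refine eq_of_sameCycle (fun d => ?_) (origin_eq_iff_sameCycle.1 hab)
  rw [Equiv.Perm.mul_apply, h]
  simp

theorem eq_of_faceOf_eq {X : Type} {g : m.Dart → X} (h : ∀ d, g (m.next d) = g d)
    {a b : m.Dart} (hab : m.faceOf a = m.faceOf b) : g a = g b :=
  eq_of_sameCycle h (faceOf_eq_iff_sameCycle.1 hab)

theorem iso_origin {e : m.Dart ≃ m'.Dart} (he : RootedMap.Iso m m' e) {a b : m.Dart} :
    m'.origin (e a) = m'.origin (e b) ↔ m.origin a = m.origin b := by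
  constructor
  · intro h
    have := eq_of_origin_eq (g := fun d => m.origin (e.symm d))
      (fun d => by rw [he.symm.1, he.symm.2.1, origin_inv]) h
    simpa using this
  · exact fun h => eq_of_origin_eq (g := fun d => m'.origin (e d))
      (fun d => by rw [he.1, he.2.1, origin_inv]) h

theorem dart_induction {P : m.Dart → Prop} {d₀ : m.Dart} (h₀ : P d₀)
    (hinv : ∀ d, P d ↔ P (m.inv d)) (hnext : ∀ d, P d ↔ P (m.next d)) (d : m.Dart) : P d := by
  have : ∀ a b, Relation.EqvGen (fun a b => b = m.inv a ∨ b = m.next a) a b → (P a ↔ P b) := by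
    intro a b h
    induction h with
    | rel a b h =>
      rcases h with rfl | rfl
      exacts [hinv a, hnext a]
    | refl => rfl
    | symm _ _ _ ih => exact ih.symm
    | trans _ _ _ _ _ h1 h2 => exact h1.trans h2
  exact (this _ _ (m.connected d₀ d)).1 h₀

end RootedMap

/-! ### Codings of a map by a tree -/

/-- `lab` codes the map `m` by the tree `t`: the finite faces of `m` are coded by the leaves of
`t` and the darts by the sides of the leaves, in such a way that vertices are determined by the
corners of the leaves. -/
structure Coding (m : RootedMap) (t : Set Word) (lab : m.Dart → Option Word × Fin 3) : Prop where
  bij : Set.BijOn lab Set.univ (labels t)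
  next : ∀ d, lab (m.next d) = nxt (lab d)
  root : lab (m.inv m.root) = (none, 2)
  inv : ∀ d, org (lab (m.inv d)) = org (lab (m.next d))
  vert : ∀ d d', org (lab d) = org (lab d') → m.origin d = m.origin d'

namespace Coding

variable {m m' : RootedMap} {t : Set Word} {lab : m.Dart → Option Word × Fin 3}

theorem mem (h : Coding m t lab) (d : m.Dart) : lab d ∈ labels t := h.bij.mapsTo trivial

theorem injective (h : Coding m t lab) : Function.Injective lab :=
  fun _ _ hab => h.bij.injOn trivial trivial hab

theorem exists_dart (h : Coding m t lab) {p : Option Word × Fin 3} (hp : p ∈ labels t) :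
    ∃ d, lab d = p := by
  obtain ⟨d, -, hd⟩ := h.bij.surjOn hp
  exact ⟨d, hd⟩

theorem origin_eq_iff (h : Coding m t lab) {d d' : m.Dart} :
    m.origin d = m.origin d' ↔ org (lab d) = org (lab d') :=
  ⟨fun hd => eq_of_origin_eq (g := fun d => org (lab d)) h.inv hd, h.vert d d'⟩

theorem faceOf_eq_iff (h : Coding m t lab) {d d' : m.Dart} :
    m.faceOf d = m.faceOf d' ↔ (lab d).1 = (lab d').1 := by
  refine ⟨fun hd => eq_of_faceOf_eq (g := fun d => (lab d).1) (fun d => by rw [h.next]; rfl) hd,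
    fun hd => ?_⟩
  have h1 : lab (m.next d) = ((lab d).1, (lab d).2 + 1) := h.next d
  have h2 : lab (m.next (m.next d)) = ((lab d).1, (lab d).2 + 2) := by
    rw [h.next, h1, nxt]
    simp only [add_assoc]
    rfl
  -- At most two applications of `next` reach any side with the same first component.
  have h3 : (lab d').2 = (lab d).2 ∨ (lab d').2 = (lab d).2 + 1 ∨ (lab d').2 = (lab d).2 + 2 := by
    generalize (lab d').2 = s'
    generalize (lab d).2 = s
    revert s s'; decide
  rcases h3 with h3 | h3 | h3
  · rw [h.injective (Prod.ext hd h3.symm)]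
  · rw [h.injective (h1.trans (Prod.ext hd h3.symm)).symm, RootedMap.faceOf_next]
  · rw [h.injective (h2.trans (Prod.ext hd h3.symm)).symm, RootedMap.faceOf_next,
      RootedMap.faceOf_next]

theorem congr (h : Coding m t lab) {e : m'.Dart ≃ m.Dart} (he : RootedMap.Iso m' m e) :
    Coding m' t (lab ∘ e) where
  bij := h.bij.comp (Set.bijOn_univ.2 e.bijective)
  next d := by rw [Function.comp_apply, he.2.1, h.next]; rfl
  root := by rw [Function.comp_apply, he.1, he.2.2, h.root]
  inv d := by rw [Function.comp_apply, Function.comp_apply, he.1, he.2.1, h.inv]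
  vert d d' hd := (iso_origin he).1 (h.vert _ _ hd)

/-- Two maps coded by the same tree are isomorphic. -/
theorem exists_iso (ht : Tern t) (h : Coding m t lab) {lab' : m'.Dart → Option Word × Fin 3}
    (h' : Coding m' t lab') : ∃ e, RootedMap.Iso m m' e ∧ ∀ d, lab' (e d) = lab d := by
  choose g hg using fun d => h'.exists_dart (h.mem d)
  have hbij : Function.Bijective g := by
    refine ⟨fun a b hab => h.injective (by rw [← hg, hab, hg]), fun d' => ?_⟩
    obtain ⟨d, hd⟩ := h.exists_dart (h'.mem d')
    exact ⟨d, h'.injective ((hg d).trans hd)⟩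
  have hnext : ∀ d, g (m.next d) = m'.next (g d) := fun d =>
    h'.injective (by rw [hg, h.next, h'.next, hg])
  -- A coding prescribes only the end points of a reversed dart; `labels_inj` shows that this is
  -- enough.
  have hinv : ∀ d, g (m.inv d) = m'.inv (g d) := by
    refine fun d => h'.injective (labels_inj ht (h'.mem _) (h'.mem _) ?_ ?_)
    · rw [hg, h.inv, h'.inv, h.next, h'.next, hg]
    · have e1 := h.inv (m.inv d)
      have e2 := h'.inv (m'.inv (g d))
      rw [m.inv_inv] at e1
      rw [m'.inv_inv] at e2
      rw [hg, ← h.next, ← h'.next, ← e1, ← e2, hg]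
  refine ⟨Equiv.ofBijective g hbij, ⟨hinv, hnext, ?_⟩, hg⟩
  show g m.root = m'.root
  have : g (m.inv m.root) = m'.inv m'.root := h'.injective (by rw [hg, h.root, h'.root])
  rw [hinv] at this
  exact m'.inv.injective this

/-- A map has at most one coding by a given tree. -/
theorem lab_unique (ht : Tern t) (h : Coding m t lab) {lab' : m.Dart → Option Word × Fin 3}
    (h' : Coding m t lab') : lab = lab' := by
  obtain ⟨e, he, hlab⟩ := h.exists_iso ht h'
  -- Rigidity: an automorphism fixing the root fixes every dart, by connectedness.
  have : ∀ d, e d = d := by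
    refine dart_induction he.2.2 (fun d => ?_) (fun d => ?_)
    · rw [he.1, m.inv.apply_eq_iff_eq]
    · rw [he.2.1, m.next.apply_eq_iff_eq]
  funext d
  rw [← hlab, this]

theorem ne_outerFace_iff (h : Coding m t lab) {d : m.Dart} :
    m.faceOf d ≠ m.outerFace ↔ ∃ u, (lab d).1 = some u := by
  rw [← Option.ne_none_iff_exists', RootedMap.outerFace, Ne, Ne, h.faceOf_eq_iff, h.root]

/-- The coding of the triangle. -/
def triangleLab (d : Fin 3 × Bool) : Option Word × Fin 3 :=
  if d.2 then (some [], d.1) else (none, -(d.1 + 1))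

theorem triangle : Coding RootedMap.triangle {[]} triangleLab where
  bij := by
    have hl : ([] : Word) ∈ leaves {[]} := mem_leaves_iff.2 (by simp)
    refine ⟨?_, ?_, ?_⟩
    · rintro ⟨i, _ | _⟩ -
      · exact none_mem_labels
      · exact some_mem_labels.2 hl
    · rintro ⟨i, _ | _⟩ - ⟨j, _ | _⟩ - h <;> simp [triangleLab] at h <;> rw [h]
    · rintro ⟨_ | u, s⟩ h
      · exact ⟨(-s - 1, false), trivial, by simp [triangleLab]⟩
      · obtain rfl : u = [] := (h u rfl).1
        exact ⟨(s, true), trivial, rfl⟩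
  next := by
    rintro ⟨i, _ | _⟩
    · show ((none, -(i - 1 + 1)) : Option Word × Fin 3) = (none, -(i + 1) + 1)
      congr 1; abel
    · rfl
  root := rfl
  inv := by
    rintro ⟨i, _ | _⟩
    · show (Sum.inr i : VLabel) = Sum.inr (- -(i - 1 + 1))
      simp
    · show (Sum.inr (- -(i + 1)) : VLabel) = Sum.inr (i + 1)
      simp
  vert := by
    have key : ∀ d, org (triangleLab d) = Sum.inr (if d.2 then d.1 else d.1 + 1) := by
      rintro ⟨i, _ | _⟩
      · show (Sum.inr (- -(i + 1)) : VLabel) = _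
        simp
      · rfl
    intro d d' h
    replace h := Sum.inr.inj ((key d).symm.trans (h.trans (key d')))
    have h3 : ∀ a b : RootedMap.triangle.Dart, (b = a ∨
        b = (RootedMap.triangle.inv * RootedMap.triangle.next⁻¹) a) →
        RootedMap.triangle.origin a = RootedMap.triangle.origin b := by
      rintro a b (rfl | rfl)
      · rfl
      · exact origin_eq_iff_sameCycle.2 (Equiv.Perm.sameCycle_apply_right.2 (.refl _ _))
    refine h3 d d' ?_
    change Fin 3 × Bool at d d'
    change d' = d ∨ d' = (fun d => ((if d.2 then d.1 - 1 else d.1 + 1, !d.2) : Fin 3 × Bool)) d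
    revert d d'; decide

/-! ### Insertion of a vertex -/

open Classical in
/-- The labels of the darts after the insertion of a vertex in the face `f` with label `u`. -/
noncomputable def insertLab (lab : m.Dart → Option Word × Fin 3) (f : m.Face) (u : Word) :
    m.InsertDart f → Option Word × Fin 3
  -- The triangle over the side from corner `s` to corner `s + 1` keeps these corners and loses the
  -- corner `s + 2`. The dart `(d, false)` lies in the triangle over the preceding side, whence the
  -- letter of `s + 1`.
  | .inl d => if m.faceOf d = f then (some (u ++ [letter ((lab d).2 + 2)]), (lab d).2) else lab d
  | .inr (d, true) => (some (u ++ [letter ((lab d).2 + 2)]), (lab d).2 + 2)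
  | .inr (d, false) => (some (u ++ [letter ((lab d).2 + 1)]), (lab d).2)

section insert

variable {f : m.Face} {u : Word}

theorem insertLab_inl_pos {d : m.Dart} (h : m.faceOf d = f) : insertLab lab f u (.inl d) =
    (some (u ++ [letter ((lab d).2 + 2)]), (lab d).2) := if_pos h

theorem insertLab_inl_neg {d : m.Dart} (h : m.faceOf d ≠ f) :
    insertLab lab f u (.inl d) = lab d := if_neg h

theorem org_eq_corner {p : Option Word × Fin 3} (hp : p.1 = some u) : org p = corner u p.2 := by
  obtain ⟨_, s⟩ := p
  cases hp
  rfl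

theorem org_insertLab_inl (hf : ∀ d, m.faceOf d = f ↔ (lab d).1 = some u) (d : m.Dart) :
    org (insertLab lab f u (.inl d)) = org (lab d) := by
  by_cases h : m.faceOf d = f
  · rw [insertLab_inl_pos h, org_eq_corner ((hf d).1 h)]
    exact corner_snoc_of_ne _ (by simp)
  · rw [insertLab_inl_neg h]

theorem org_insertLab_false (hf : ∀ d, m.faceOf d = f ↔ (lab d).1 = some u)
    (d : {d // m.faceOf d = f}) :
    org (insertLab lab f u (.inr (d, false))) = org (lab d) := by
  rw [org_eq_corner ((hf d).1 d.2)]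
  exact corner_snoc_of_ne _ (by simp)

theorem org_insertLab_true (d : {d // m.faceOf d = f}) :
    org (insertLab lab f u (.inr (d, true))) = .inl u := corner_snoc_self _ _

/-- A leaf is not a strict prefix of a node, so its word is still free to name the vertex to be
inserted. -/
theorem org_ne_leaf (ht : Tern t) (hu : u ∈ leaves t) {p : Option Word × Fin 3}
    (hp : p ∈ labels t) : org p ≠ .inl u := by
  obtain ⟨_ | v, s⟩ := p
  · simp [org]
  · rw [some_mem_labels] at hp
    intro h
    obtain ⟨y, rfl, -⟩ := corner_eq_inl_iff.1 h
    exact absurd hu.2 (ht.mem_internalNodes_of_append hp.1).2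

/-- After a side of `f` the next dart is now a spoke, but this spoke leaves the same vertex as the
old successor. So the insertion does not split old vertices. -/
theorem insert_origin_inl {d d' : m.Dart} (h : m.origin d = m.origin d') :
    (m.insert f).origin (.inl d) = (m.insert f).origin (.inl d') := by
  refine eq_of_origin_eq (m := m) (g := fun d => (m.insert f).origin (.inl d)) (fun d => ?_) h
  have h1 : (m.insert f).origin (.inl (m.inv d)) =
    (m.insert f).origin ((m.insert f).next (.inl d)) := origin_inv (m := m.insert f) (.inl d)
  rw [h1]
  change (m.insert f).origin (m.insertNext f (.inl d)) = _
  rw [RootedMap.insertNext_inl]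
  split_ifs with hd
  · exact origin_inv (m := m.insert f) (.inr (⟨m.next d, (RootedMap.faceOf_next d).trans hd⟩, true))
  · rfl

theorem insert_origin_false (d : {d // m.faceOf d = f}) :
    (m.insert f).origin (.inr (d, false)) = (m.insert f).origin (.inl d.1) :=
  origin_inv (m := m.insert f) (.inr (d, true))

theorem insert_origin_true (d d' : {d // m.faceOf d = f}) :
    (m.insert f).origin (.inr (d, true)) = (m.insert f).origin (.inr (d', true)) := by
  have h : ∀ a : {d // m.faceOf d = f}, (m.insert f).origin (.inr (a, true)) =
      (m.insert f).origin (.inr (⟨m.next.symm a, (RootedMap.faceOf_next_symm _).trans a.2⟩, true)) :=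
    fun a => origin_inv (m := m.insert f) (.inr (a, false))
  have key : ∀ a b, m.faceOf a = m.faceOf b → ∀ ha hb, (m.insert f).origin (.inr (⟨a, ha⟩, true)) =
      (m.insert f).origin (.inr (⟨b, hb⟩, true)) := by
    classical
    intro a b hab ha hb
    have := eq_of_faceOf_eq (m := m) (g := fun d => if hd : m.faceOf d = f then
      (m.insert f).origin (.inr (⟨d, hd⟩, true)) else (m.insert f).origin (.inl a)) (fun d => ?_) hab
    · simpa [ha, hb] using this
    · by_cases hd : m.faceOf d = f
      · have hd' := (RootedMap.faceOf_next d).trans hd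
        rw [dif_pos hd, dif_pos hd', h ⟨m.next d, hd'⟩]
        simp
      · rw [dif_neg hd, dif_neg (by rwa [RootedMap.faceOf_next])]
  exact key _ _ (d.2.trans d'.2.symm) _ _

/-- The inductive step of the correspondence. Labels outside `f` are kept, while the three sides of
`f` and the six new darts receive the nine sides of the children of `u`. End points of old darts
keep their labels, and the new vertex takes the label `u`. -/
theorem insert (ht : Tern t) (hu : u ∈ leaves t) (h : Coding m t lab)
    (hf : ∀ d, m.faceOf d = f ↔ (lab d).1 = some u) :
    Coding (m.insert f) (growTree t u) (insertLab lab f u) := by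
  have hnu : ∀ s, u ++ [letter s] ∉ leaves t := fun s hs => (mem_leaves_iff.1 hu).2 _ hs.1
  have hdart : ∀ s, ∃ d : {d // m.faceOf d = f}, (lab d).2 = s := by
    intro s
    obtain ⟨d, hd⟩ := h.exists_dart (some_mem_labels (s := s).2 hu)
    exact ⟨⟨d, (hf d).2 (by rw [hd])⟩, by rw [hd]⟩
  have hsub : ∀ d d' : {d // m.faceOf d = f}, (lab d).2 = (lab d').2 → d = d' := fun d d' e =>
    Subtype.ext (h.injective (Prod.ext (((hf d).1 d.2).trans ((hf d').1 d'.2).symm) e))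
  refine ⟨⟨?_, ?_, ?_⟩, ?_, ?_, ?_, ?_⟩
  · rintro (d | ⟨d, _ | _⟩) -
    · by_cases hd : m.faceOf d = f
      · rw [insertLab_inl_pos hd, some_mem_labels, leaves_growTree ht hu]
        exact .inr ⟨_, rfl⟩
      · rw [insertLab_inl_neg hd]
        intro v hv
        rw [leaves_growTree ht hu]
        refine .inl ⟨h.mem d v hv, ?_⟩
        rintro rfl
        exact hd ((hf d).2 hv)
    · exact some_mem_labels.2 ((leaves_growTree ht hu).2 (.inr ⟨_, rfl⟩))
    · exact some_mem_labels.2 ((leaves_growTree ht hu).2 (.inr ⟨_, rfl⟩))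
  · have hold : ∀ (d : m.Dart) s s', lab d ≠ (some (u ++ [letter s]), s') := by
      intro d s s' e
      exact hnu s (some_mem_labels.1 (e ▸ h.mem d))
    have hpair : ∀ {s r s' r' : Fin 3}, ((some (u ++ [letter s]), r) : Option Word × Fin 3) =
        (some (u ++ [letter s']), r') → s = s' ∧ r = r' := by
      intro s r s' r' e
      simpa using e
    -- Below `u` the difference between the corner replaced and the index of the side tells the
    -- three kinds of darts apart: 2 for the sides of `f`, 1 for the darts into the new vertex, 0
    -- for those out of it.
    rintro (d | ⟨d, _ | _⟩) - (d' | ⟨d', _ | _⟩) - e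
    · by_cases hd : m.faceOf d = f <;> by_cases hd' : m.faceOf d' = f
      · rw [insertLab_inl_pos hd, insertLab_inl_pos hd'] at e
        have := hsub ⟨d, hd⟩ ⟨d', hd'⟩ (hpair e).2
        rw [Subtype.mk.injEq] at this
        rw [this]
      · rw [insertLab_inl_pos hd, insertLab_inl_neg hd'] at e
        exact absurd e.symm (hold _ _ _)
      · rw [insertLab_inl_neg hd, insertLab_inl_pos hd'] at e
        exact absurd e (hold _ _ _)
      · rw [insertLab_inl_neg hd, insertLab_inl_neg hd'] at e
        rw [h.injective e]
    · by_cases hd : m.faceOf d = f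
      · rw [insertLab_inl_pos hd] at e
        obtain ⟨e1, e2⟩ := hpair e
        rw [e2] at e1
        simp at e1
      · rw [insertLab_inl_neg hd] at e
        exact absurd e (hold _ _ _)
    · by_cases hd : m.faceOf d = f
      · rw [insertLab_inl_pos hd] at e
        obtain ⟨e1, e2⟩ := hpair e
        rw [e2] at e1
        simp at e1
      · rw [insertLab_inl_neg hd] at e
        exact absurd e (hold _ _ _)
    · by_cases hd : m.faceOf d' = f
      · rw [insertLab_inl_pos hd] at e
        obtain ⟨e1, e2⟩ := hpair e
        rw [e2] at e1
        simp at e1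
      · rw [insertLab_inl_neg hd] at e
        exact absurd e.symm (hold _ _ _)
    · rw [hsub d d' (hpair e).2]
    · obtain ⟨e1, e2⟩ := hpair e
      rw [e2] at e1
      simp [add_assoc] at e1
    · by_cases hd : m.faceOf d' = f
      · rw [insertLab_inl_pos hd] at e
        obtain ⟨e1, e2⟩ := hpair e
        rw [← e2] at e1
        simp at e1
      · rw [insertLab_inl_neg hd] at e
        exact absurd e.symm (hold _ _ _)
    · obtain ⟨e1, e2⟩ := hpair e
      rw [← e2] at e1
      simp [add_assoc] at e1
    · rw [hsub d d' (add_right_cancel (hpair e).2)]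
  · rintro ⟨_ | v, s⟩ hp
    · obtain ⟨d, hd⟩ := h.exists_dart (none_mem_labels (t := t) (s := s))
      refine ⟨.inl d, trivial, ?_⟩
      rw [insertLab_inl_neg (fun h' => by have := (hf d).1 h'; rw [hd] at this; cases this), hd]
    · rw [some_mem_labels, leaves_growTree ht hu] at hp
      rcases hp with ⟨hv, hvu⟩ | ⟨r, rfl⟩
      · obtain ⟨d, hd⟩ := h.exists_dart (some_mem_labels (s := s).2 hv)
        refine ⟨.inl d, trivial, ?_⟩
        rw [insertLab_inl_neg (fun h' => hvu ?_), hd]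
        have := (hf d).1 h'
        rw [hd] at this
        exact Option.some.inj this
      · have hr : r = s + 2 ∨ r = s ∨ r = s + 1 := by revert r s; decide
        rcases hr with rfl | rfl | rfl
        · obtain ⟨d, rfl⟩ := hdart s
          exact ⟨.inl d, trivial, insertLab_inl_pos d.2⟩
        · obtain ⟨d, hd⟩ := hdart (r + 1)
          have : r + 1 + 2 = r := by clear hd; revert r; decide
          exact ⟨.inr (d, true), trivial, by rw [insertLab, hd, this]⟩
        · obtain ⟨d, rfl⟩ := hdart s
          exact ⟨.inr (d, false), trivial, rfl⟩
  · have hn : ∀ d, (lab (m.next d)).2 = (lab d).2 + 1 := fun d => by rw [h.next]; rfl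
    have hs : ∀ d, (lab (m.next.symm d)).2 = (lab d).2 + 2 := fun d => by
      have := hn (m.next.symm d)
      rw [Equiv.apply_symm_apply] at this
      rw [this]
      generalize (lab (m.next.symm d)).2 = s
      revert s; decide
    have h3 : ∀ s : Fin 3, s + 2 + 1 = s := by decide
    have h4 : ∀ s : Fin 3, s + 1 + 1 = s + 2 := by decide
    have h5 : ∀ s : Fin 3, s + 2 + 2 = s + 1 := by decide
    rintro (d | ⟨d, _ | _⟩)
    · change insertLab lab f u (m.insertNext f (.inl d)) = _
      rw [RootedMap.insertNext_inl]
      by_cases hd : m.faceOf d = f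
      · rw [dif_pos hd, insertLab_inl_pos hd]
        simp only [insertLab, nxt, hn, h4]
      · rw [dif_neg hd, insertLab_inl_neg hd, insertLab_inl_neg (by rwa [RootedMap.faceOf_next]),
          h.next]
    · change insertLab lab f u (m.insertNext f (.inr (d, false))) = _
      rw [RootedMap.insertNext_inr_false]
      simp only [insertLab, nxt, hs, h5]
    · change insertLab lab f u (.inl d.1) = _
      rw [insertLab_inl_pos d.2]
      simp only [insertLab, nxt, h3]
  · change insertLab lab f u (.inl (m.inv m.root)) = _
    rw [insertLab_inl_neg, h.root]
    intro h'
    have := (hf _).1 h'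
    rw [h.root] at this
    cases this
  · rintro (d | ⟨d, _ | _⟩)
    · change org (insertLab lab f u (.inl (m.inv d))) = org (insertLab lab f u (m.insertNext f (.inl d)))
      rw [org_insertLab_inl hf, RootedMap.insertNext_inl]
      by_cases hd : m.faceOf d = f
      · rw [dif_pos hd, org_insertLab_false hf, h.inv]
      · rw [dif_neg hd, org_insertLab_inl hf, h.inv]
    · change org (insertLab lab f u (.inr (d, true))) = org (insertLab lab f u (.inr (_, true)))
      rw [org_insertLab_true, org_insertLab_true]
    · change org (insertLab lab f u (.inr (d, false))) = org (insertLab lab f u (.inl d.1))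
      rw [org_insertLab_false hf, org_insertLab_inl hf]
  · have hne := fun d => org_ne_leaf ht hu (h.mem d)
    rintro (d | ⟨d, _ | _⟩) (d' | ⟨d', _ | _⟩) e <;>
      simp only [org_insertLab_inl hf, org_insertLab_false hf, org_insertLab_true] at e
    · exact insert_origin_inl (h.vert _ _ e)
    · exact (insert_origin_inl (h.vert _ _ e)).trans (insert_origin_false d').symm
    · exact absurd e (hne _)
    · exact (insert_origin_false d).trans (insert_origin_inl (h.vert _ _ e))
    · exact (insert_origin_false d).trans
        ((insert_origin_inl (h.vert _ _ e)).trans (insert_origin_false d').symm)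
    · exact absurd e (hne _)
    · exact absurd e.symm (hne _)
    · exact absurd e.symm (hne _)
    · exact insert_origin_true _ _

end insert

/-- The face with label `u`. -/
theorem exists_face (h : Coding m t lab) {u : Word} (hu : u ∈ leaves t) :
    ∃ f ∈ m.finiteFaces, ∀ d, m.faceOf d = f ↔ (lab d).1 = some u := by
  obtain ⟨d₀, hd₀⟩ := h.exists_dart (some_mem_labels (s := 0).2 hu)
  refine ⟨m.faceOf d₀, h.ne_outerFace_iff.2 ⟨u, by rw [hd₀]⟩, fun d => ?_⟩
  rw [h.faceOf_eq_iff, hd₀]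

/-- The label of a finite face. -/
theorem exists_label (h : Coding m t lab) {f : m.Face} (hf : f ∈ m.finiteFaces) :
    ∃ u ∈ leaves t, ∀ d, m.faceOf d = f ↔ (lab d).1 = some u := by
  obtain ⟨d₀, rfl⟩ := faceOf_surjective f
  obtain ⟨u, hu⟩ := h.ne_outerFace_iff.1 hf
  exact ⟨u, h.mem d₀ u hu, fun d => by rw [h.faceOf_eq_iff, hu]⟩

/-- Every ternary tree codes a map. -/
theorem exists_coding (ht : Tern t) : ∃ (m : RootedMap) (lab : _), Coding m t lab := by
  refine ht.induction (P := fun t => ∃ (m : RootedMap) (lab : _), Coding m t lab)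
    ⟨_, _, triangle⟩ ?_
  rintro t u ht hu ⟨m, lab, h⟩
  obtain ⟨f, -, hf⟩ := h.exists_face hu
  exact ⟨_, _, h.insert ht hu hf⟩

end Coding

/-! ### Degrees -/

/-- The darts around the vertex with label `w`. -/
def star (t : Set Word) (w : Word) : Set (Option Word × Fin 3) := {p ∈ labels t | org p = .inl w}

theorem none_notMem_star {t : Set Word} {w : Word} {s : Fin 3} : (none, s) ∉ star t w := by
  rintro ⟨-, h⟩
  simp [org] at h

theorem some_mem_star {t : Set Word} {u w : Word} {s : Fin 3} :
    (some u, s) ∈ star t w ↔ u ∈ leaves t ∧ corner u s = .inl w :=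
  and_congr some_mem_labels Iff.rfl

theorem finite_labels {t : Set Word} (ht : Tern t) : (labels t).Finite := by
  refine ((((ht.finite.subset fun u hu => hu.1 : (leaves t).Finite).image some).union
    (Set.finite_singleton none)).prod (Set.finite_univ (α := Fin 3))).subset ?_
  rintro ⟨_ | u, s⟩ h
  · exact ⟨.inr rfl, trivial⟩
  · exact ⟨.inl ⟨u, h u rfl, rfl⟩, trivial⟩

/-- The words allowed in the forest are those whose first letter does not recur, which is the
condition for `w` to survive as a corner. -/
theorem mem_binaryForest_iff {t : Set Word} (ht : Tern t) {v w : Word} :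
    v ∈ binaryForest (internalNodes t) w ↔
      v ∈ internalNodes t ∧ ∃ s, corner v s = .inl w := by
  have key : ∀ (s : Fin 3) (y : Word), letter s :: y ∈ startThen 1 2 3 ∪ startThen 2 1 3 ∪
      startThen 3 1 2 ↔ ∀ a ∈ y, ∃ r ≠ s, letter r = a := by
    intro s y
    fin_cases s <;> simp [startThen, letter, Fin.exists_fin_succ, eq_comm]
  refine and_congr_right fun hv => ⟨?_, ?_⟩
  · rintro ⟨x, hx, rfl⟩
    have : ∃ s y, x = letter s :: y := by
      rcases hx with (⟨y, rfl, -⟩ | ⟨y, rfl, -⟩) | ⟨y, rfl, -⟩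
      exacts [⟨0, y, rfl⟩, ⟨1, y, rfl⟩, ⟨2, y, rfl⟩]
    obtain ⟨s, y, rfl⟩ := this
    refine ⟨s, corner_append_cons _ _ _ fun h => ?_⟩
    obtain ⟨r, hr, h⟩ := (key s y).1 hx _ h
    exact hr (letter_inj.1 h)
  · rintro ⟨s, hs⟩
    obtain ⟨y, rfl, hy⟩ := corner_eq_inl_iff.1 hs
    refine ⟨_, (key s y).2 fun a ha => ?_, rfl⟩
    obtain ⟨r, rfl⟩ := ht.exists_letter_of_mem hv.1 (by simp [ha] : a ∈ w ++ letter s :: y)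
    exact ⟨r, by rintro rfl; exact hy ha, rfl⟩

theorem corner_internal_ne_leaf {t : Set Word} (ht : Tern t) {u v : Word} (hu : u ∈ leaves t)
    (hv : v ∈ t) (s : Fin 3) : corner v s ≠ .inl u := by
  intro h
  obtain ⟨y, rfl, -⟩ := corner_eq_inl_iff.1 h
  exact absurd hu.2 (ht.mem_internalNodes_of_append hv).2

theorem ncard_star_growTree_self {t : Set Word} (ht : Tern t) {u : Word} (hu : u ∈ leaves t) :
    (star (growTree t u) u).ncard = 3 := by
  have : star (growTree t u) u =
      Set.range fun s : Fin 3 => ((some (u ++ [letter s]), s) : Option Word × Fin 3) := by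
    ext ⟨_ | v, s⟩
    · simp [none_notMem_star]
    · rw [some_mem_star, leaves_growTree ht hu]
      constructor
      · rintro ⟨⟨hv, -⟩ | ⟨r, rfl⟩, h⟩
        · exact absurd h (corner_internal_ne_leaf ht hu hv.1 s)
        · rw [corner_snoc] at h
          split_ifs at h with hr
          · exact ⟨s, by rw [hr]⟩
          · exact absurd h (corner_internal_ne_leaf ht hu hu.1 s)
      · rintro ⟨r, hr⟩
        cases hr
        exact ⟨.inr ⟨s, rfl⟩, corner_snoc_self _ _⟩
  rw [this, ← Set.image_univ, Set.ncard_image_of_injective _ fun a b h => (Prod.ext_iff.1 h).2]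
  simp

/-- When `u` is divided, each of its corners is inherited by two of the three children. -/
theorem some_mem_star_growTree {t : Set Word} (ht : Tern t) {u v w : Word} (hu : u ∈ leaves t)
    (hw : w ≠ u) {s : Fin 3} : (some v, s) ∈ star (growTree t u) w ↔
      ((some v, s) ∈ star t w ∧ v ≠ u) ∨
        ∃ r ≠ s, v = u ++ [letter r] ∧ corner u s = .inl w := by
  rw [some_mem_star, some_mem_star, leaves_growTree ht hu]
  constructor
  · rintro ⟨⟨hv, hvu⟩ | ⟨r, rfl⟩, h⟩
    · exact .inl ⟨⟨hv, h⟩, hvu⟩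
    · rw [corner_snoc] at h
      split_ifs at h with hr
      · exact absurd (Sum.inl.inj h).symm hw
      · exact .inr ⟨r, fun e => hr (by rw [e]), rfl, h⟩
  · rintro (⟨⟨hv, h⟩, hvu⟩ | ⟨r, hr, rfl, h⟩)
    · exact ⟨.inl ⟨hv, hvu⟩, h⟩
    · exact ⟨.inr ⟨r, rfl⟩, by rwa [corner_snoc_of_ne _ (by simpa using hr)]⟩

/-- Induction on growth. A new vertex has degree three and an empty forest. Dividing a triangle `u`
with corner `w` trades one dart at `w` for two and adds the node `u` to the forest; any other
division changes neither side. -/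
theorem ncard_star {t : Set Word} (ht : Tern t) {w : Word} (hw : w ∈ internalNodes t) :
    (star t w).ncard = 3 + (binaryForest (internalNodes t) w).ncard := by
  suffices h : ∀ w ∈ internalNodes t,
      (star t w).ncard = 3 + (binaryForest (internalNodes t) w).ncard from h w hw
  clear hw w
  refine ht.induction (P := fun t => ∀ w ∈ internalNodes t,
    (star t w).ncard = 3 + (binaryForest (internalNodes t) w).ncard) ?_ ?_
  · intro w hw
    obtain ⟨hw, a, ha⟩ := mem_internalNodes_iff.1 hw
    simp at ha
  · intro t u ht hu ih w hw
    have ht' := ht.growTree hu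
    have hu' : u ∉ internalNodes t := fun h => h.2 hu.2
    have hmem : ∀ v, v ∈ binaryForest (internalNodes (growTree t u)) w ↔
        (v = u ∧ ∃ s, corner u s = .inl w) ∨ v ∈ binaryForest (internalNodes t) w := by
      intro v
      rw [mem_binaryForest_iff ht', mem_binaryForest_iff ht, internalNodes_growTree ht hu,
        Set.mem_insert_iff]
      constructor
      · rintro ⟨rfl | h, h'⟩
        exacts [.inl ⟨rfl, h'⟩, .inr ⟨h, h'⟩]
      · rintro (⟨rfl, h⟩ | h)
        exacts [⟨.inl rfl, h⟩, ⟨.inr h.1, h.2⟩]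
    rw [internalNodes_growTree ht hu, Set.mem_insert_iff] at hw
    by_cases hwu : w = u
    · subst hwu
      rw [ncard_star_growTree_self ht hu]
      have : binaryForest (internalNodes (growTree t w)) w = ∅ := by
        refine Set.eq_empty_of_forall_notMem fun v hv => ?_
        rw [hmem, mem_binaryForest_iff ht] at hv
        rcases hv with ⟨-, s, hs⟩ | ⟨h, s, hs⟩
        · exact corner_internal_ne_leaf ht hu hu.1 s hs
        · exact corner_internal_ne_leaf ht hu h.1 s hs
      simp [this]
    · replace hw := hw.resolve_left hwu
      by_cases hs : ∃ s, corner u s = .inl w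
      · have h1 : binaryForest (internalNodes (growTree t u)) w =
            insert u (binaryForest (internalNodes t) w) := by
          ext v
          rw [hmem, Set.mem_insert_iff]
          exact or_congr_left (and_iff_left hs)
        have h2 : (binaryForest (internalNodes (growTree t u)) w).ncard =
            (binaryForest (internalNodes t) w).ncard + 1 := by
          rw [h1, Set.ncard_insert_of_notMem (fun h => hu' h.1)
            (ht.finite.subset fun v hv => hv.1.1)]
        obtain ⟨s, hs⟩ := hs
        have huniq : ∀ r, corner u r = .inl w → r = s := fun r hr =>
          corner_injective u (hr.trans hs.symm)
        have h3 : star (growTree t u) w = insert (some (u ++ [letter (s + 1)]), s)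
            (insert (some (u ++ [letter (s + 2)]), s) (star t w \ {(some u, s)})) := by
          ext ⟨_ | v, r⟩
          · simp [none_notMem_star]
          · rw [some_mem_star_growTree ht hu hwu]
            simp only [Set.mem_insert_iff, Set.mem_sdiff, Set.mem_singleton_iff, Prod.mk.injEq,
              Option.some.injEq, not_and]
            constructor
            · rintro (⟨h, h'⟩ | ⟨a, ha, rfl, h⟩)
              · exact .inr (.inr ⟨h, fun e => absurd e h'⟩)
              · obtain rfl := huniq r h
                have : a = r + 1 ∨ a = r + 2 := by clear * - ha; revert a r; decide
                rcases this with rfl | rfl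
                · exact .inl ⟨rfl, rfl⟩
                · exact .inr (.inl ⟨rfl, rfl⟩)
            · rintro (⟨rfl, rfl⟩ | ⟨rfl, rfl⟩ | ⟨h, h'⟩)
              · exact .inr ⟨r + 1, by simp, rfl, hs⟩
              · exact .inr ⟨r + 2, by simp, rfl, hs⟩
              · refine .inl ⟨h, ?_⟩
                rintro rfl
                exact h' rfl (huniq r (some_mem_star.1 h).2)
        have hfin : (star t w).Finite := (finite_labels ht).subset fun p hp => hp.1
        have hmem_s : (some u, s) ∈ star t w := some_mem_star.2 ⟨hu, hs⟩
        have hold : ∀ r, (some (u ++ [letter r]), s) ∉ star t w := fun r h =>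
          (mem_leaves_iff.1 hu).2 _ (some_mem_star.1 h).1.1
        have hpos : 0 < (star t w).ncard := (Set.ncard_pos hfin).2 ⟨_, hmem_s⟩
        rw [h2, h3, Set.ncard_insert_of_notMem _ ((hfin.sdiff).insert _),
          Set.ncard_insert_of_notMem _ hfin.sdiff, Set.ncard_sdiff_singleton_of_mem hmem_s]
        · have := ih w hw
          omega
        · exact fun h => hold _ h.1
        · rw [Set.mem_insert_iff, not_or]
          exact ⟨by simp, fun h => hold _ h.1⟩
      · have h1 : binaryForest (internalNodes (growTree t u)) w =
            binaryForest (internalNodes t) w := by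
          ext v
          rw [hmem]
          exact or_iff_right fun h => hs h.2
        have h2 : star (growTree t u) w = star t w := by
          ext ⟨_ | v, r⟩
          · simp [none_notMem_star]
          · rw [some_mem_star_growTree ht hu hwu]
            constructor
            · rintro (h | ⟨_, _, _, h⟩)
              · exact h.1
              · exact absurd ⟨r, h⟩ hs
            · refine fun h => .inl ⟨h, ?_⟩
              rintro rfl
              exact hs ⟨r, (some_mem_star.1 h).2⟩
        rw [h1, h2]
        exact ih w hw

theorem Coding.degree_eq {m : RootedMap} {t : Set Word} {lab : m.Dart → Option Word × Fin 3}
    (h : Coding m t lab) (ht : Tern t) {d : m.Dart} {w : Word} (hd : org (lab d) = .inl w)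
    (hw : w ∈ internalNodes t) :
    m.degree (m.origin d) = 3 + (binaryForest (internalNodes t) w).ncard := by
  rw [← ncard_star ht hw, RootedMap.degree]
  refine Nat.card_congr (Equiv.ofBijective
    (fun x : {x // m.origin x = m.origin d} => (⟨lab x, h.mem x, ?_⟩ : star t w)) ⟨?_, ?_⟩)
  · rw [h.origin_eq_iff.1 x.2, hd]
  · intro a b hab
    exact Subtype.ext (h.injective (congrArg Subtype.val hab))
  · rintro ⟨p, hp, hp'⟩
    obtain ⟨x, rfl⟩ := h.exists_dart hp
    exact ⟨⟨x, h.vert _ _ (hp'.trans hd.symm)⟩, rfl⟩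

/-- The label of an internal vertex is an internal node. -/
theorem mem_internalNodes_of_org {t : Set Word} (ht : Tern t) {p : Option Word × Fin 3}
    (hp : p ∈ labels t) {w : Word} (h : org p = .inl w) : w ∈ internalNodes t := by
  obtain ⟨_ | u, s⟩ := p
  · simp [org] at h
  · obtain ⟨y, rfl, -⟩ := corner_eq_inl_iff.1 h
    exact ht.mem_internalNodes_of_append (some_mem_labels.1 hp).1

theorem exists_label_of_mem {t : Set Word} (ht : Tern t) {w : Word} (hw : w ∈ t) (s s' : Fin 3) :
    ∃ u ∈ leaves t, org (some u, s) = corner w s ∧ org (some u, s') = corner w s' :=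
  ht.exists_leaf_corner hw s s'

theorem exists_label_of_internal {t : Set Word} (ht : Tern t) {w : Word}
    (hw : w ∈ internalNodes t) : ∃ p ∈ labels t, org p = .inl w := by
  obtain ⟨u, hu, h, -⟩ := ht.exists_leaf_corner (ht.snoc_mem hw 0) 0 0
  exact ⟨(some u, 0), some_mem_labels.2 hu, h.trans (corner_snoc_self _ _)⟩

/-! ### Uniqueness of the coding -/

/-- The darts of `m` as darts of the map obtained by an insertion. -/
def oldDart {m : RootedMap} (f : m.Face) (d : m.Dart) : (m.insert f).Dart := Sum.inl d

section oldDart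

variable {m : RootedMap} {f : m.Face}

theorem oldDart_injective : Function.Injective (oldDart f) := fun _ _ h => Sum.inl.inj h

theorem inv_oldDart (d : m.Dart) : (m.insert f).inv (oldDart f d) = oldDart f (m.inv d) := rfl

theorem root_insert : (m.insert f).root = oldDart f m.root := rfl

theorem next_oldDart {d : m.Dart} (hd : m.faceOf d ≠ f) :
    (m.insert f).next (oldDart f d) = oldDart f (m.next d) := by
  change m.insertNext f (.inl d) = _
  rw [RootedMap.insertNext_inl, dif_neg hd]
  rfl

/-- Crossing the spoke drawn at the corner recovers the old successor, so the old face permutation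
can be read off the new map. -/
theorem next_inv_next_oldDart {d : m.Dart} (hd : m.faceOf d = f) :
    (m.insert f).next ((m.insert f).inv ((m.insert f).next (oldDart f d))) =
      oldDart f (m.next d) := by
  change m.insertNext f (m.insertInv f (m.insertNext f (.inl d))) = _
  rw [RootedMap.insertNext_inl, dif_pos hd]
  rfl

theorem faceOf_eq_iff_next_oldDart (d : m.Dart) :
    m.faceOf d = f ↔ ¬ ∃ d', (m.insert f).next (oldDart f d) = oldDart f d' := by
  constructor
  · rintro hd ⟨d', h⟩
    change m.insertNext f (.inl d) = .inl d' at h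
    rw [RootedMap.insertNext_inl, dif_pos hd] at h
    cases h
  · exact fun h => by_contra fun hd => h ⟨_, next_oldDart hd⟩

end oldDart

/-- An isomorphism between the results of two insertions that matches the new vertices comes from
an isomorphism. -/
theorem exists_iso_of_insert {m m' : RootedMap} {f : m.Face} {f' : m'.Face}
    {e : (m.insert f).Dart ≃ (m'.insert f').Dart}
    (he : RootedMap.Iso (m.insert f) (m'.insert f') e)
    (h : ∀ x, (∃ d, x = oldDart f d) ↔ ∃ d', e x = oldDart f' d') :
    ∃ e₀ : m.Dart ≃ m'.Dart, RootedMap.Iso m m' e₀ ∧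
      ∀ d, m.faceOf d = f ↔ m'.faceOf (e₀ d) = f' := by
  choose g hg using fun d => (h (oldDart f d)).1 ⟨d, rfl⟩
  have hbij : Function.Bijective g := by
    refine ⟨fun a b hab => oldDart_injective (e.injective (by rw [hg, hab, hg])), fun d' => ?_⟩
    obtain ⟨d, hd⟩ := (h (e.symm (oldDart f' d'))).2 ⟨d', e.apply_symm_apply _⟩
    exact ⟨d, oldDart_injective (by rw [← hg, ← hd, e.apply_symm_apply])⟩
  have hface : ∀ d, m.faceOf d = f ↔ m'.faceOf (g d) = f' := by
    intro d
    rw [faceOf_eq_iff_next_oldDart, faceOf_eq_iff_next_oldDart, ← hg, ← he.2.1]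
    exact not_congr (h _)
  refine ⟨Equiv.ofBijective g hbij, ⟨fun d => ?_, fun d => ?_, ?_⟩, hface⟩
  · change g (m.inv d) = m'.inv (g d)
    refine oldDart_injective (f := f') ?_
    rw [← hg, ← inv_oldDart, ← inv_oldDart, he.1, hg]
  · change g (m.next d) = m'.next (g d)
    refine oldDart_injective (f := f') ?_
    rw [← hg]
    by_cases hd : m.faceOf d = f
    · rw [← next_inv_next_oldDart hd, ← next_inv_next_oldDart ((hface d).1 hd), he.2.1, he.1,
        he.2.1, hg]
    · rw [← next_oldDart hd, ← next_oldDart fun h' => hd ((hface d).2 h'), he.2.1, hg]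
  · change g m.root = m'.root
    refine oldDart_injective (f := f') ?_
    rw [← hg, ← root_insert, ← root_insert, he.2.2]

/-- The added darts are exactly those with an end at the new vertex. This expresses "old dart"
through vertices alone, so that it can be compared across two codings. -/
theorem Coding.exists_oldDart_iff {m : RootedMap} {t : Set Word} {lab : m.Dart → Option Word × Fin 3}
    (h : Coding m t lab) (ht : Tern t) {f : m.Face} {u : Word} (hu : u ∈ leaves t)
    (hf : ∀ d, m.faceOf d = f ↔ (lab d).1 = some u) (x : (m.insert f).Dart) :
    (∃ d, x = oldDart f d) ↔ org (insertLab lab f u x) ≠ .inl u ∧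
      org (insertLab lab f u ((m.insert f).inv x)) ≠ .inl u := by
  have hne := fun d => org_ne_leaf ht hu (h.mem d)
  obtain d | ⟨d, _ | _⟩ := x
  · refine iff_of_true ⟨d, rfl⟩ ⟨?_, ?_⟩
    · rw [org_insertLab_inl hf]
      exact hne d
    · change org (insertLab lab f u (.inl (m.inv d))) ≠ _
      rw [org_insertLab_inl hf]
      exact hne _
  · refine iff_of_false (fun ⟨_, h⟩ => by cases h) fun h' => h'.2 ?_
    exact org_insertLab_true d
  · refine iff_of_false (fun ⟨_, h⟩ => by cases h) fun h' => h'.1 ?_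
    exact org_insertLab_true d

/-- A map is coded by at most one tree. -/
theorem Coding.tree_unique {m : RootedMap} {t t' : Set Word}
    {lab lab' : m.Dart → Option Word × Fin 3} (ht : Tern t) (ht' : Tern t') (h : Coding m t lab)
    (h' : Coding m t' lab') : t = t' := by
  suffices key : ∀ (m : RootedMap) (t' : Set Word) (lab lab' : m.Dart → Option Word × Fin 3),
      Tern t' → Coding m t lab → Coding m t' lab' → t = t' from key m t' lab lab' ht' h h'
  clear h h' ht' lab lab' t' m
  refine ht.induction (P := fun t => ∀ (m : RootedMap) (t' : Set Word)
    (lab lab' : m.Dart → Option Word × Fin 3),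
      Tern t' → Coding m t lab → Coding m t' lab' → t = t') ?_ ?_
  · intro m t' lab lab' ht' h h'
    refine (ht'.eq_singleton (Set.eq_empty_of_forall_notMem fun w hw => ?_)).symm
    obtain ⟨p, hp, hpw⟩ := exists_label_of_internal ht' hw
    obtain ⟨d, rfl⟩ := h'.exists_dart hp
    -- For the one-node tree every vertex is outer, so the other tree cannot have an internal node.
    obtain ⟨d', hd', hdd'⟩ : ∃ d', m.origin d = m.origin d' ∧ (lab d').1 = none := by
      have hcase : ∃ s, org (lab d) = .inr s := by
        have hmem := h.mem d
        generalize lab d = p at hmem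
        obtain ⟨_ | u, s⟩ := p
        · exact ⟨_, rfl⟩
        · obtain rfl : u = [] := (hmem u rfl).1
          exact ⟨s, rfl⟩
      obtain ⟨s, hs⟩ := hcase
      obtain ⟨d', hd'⟩ := h.exists_dart (none_mem_labels (s := -s))
      exact ⟨d', h.vert _ _ (by rw [hd', hs]; simp [org]), by rw [hd']⟩
    have hout : (lab' d').1 = none := by
      by_contra hne
      have := h'.ne_outerFace_iff.2 (Option.ne_none_iff_exists'.1 hne)
      rw [h.ne_outerFace_iff, hdd'] at this
      simp at this
    rw [h'.origin_eq_iff.1 hd'] at hpw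
    have : lab' d' = (none, (lab' d').2) := Prod.ext hout rfl
    rw [this] at hpw
    simp [org] at hpw
  · intro t u ht hu ih m t' lab lab' ht' h h'
    have hgt := ht.growTree hu
    have huint : u ∈ internalNodes (growTree t u) := by
      rw [internalNodes_growTree ht hu]
      exact .inl rfl
    obtain ⟨p, hp, hpu⟩ := exists_label_of_internal hgt huint
    obtain ⟨d, rfl⟩ := h.exists_dart hp
    have hdeg : m.degree (m.origin d) = 3 := by
      rw [h.degree_eq hgt hpu huint, ← ncard_star hgt huint, ncard_star_growTree_self ht hu]
    -- Both codings single out the same infinite face, hence the same internal vertices.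
    obtain ⟨w, hw⟩ : ∃ w, org (lab' d) = .inl w := by
      cases hcase : org (lab' d) with
      | inl w => exact ⟨w, rfl⟩
      | inr s =>
        exfalso
        obtain ⟨d', hd'⟩ := h'.exists_dart (none_mem_labels (s := -s))
        have e1 : m.origin d = m.origin d' := h'.vert _ _ (by rw [hd', hcase]; simp [org])
        have hout : (lab d').1 = none := by
          by_contra hne
          have := h.ne_outerFace_iff.2 (Option.ne_none_iff_exists'.1 hne)
          rw [h'.ne_outerFace_iff, hd'] at this
          simp at this
        rw [h.origin_eq_iff.1 e1] at hpu
        have : lab d' = (none, (lab d').2) := Prod.ext hout rfl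
        rw [this] at hpu
        simp [org] at hpu
    have hwint := mem_internalNodes_of_org ht' (h'.mem d) hw
    -- Degree three means an empty forest. In particular no child of `w` is internal, and `t'` can
    -- be cut at `w`.
    have hBF : binaryForest (internalNodes t') w = ∅ := by
      rw [h'.degree_eq ht' hw hwint] at hdeg
      refine (Set.ncard_eq_zero (ht'.finite.subset fun v hv => hv.1.1)).1 (by omega)
    obtain ⟨t₀, ht₀, hwl, rfl⟩ := ht'.exists_eq_growTree hwint fun s hs => by
      have : w ++ [letter s] ∈ binaryForest (internalNodes t') w :=
        (mem_binaryForest_iff ht').2 ⟨hs, s, corner_snoc_self _ _⟩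
      simp [hBF] at this
    -- Realize both cut trees by maps. Then `m` is an insertion into each of them with the same new
    -- vertex, so deleting this vertex gives an isomorphism of the two smaller maps.
    obtain ⟨m₁, lab₁, h₁⟩ := Coding.exists_coding ht
    obtain ⟨m₂, lab₂, h₂⟩ := Coding.exists_coding ht₀
    obtain ⟨f₁, -, hf₁⟩ := h₁.exists_face hu
    obtain ⟨f₂, -, hf₂⟩ := h₂.exists_face hwl
    obtain ⟨e₁, he₁, hl₁⟩ := h.exists_iso hgt (h₁.insert ht hu hf₁)
    obtain ⟨e₂, he₂, hl₂⟩ := h'.exists_iso ht' (h₂.insert ht₀ hwl hf₂)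
    have hcorr : ∀ x, org (lab x) = .inl u ↔ org (lab' x) = .inl w := fun x => by
      rw [← hpu, ← hw, ← h.origin_eq_iff, h'.origin_eq_iff]
    obtain ⟨e₀, he₀, hfe⟩ := exists_iso_of_insert (he₁.symm.trans he₂) fun x => by
      obtain ⟨x, rfl⟩ := e₁.surjective x
      refine (h₁.exists_oldDart_iff ht hu hf₁ _).trans
        (Iff.trans ?_ (h₂.exists_oldDart_iff ht₀ hwl hf₂ _).symm)
      rw [Equiv.trans_apply, Equiv.symm_apply_apply, ← he₁.1, ← he₂.1, hl₁, hl₁, hl₂, hl₂,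
        Ne, Ne, hcorr, hcorr]
    have ht_eq := ih m₁ t₀ lab₁ _ ht₀ h₁ (h₂.congr he₀)
    subst ht_eq
    -- With equal trees the labellings agree too, so the marked faces carry the same leaf.
    have hlab := h₁.lab_unique ht (h₂.congr he₀)
    obtain ⟨x, hx⟩ := h₁.exists_dart (some_mem_labels (s := 0).2 hu)
    have h1 : (lab₁ x).1 = some u := by rw [hx]
    have h2 : (lab₁ x).1 = some w := by
      rw [hlab]
      exact (hf₂ _).1 ((hfe x).1 ((hf₁ x).2 h1))
    rw [Option.some.inj (h1.symm.trans h2)]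

/-! ### Types of triangles -/

/-- The least of three numbers. -/
def lo (c : Fin 3 → ℕ) : ℕ := min (c 0) (min (c 1) (c 2))

theorem lo_le (c : Fin 3 → ℕ) (s : Fin 3) : lo c ≤ c s := by
  unfold lo
  fin_cases s <;> simp

theorem exists_eq_lo (c : Fin 3 → ℕ) : ∃ s, c s = lo c := by
  by_contra! h
  have h0 := lt_of_le_of_ne (lo_le c 0) (h 0).symm
  have h1 := lt_of_le_of_ne (lo_le c 1) (h 1).symm
  have h2 := lt_of_le_of_ne (lo_le c 2) (h 2).symm
  exact absurd (lt_min h0 (lt_min h1 h2)) (lt_irrefl _)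

theorem lo_mono {c c' : Fin 3 → ℕ} (h : ∀ s, c s ≤ c' s) : lo c ≤ lo c' :=
  min_le_min (h 0) (min_le_min (h 1) (h 2))

/-- Replace the value at the corner designated by a letter by one plus the least value. -/
def step (c : Fin 3 → ℕ) (a : ℕ) (s : Fin 3) : ℕ := if a = letter s then lo c + 1 else c s

/-- The type of the triangle coded by a word, when the initial triangle has type `c`: the distances
of its corners to a point at distances `c` of the initial corners. -/
def typ (c : Fin 3 → ℕ) (u : Word) : Fin 3 → ℕ := u.foldl step c

/-- The distance of the vertex inserted in the triangle coded by a word. -/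
def val (c : Fin 3 → ℕ) (u : Word) : ℕ := lo (typ c u) + 1

theorem typ_snoc (c : Fin 3 → ℕ) (u : Word) (a : ℕ) : typ c (u ++ [a]) = step (typ c u) a := by
  simp [typ]

theorem step_mono {c c' : Fin 3 → ℕ} (h : ∀ s, c s ≤ c' s) (a : ℕ) (s : Fin 3) :
    step c a s ≤ step c' a s := by
  unfold step
  split_ifs
  · exact Nat.succ_le_succ (lo_mono h)
  · exact h s

theorem typ_mono {c c' : Fin 3 → ℕ} (h : ∀ s, c s ≤ c' s) (u : Word) (s : Fin 3) :
    typ c u s ≤ typ c' u s := by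
  induction u using List.reverseRecOn generalizing s with
  | nil => exact h s
  | append_singleton u a ih =>
    rw [typ_snoc, typ_snoc]
    exact step_mono ih a s

theorem val_mono {c c' : Fin 3 → ℕ} (h : ∀ s, c s ≤ c' s) (u : Word) : val c u ≤ val c' u :=
  Nat.succ_le_succ (lo_mono (typ_mono h u))

theorem lo_add_one (c : Fin 3 → ℕ) : lo (fun s => c s + 1) = lo c + 1 := by
  simp only [lo]
  omega

theorem typ_add_one (c : Fin 3 → ℕ) (u : Word) (s : Fin 3) :
    typ (fun s => c s + 1) u s = typ c u s + 1 := by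
  induction u using List.reverseRecOn generalizing s with
  | nil => rfl
  | append_singleton u a ih =>
    rw [typ_snoc, typ_snoc, funext ih]
    unfold step
    rw [lo_add_one]
    split_ifs <;> rfl

theorem val_add_one (c : Fin 3 → ℕ) (u : Word) : val (fun s => c s + 1) u = val c u + 1 := by
  rw [val, val, funext (typ_add_one c u), lo_add_one]

/-- The values at the three corners differ by at most one. -/
theorem typ_le_lo {c : Fin 3 → ℕ} (h : ∀ s, c s ≤ lo c + 1) (u : Word) (s : Fin 3) :
    typ c u s ≤ lo (typ c u) + 1 := by
  induction u using List.reverseRecOn generalizing s with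
  | nil => exact h s
  | append_singleton u a ih =>
    rw [typ_snoc]
    have key : lo (typ c u) ≤ lo (step (typ c u) a) := by
      have : ∀ s, lo (typ c u) ≤ step (typ c u) a s := by
        intro s
        unfold step
        split_ifs
        · exact Nat.le_succ _
        · exact lo_le _ s
      exact le_min (this 0) (le_min (this 1) (this 2))
    refine le_trans ?_ (Nat.succ_le_succ key)
    unfold step
    split_ifs
    · exact le_rfl
    · exact ih s

/-- The distances of the three outer vertices to the root vertex. -/
def rootType (s : Fin 3) : ℕ := if s = 0 then 0 else 1

theorem lo_rootType : lo rootType = 0 := rfl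

theorem step_rootType_letter_zero : step rootType 1 = fun _ => 1 := by
  funext s
  fin_cases s <;> rfl

/-- While the root vertex remains a corner, every inserted vertex is at distance one. This explains
why the second passage time waits for the letter 1 only. -/
theorem step_rootType {a : ℕ} (h : a ≠ 1) : step rootType a = rootType := by
  funext s
  unfold step
  split_ifs with ha
  · rw [lo_rootType, rootType, if_neg]
    rintro rfl
    exact h ha
  · rfl

/-! ### The passage function -/

/-- The first time at which a property holds. -/
noncomputable def firstTime (Q : ℕ → Prop) : ℕ∞ := sInf {i : ℕ∞ | ∃ n : ℕ, i = n ∧ Q n}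

theorem firstTime_eq_coe {Q : ℕ → Prop} {T : ℕ} :
    firstTime Q = T ↔ Q T ∧ ∀ n, Q n → T ≤ n := by
  constructor
  · intro h
    have hne : {i : ℕ∞ | ∃ n : ℕ, i = n ∧ Q n}.Nonempty := by
      by_contra he
      rw [Set.not_nonempty_iff_eq_empty] at he
      rw [firstTime, he, sInf_empty] at h
      exact absurd h (by simp)
    obtain ⟨n, hn, hQ⟩ := csInf_mem hne
    have : (T : ℕ∞) = n := h.symm.trans hn
    obtain rfl : T = n := by exact_mod_cast this
    refine ⟨hQ, fun k hk => ?_⟩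
    have : firstTime Q ≤ k := sInf_le ⟨k, rfl, hk⟩
    rw [h] at this
    exact_mod_cast this
  · rintro ⟨hT, hmin⟩
    refine le_antisymm (sInf_le ⟨T, rfl, hT⟩) (le_sInf ?_)
    rintro _ ⟨n, rfl, hn⟩
    exact_mod_cast hmin n hn

theorem firstTime_eq_top {Q : ℕ → Prop} : firstTime Q = ⊤ ↔ ∀ n, ¬ Q n := by
  constructor
  · intro h n hn
    have : firstTime Q ≤ n := sInf_le ⟨n, rfl, hn⟩
    rw [h] at this
    exact absurd (top_le_iff.1 this) (by simp)
  · intro h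
    rw [firstTime, sInf_eq_top]
    rintro _ ⟨n, -, hn⟩
    exact absurd hn (h n)

/-- `n` closes a block of letters that starts after `T`. -/
def IsBlock (u : Word) (T : ℕ∞) (n : ℕ) : Prop :=
  n ≤ u.length ∧ T < n ∧ letterIn u 1 T n ∧ letterIn u 2 T n ∧ letterIn u 3 T n

theorem tau_two (u : Word) : tau u 2 = firstTime fun n => 0 < n ∧ u[n - 1]? = some 1 := rfl

theorem tau_add_three (u : Word) (j : ℕ) :
    tau u (j + 3) = firstTime (IsBlock u (tau u (j + 2))) := rfl

theorem isBlock_iff {u : Word} {T n : ℕ} :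
    IsBlock u T n ↔ n ≤ u.length ∧ ∀ s, letterIn u (letter s) T n := by
  constructor
  · rintro ⟨h, -, h1, h2, h3⟩
    refine ⟨h, fun s => ?_⟩
    fin_cases s
    exacts [h1, h2, h3]
  · rintro ⟨h, h'⟩
    obtain ⟨r, hr, hr', -⟩ := h' 0
    exact ⟨h, lt_of_le_of_lt hr (by exact_mod_cast hr'), h' 0, h' 1, h' 2⟩

theorem letterIn_snoc_of_le {u : Word} {a b : ℕ} {T : ℕ∞} {n : ℕ} (h : n ≤ u.length) :
    letterIn (u ++ [a]) b T n ↔ letterIn u b T n := by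
  refine exists_congr fun r => and_congr_right fun _ => and_congr_right fun hr => ?_
  rw [List.getElem?_append_left (by omega)]

theorem letterIn_snoc {u : Word} {a b T : ℕ} (h : T ≤ u.length) :
    letterIn (u ++ [a]) b T (u.length + 1) ↔ letterIn u b T u.length ∨ a = b := by
  constructor
  · rintro ⟨r, hr, hr', e⟩
    rcases Nat.lt_succ_iff_lt_or_eq.1 hr' with h' | rfl
    · rw [List.getElem?_append_left h'] at e
      exact .inl ⟨r, hr, h', e⟩
    · right
      simpa using e
  · rintro (⟨r, hr, hr', e⟩ | rfl)
    · exact ⟨r, hr, by omega, by rwa [List.getElem?_append_left hr']⟩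
    · exact ⟨u.length, by exact_mod_cast h, by omega, by simp⟩

/-- A passage time depends only on the letters read up to that time, so appending a letter does not
move it. -/
theorem tau_snoc_of_eq {u : Word} (a : ℕ) {j T : ℕ} (h : tau u j = T) (hT : T ≤ u.length) :
    tau (u ++ [a]) j = T := by
  induction j using Nat.strong_induction_on generalizing T with
  | _ j ih =>
    match j with
    | 0 => exact h
    | 1 => exact h
    | 2 =>
      rw [tau_two, firstTime_eq_coe] at h ⊢
      obtain ⟨⟨h0, h1⟩, hmin⟩ := h
      refine ⟨⟨h0, by rwa [List.getElem?_append_left (by omega)]⟩, fun n hn => ?_⟩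
      by_contra hlt
      refine hlt (hmin n ⟨hn.1, ?_⟩)
      rw [← hn.2, List.getElem?_append_left (by omega)]
    | j + 3 =>
      have htop : tau u (j + 2) ≠ ⊤ := by
        intro htop
        rw [tau_add_three, firstTime_eq_coe, htop] at h
        exact absurd h.1.2.1 (by simp)
      obtain ⟨T', hT'⟩ := ENat.ne_top_iff_exists.1 htop
      rw [tau_add_three, ← hT', firstTime_eq_coe] at h
      have hlt : T' < T := by exact_mod_cast h.1.2.1
      rw [tau_add_three, ih (j + 2) (by omega) hT'.symm (by omega), firstTime_eq_coe]
      rw [isBlock_iff] at h ⊢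
      refine ⟨⟨by simp; omega, fun s => (letterIn_snoc_of_le hT).2 (h.1.2 s)⟩, fun n hn => ?_⟩
      by_contra hnT
      rw [isBlock_iff] at hn
      refine hnT (h.2 n (isBlock_iff.2 ⟨by omega, fun s => ?_⟩))
      exact (letterIn_snoc_of_le (by omega)).1 (hn.2 s)

theorem tau_eq_top_of_le {u : Word} {j k : ℕ} (h : tau u (j + 2) = ⊤) (hk : j + 2 ≤ k) :
    tau u k = ⊤ := by
  induction k, hk using Nat.le_induction with
  | base => exact h
  | succ k hk ih =>
    obtain ⟨i, rfl⟩ : ∃ i, k = i + 2 := ⟨k - 2, by omega⟩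
    rw [tau_add_three, ih, firstTime_eq_top]
    rintro n ⟨-, hn, -⟩
    exact absurd hn (by simp)

theorem passage_eq {u : Word} {j T : ℕ} (h : tau u (j + 1) = T) (hT : T ≤ u.length)
    (h' : tau u (j + 2) = ⊤) : passage u = j + 1 := by
  have : IsGreatest {i : ℕ | 1 ≤ i ∧ tau u i ≤ u.length} (j + 1) := by
    refine ⟨⟨by omega, by rw [h]; exact_mod_cast hT⟩, ?_⟩
    rintro i ⟨-, hi⟩
    by_contra hlt
    rw [tau_eq_top_of_le h' (by omega)] at hi
    exact absurd (top_le_iff.1 hi) (by simp)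
  exact this.csSup_eq

/-- The state after reading a word: the last passage time, and the type of the triangle. -/
theorem exists_state (u : Word) : ∃ j T : ℕ, tau u (j + 1) = T ∧ T ≤ u.length ∧
    tau u (j + 2) = ⊤ ∧ ((j = 0 ∧ typ rootType u = rootType) ∨ (1 ≤ j ∧ ∀ s,
      (letterIn u (letter s) T u.length ∧ typ rootType u s = j + 1) ∨
      (¬ letterIn u (letter s) T u.length ∧ typ rootType u s = j))) ∧
    lo (typ rootType u) = j := by
  -- As the current block is incomplete, some letter is missing since `T`, and its corner still has
  -- the value `j`.
  have hlo : ∀ (u : Word) (j T : ℕ), 1 ≤ j → tau u (j + 2) = ⊤ → tau u (j + 1) = T → (∀ s,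
      (letterIn u (letter s) T u.length ∧ typ rootType u s = j + 1) ∨
      (¬ letterIn u (letter s) T u.length ∧ typ rootType u s = j)) →
      lo (typ rootType u) = j := by
    intro u j T hj h h' hs
    obtain ⟨i, rfl⟩ : ∃ i, j = i + 1 := ⟨j - 1, by omega⟩
    have hblock : ¬ IsBlock u T u.length := by
      rw [tau_add_three, h', firstTime_eq_top] at h
      exact h _
    obtain ⟨s, hs'⟩ : ∃ s, ¬ letterIn u (letter s) T u.length := by
      by_contra! hall
      exact hblock (isBlock_iff.2 ⟨le_rfl, hall⟩)
    refine le_antisymm ?_ ?_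
    · rw [← ((hs s).resolve_left fun h => hs' h.1).2]
      exact lo_le _ _
    · obtain ⟨r, hr⟩ := exists_eq_lo (typ rootType u)
      rw [← hr]
      rcases hs r with h | h <;> omega
  induction u using List.reverseRecOn with
  | nil =>
    refine ⟨0, 0, rfl, le_rfl, ?_, .inl ⟨rfl, rfl⟩, rfl⟩
    rw [tau_two, firstTime_eq_top]
    simp
  | append_singleton u a ih =>
    obtain ⟨j, T, h1, hT, h2, h3, h4⟩ := ih
    have hT' : T ≤ (u ++ [a]).length := by simp; omega
    have hlen : (u ++ [a]).length = u.length + 1 := by simp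
    have h1' := tau_snoc_of_eq a h1 hT
    have hnew : ∀ i, tau (u ++ [a]) (i + 2) = ((u.length + 1 : ℕ) : ℕ∞) →
        tau (u ++ [a]) (i + 3) = ⊤ := by
      intro i hi
      rw [tau_add_three, hi, firstTime_eq_top]
      rintro n ⟨hn, hn', -⟩
      rw [hlen] at hn
      have : u.length + 1 < n := by exact_mod_cast hn'
      omega
    have hnone : ∀ b, ¬ letterIn (u ++ [a]) b (u.length + 1 : ℕ) (u.length + 1) := by
      rintro b ⟨r, hr, hr', -⟩
      have : u.length + 1 ≤ r := by exact_mod_cast hr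
      omega
    rcases h3 with ⟨rfl, h3⟩ | ⟨hj, h3⟩
    · have hno : ∀ n, ¬ (0 < n ∧ u[n - 1]? = some 1) := by
        rwa [tau_two, firstTime_eq_top] at h2
      have hcase : ∀ n, 0 < n ∧ (u ++ [a])[n - 1]? = some 1 → n = u.length + 1 ∧ a = 1 := by
        rintro n ⟨hn, hn'⟩
        rcases lt_trichotomy (n - 1) u.length with hlt | heq | hgt
        · rw [List.getElem?_append_left hlt] at hn'
          exact absurd ⟨hn, hn'⟩ (hno n)
        · rw [heq] at hn'
          exact ⟨by omega, by simpa using hn'⟩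
        · rw [List.getElem?_eq_none (by simp; omega)] at hn'
          cases hn'
      by_cases ha : a = 1
      · subst ha
        have h5 : tau (u ++ [1]) 2 = ((u.length + 1 : ℕ) : ℕ∞) := by
          rw [tau_two, firstTime_eq_coe]
          exact ⟨⟨by omega, by simp⟩, fun n hn => (hcase n hn).1.ge⟩
        have h6 : ∀ s, (letterIn (u ++ [1]) (letter s) (u.length + 1 : ℕ) (u ++ [1]).length ∧
            typ rootType (u ++ [1]) s = 1 + 1) ∨
            (¬ letterIn (u ++ [1]) (letter s) (u.length + 1 : ℕ) (u ++ [1]).length ∧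
            typ rootType (u ++ [1]) s = 1) := by
          intro s
          rw [hlen]
          refine .inr ⟨hnone _, ?_⟩
          rw [typ_snoc, h3, step_rootType_letter_zero]
        exact ⟨1, u.length + 1, h5, by rw [hlen], hnew 0 h5, .inr ⟨le_rfl, h6⟩,
          hlo _ _ _ le_rfl (hnew 0 h5) h5 h6⟩
      · have h5 : typ rootType (u ++ [a]) = rootType := by
          rw [typ_snoc, h3, step_rootType ha]
        refine ⟨0, T, h1', hT', ?_, .inl ⟨rfl, h5⟩, by rw [h5]; rfl⟩
        rw [tau_two, firstTime_eq_top]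
        exact fun n hn => ha (hcase n hn).2
    · obtain ⟨i, rfl⟩ : ∃ i, j = i + 1 := ⟨j - 1, by omega⟩
      have hno : ∀ n, ¬ IsBlock u T n := by
        rwa [tau_add_three, h1, firstTime_eq_top] at h2
      have hcase : ∀ n, IsBlock (u ++ [a]) T n → n = u.length + 1 := by
        intro n hn
        rw [isBlock_iff, hlen] at hn
        by_contra hne
        have hle : n ≤ u.length := by omega
        exact hno n (isBlock_iff.2 ⟨hle, fun s => (letterIn_snoc_of_le hle).1 (hn.2 s)⟩)
      have hty : ∀ s, typ rootType (u ++ [a]) s =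
          if a = letter s then i + 2 else typ rootType u s := by
        intro s
        rw [typ_snoc, step, h4]
      -- If `a` completes the block, all three corners have the raised value and a new block starts
      -- with no letter seen; otherwise only the corner of `a` is raised.
      by_cases hall : ∀ s, letterIn u (letter s) T u.length ∨ a = letter s
      · have h5 : tau (u ++ [a]) (i + 3) = ((u.length + 1 : ℕ) : ℕ∞) := by
          rw [tau_add_three, h1', firstTime_eq_coe]
          refine ⟨isBlock_iff.2 ⟨by rw [hlen], fun s => (letterIn_snoc hT).2 (hall s)⟩,
            fun n hn => (hcase n hn).ge⟩
        have h6 : ∀ s, (letterIn (u ++ [a]) (letter s) (u.length + 1 : ℕ) (u ++ [a]).length ∧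
            typ rootType (u ++ [a]) s = i + 2 + 1) ∨
            (¬ letterIn (u ++ [a]) (letter s) (u.length + 1 : ℕ) (u ++ [a]).length ∧
            typ rootType (u ++ [a]) s = i + 2) := by
          intro s
          rw [hlen, hty]
          refine .inr ⟨hnone _, ?_⟩
          split_ifs with ha
          · rfl
          · rcases h3 s with h | h
            · exact h.2
            · exact absurd ((hall s).resolve_right ha) h.1
        exact ⟨i + 2, u.length + 1, h5, by rw [hlen], hnew (i + 1) h5, .inr ⟨by omega, h6⟩,
          hlo _ _ _ (by omega) (hnew (i + 1) h5) h5 h6⟩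
      · have h5 : tau (u ++ [a]) (i + 3) = ⊤ := by
          rw [tau_add_three, h1', firstTime_eq_top]
          intro n hn
          obtain rfl := hcase n hn
          exact hall fun s => (letterIn_snoc hT).1 ((isBlock_iff.1 hn).2 s)
        have h6 : ∀ s, (letterIn (u ++ [a]) (letter s) T (u ++ [a]).length ∧
            typ rootType (u ++ [a]) s = i + 1 + 1) ∨
            (¬ letterIn (u ++ [a]) (letter s) T (u ++ [a]).length ∧
            typ rootType (u ++ [a]) s = i + 1) := by
          intro s
          rw [hlen, letterIn_snoc hT, hty]
          split_ifs with ha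
          · exact .inl ⟨.inr ha, rfl⟩
          · simpa [ha] using h3 s
        exact ⟨i + 1, T, h1', hT', h5, .inr ⟨hj, h6⟩, hlo _ _ _ hj h5 h1' h6⟩

/-- The passage function computes the distance to the root vertex. -/
theorem passage_eq_val (u : Word) : passage u = val rootType u := by
  obtain ⟨j, T, h1, hT, h2, -, h4⟩ := exists_state u
  rw [passage_eq h1 hT h2, val, h4]

/-- After its first letter, a word has a passage number that is, up to one, the distance to the
corners of the triangle coded by the first letter. -/
theorem passage_cons_bounds (a : ℕ) (y : Word) :
    val (fun _ => 0) y ≤ passage (a :: y) ∧ passage (a :: y) ≤ val (fun _ => 0) y + 1 := by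
  have h : passage (a :: y) = val (step rootType a) y := passage_eq_val _
  rw [h, ← val_add_one]
  -- After one letter the type lies between the constants 0 and 1, and shifting a type by one shifts
  -- `val` by one.
  refine ⟨val_mono (fun _ => Nat.zero_le _) y, val_mono (fun s => ?_) y⟩
  by_cases ha : a = 1
  · rw [ha, step_rootType_letter_zero]
  · rw [step_rootType ha, rootType]
    split_ifs <;> simp

theorem passage_nil : passage [] = 1 := by
  rw [passage_eq_val]
  rfl

/-! ### The two-parameter passage function -/

theorem exists_meet (u v : Word) : ∃ w a b, meet u v = w ∧ u = w ++ a ∧ v = w ++ b ∧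
    (∀ x y x' y', a = x :: y → b = x' :: y' → x ≠ x') := by
  induction u generalizing v with
  | nil => exact ⟨[], [], v, by simp [meet], rfl, rfl, fun _ _ _ _ h => by cases h⟩
  | cons c u ih =>
    cases v with
    | nil => exact ⟨[], c :: u, [], rfl, rfl, rfl, fun _ _ _ _ _ h => by cases h⟩
    | cons d v =>
      by_cases h : c = d
      · subst h
        obtain ⟨w, a, b, h1, h2, h3, h4⟩ := ih v
        exact ⟨c :: w, a, b, by rw [meet, if_pos rfl, h1], by rw [h2]; rfl, by rw [h3]; rfl, h4⟩
      · refine ⟨[], c :: u, d :: v, by rw [meet, if_neg h], rfl, rfl, ?_⟩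
        rintro x y x' y' e e'
        cases e
        cases e'
        exact h

theorem exists_passage₂_eq (u v : Word) : ∃ w a b, u = w ++ a ∧ v = w ++ b ∧
    (∀ x y x' y', a = x :: y → b = x' :: y' → x ≠ x') ∧ passage₂ u v = passage a + passage b := by
  obtain ⟨w, a, b, h1, h2, h3, h4⟩ := exists_meet u v
  refine ⟨w, a, b, h2, h3, h4, ?_⟩
  rw [passage₂, h1]
  simp [h2, h3]

/-! ### Distances -/

section RootedMap

variable {m : RootedMap}

theorem adj_or_eq (d : m.Dart) :
    m.graph.Adj (m.origin d) (m.origin (m.next d)) ∨ m.origin d = m.origin (m.next d) := by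
  by_cases h : m.origin d = m.origin (m.next d)
  · exact .inr h
  · exact .inl ⟨h, d, rfl, origin_inv d⟩

theorem dist_next_le_one (d : m.Dart) : m.dist (m.origin d) (m.origin (m.next d)) ≤ 1 := by
  rcases adj_or_eq d with h | h
  · exact (SimpleGraph.dist_eq_one_iff_adj.2 h).le
  · rw [← h, RootedMap.dist, SimpleGraph.dist_self]
    exact Nat.zero_le _

theorem graph_connected (m : RootedMap) : m.graph.Connected := by
  have key : ∀ d : m.Dart, m.graph.Reachable (m.origin d) (m.origin (m.next d)) := fun d =>
    (adj_or_eq d).elim SimpleGraph.Adj.reachable fun h => h ▸ .refl _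
  have h : ∀ d : m.Dart, m.graph.Reachable (m.origin m.root) (m.origin d) := by
    refine dart_induction (.refl _) (fun d => ?_) fun d => ?_
    · rw [origin_inv]
      exact ⟨fun h => h.trans (key d), fun h => h.trans (key d).symm⟩
    · exact ⟨fun h => h.trans (key d), fun h => h.trans (key d).symm⟩
  have : Nonempty m.Vertex := ⟨m.rootVertex⟩
  refine ⟨fun v w => ?_⟩
  obtain ⟨d, rfl⟩ := origin_surjective v
  obtain ⟨d', rfl⟩ := origin_surjective w
  exact (h d).symm.trans (h d')

theorem dist_triangle (u v w : m.Vertex) : m.dist u w ≤ m.dist u v + m.dist v w :=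
  (graph_connected m).dist_triangle

theorem dist_comm (u v : m.Vertex) : m.dist u v = m.dist v u := SimpleGraph.dist_comm

theorem dist_self (v : m.Vertex) : m.dist v v = 0 := SimpleGraph.dist_self

end RootedMap

namespace Coding

variable {m : RootedMap} {t : Set Word} {lab : m.Dart → Option Word × Fin 3}

/-- A function on labels whose variation along edges is at most one gives lower bounds for
distances. -/
theorem sub_le_dist (h : Coding m t lab) {F : VLabel → ℤ}
    (hl : ∀ u ∈ leaves t, ∀ s s', F (corner u s) - F (corner u s') ≤ 1)
    (ho : ∀ i j, F (.inr i) - F (.inr j) ≤ 1) (d d' : m.Dart) :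
    F (org (lab d)) - F (org (lab d')) ≤ m.dist (m.origin d) (m.origin d') := by
  -- A chosen dart at each vertex turns `F` into a function of vertices, to be followed along a
  -- walk.
  choose r hr using origin_surjective (m := m)
  have hG : ∀ d, F (org (lab (r (m.origin d)))) = F (org (lab d)) := fun d => by
    rw [h.origin_eq_iff.1 (hr (m.origin d))]
  have hwalk : ∀ {x y : m.Vertex} (p : m.graph.Walk x y),
      F (org (lab (r x))) - F (org (lab (r y))) ≤ p.length := by
    intro x y p
    induction p with
    | nil => simp
    | cons hadj p ih =>
      rw [SimpleGraph.Walk.length_cons]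
      obtain ⟨-, d, rfl, rfl⟩ := hadj
      rw [hG] at ih ⊢
      rw [h.inv, h.next] at ih
      have : F (org (lab d)) - F (org (nxt (lab d))) ≤ 1 := by
        have hmem := h.mem d
        generalize lab d = p at hmem
        obtain ⟨_ | u, s⟩ := p
        · exact ho _ _
        · exact hl u (some_mem_labels.1 hmem) _ _
      push_cast
      linarith
  obtain ⟨p, hp⟩ := (graph_connected m).exists_walk_length_eq_dist (m.origin d) (m.origin d')
  have := hwalk p
  rw [hp, hG, hG] at this
  exact this

theorem exists_dart_corner (h : Coding m t lab) (ht : Tern t) {w : Word} (hw : w ∈ t)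
    (s : Fin 3) : ∃ d, org (lab d) = corner w s := by
  obtain ⟨u, hu, e, -⟩ := exists_label_of_mem ht hw s s
  obtain ⟨d, hd⟩ := h.exists_dart (some_mem_labels (s := s).2 hu)
  exact ⟨d, by rw [hd, e]⟩

theorem exists_dart_internal (h : Coding m t lab) (ht : Tern t) {w : Word}
    (hw : w ∈ internalNodes t) : ∃ d, org (lab d) = .inl w := by
  obtain ⟨d, hd⟩ := h.exists_dart_corner ht (ht.snoc_mem hw 0) 0
  exact ⟨d, hd.trans (corner_snoc_self _ _)⟩

/-- By `exists_label_of_mem` the two corners are also corners of one leaf, where a side joins them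
unless they coincide. -/
theorem dist_corner_le_one (h : Coding m t lab) (ht : Tern t) {w : Word} (hw : w ∈ t)
    {s s' : Fin 3} {d d' : m.Dart} (hd : org (lab d) = corner w s)
    (hd' : org (lab d') = corner w s') : m.dist (m.origin d) (m.origin d') ≤ 1 := by
  obtain ⟨u, hu, e, e'⟩ := exists_label_of_mem ht hw s s'
  obtain ⟨x, hx⟩ := h.exists_dart (some_mem_labels (s := s).2 hu)
  obtain ⟨x', hx'⟩ := h.exists_dart (some_mem_labels (s := s').2 hu)
  rw [h.vert d x (by rw [hd, hx, e]), h.vert d' x' (by rw [hd', hx', e'])]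
  have hs : s' = s ∨ s' = s + 1 ∨ s = s' + 1 := by clear * -; revert s s'; decide
  rcases hs with rfl | rfl | rfl
  · rw [h.injective (hx.trans hx'.symm), dist_self]
    exact Nat.zero_le _
  · rw [h.injective (hx'.trans (by rw [h.next, hx]; rfl) : lab x' = lab (m.next x))]
    exact dist_next_le_one x
  · rw [h.injective (hx.trans (by rw [h.next, hx']; rfl) : lab x = lab (m.next x')), dist_comm]
    exact dist_next_le_one x'

/-- The child that loses the corner `s + 1` has both the vertex `w` and the old corner `s` among its
corners. -/
theorem dist_inserted_le_one (h : Coding m t lab) (ht : Tern t) {w : Word}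
    (hw : w ∈ internalNodes t) {s : Fin 3} {d d' : m.Dart} (hd : org (lab d) = .inl w)
    (hd' : org (lab d') = corner w s) : m.dist (m.origin d) (m.origin d') ≤ 1 := by
  refine h.dist_corner_le_one ht (ht.snoc_mem hw (s + 1)) (s := s + 1) (s' := s) ?_ ?_
  · rw [hd, corner_snoc_self]
  · rw [hd', corner_snoc_of_ne _ (by simp)]

/-- A corner of a triangle inside the triangle `w` can be joined to a corner of `w` by a path
whose length is controlled by the type. -/
theorem exists_corner_dist_le (h : Coding m t lab) (ht : Tern t) (c : Fin 3 → ℕ) {w y : Word}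
    (hy : w ++ y ∈ t) (s : Fin 3) {d : m.Dart} (hd : org (lab d) = corner (w ++ y) s) :
    ∃ s₀ z, org (lab z) = corner w s₀ ∧
      m.dist (m.origin z) (m.origin d) + c s₀ ≤ typ c y s := by
  induction y using List.reverseRecOn generalizing s d with
  | nil =>
    refine ⟨s, d, by simpa using hd, ?_⟩
    rw [dist_self, zero_add]
    exact le_rfl
  | append_singleton y a ih =>
    rw [← List.append_assoc] at hy hd
    have hy' : w ++ y ∈ t := ht.prefix_mem hy
    rw [corner_snoc] at hd
    rw [typ_snoc, step]
    split_ifs at hd ⊢ with ha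
    · obtain ⟨s₁, hs₁⟩ := exists_eq_lo (typ c y)
      obtain ⟨d₁, hd₁⟩ := h.exists_dart_corner ht hy' s₁
      obtain ⟨s₀, z, hz, hle⟩ := ih hy' s₁ hd₁
      refine ⟨s₀, z, hz, ?_⟩
      have hint : w ++ y ∈ internalNodes t := mem_internalNodes_iff.2 ⟨hy', a, hy⟩
      have h1 := h.dist_inserted_le_one ht hint hd hd₁
      have h2 := dist_triangle (m.origin z) (m.origin d₁) (m.origin d)
      rw [dist_comm] at h1
      omega
    · exact ih hy' s hd

theorem exists_corner_dist_node_le (h : Coding m t lab) (ht : Tern t) (c : Fin 3 → ℕ)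
    {w y : Word} (hy : w ++ y ∈ internalNodes t) {d : m.Dart}
    (hd : org (lab d) = .inl (w ++ y)) :
    ∃ s₀ z, org (lab z) = corner w s₀ ∧ m.dist (m.origin z) (m.origin d) + c s₀ ≤ val c y := by
  have hmem := ht.snoc_mem hy 0
  rw [List.append_assoc] at hmem
  obtain ⟨s₀, z, hz, hle⟩ := h.exists_corner_dist_le ht c hmem 0 (d := d)
    (by rw [hd, ← List.append_assoc, corner_snoc_self])
  refine ⟨s₀, z, hz, hle.trans_eq ?_⟩
  rw [typ_snoc, step, if_pos rfl]
  rfl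

/-! ### Distance to the root vertex. -/

theorem org_root (h : Coding m t lab) : org (lab m.root) = .inr 0 := by
  have := h.inv (m.inv m.root)
  rw [m.inv_inv, h.next, h.root] at this
  exact this

/-- The distance to the root vertex, as a function of labels. -/
def rootDist : VLabel → ℕ
  | .inl v => val rootType v
  | .inr s => rootType s

theorem rootDist_corner (u : Word) (s : Fin 3) : rootDist (corner u s) = typ rootType u s := by
  induction u using List.reverseRecOn with
  | nil => rfl
  | append_singleton u a ih =>
    rw [corner_snoc, typ_snoc, step]
    split_ifs
    · rfl
    · exact ih

theorem dist_root (h : Coding m t lab) (ht : Tern t) {w : Word} (hw : w ∈ internalNodes t)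
    {d : m.Dart} (hd : org (lab d) = .inl w) :
    m.dist m.rootVertex (m.origin d) = val rootType w := by
  refine le_antisymm ?_ ?_
  · obtain ⟨s₀, z, hz, hle⟩ := h.exists_corner_dist_node_le ht rootType (w := []) hw hd
    have h1 : m.dist (m.origin m.root) (m.origin z) ≤ rootType s₀ := by
      by_cases hs : s₀ = 0
      · subst hs
        rw [h.vert _ _ (h.org_root.trans hz.symm), dist_self]
        exact Nat.zero_le _
      · rw [rootType, if_neg hs]
        exact h.dist_corner_le_one ht ht.nil_mem (s := 0) h.org_root hz
    have h2 := dist_triangle (m.origin m.root) (m.origin z) (m.origin d)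
    change m.dist (m.origin m.root) (m.origin d) ≤ _
    omega
  -- The lower bound: the values of `rootDist` at the corners of a triangle form its type, whose
  -- entries differ by at most one.
  · have := h.sub_le_dist (F := fun x => (rootDist x : ℤ)) (fun u hu s s' => ?_) (fun i j => ?_)
      d m.root
    · rw [hd, h.org_root, dist_comm] at this
      have h0 : rootDist (.inr 0) = 0 := rfl
      have h1 : rootDist (.inl w) = val rootType w := rfl
      rw [h0, h1] at this
      change _ ≤ m.dist (m.origin m.root) (m.origin d)
      omega
    · simp only [rootDist_corner]
      have h1 := typ_le_lo (c := rootType) (by decide) u s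
      have h2 := lo_le (typ rootType u) s'
      omega
    · simp only [rootDist]
      have : rootType i ≤ 1 := by unfold rootType; split_ifs <;> simp
      omega

/-! ### Distances between two internal vertices. -/

open Classical in
/-- The distance to the corners of the triangle `w` for the vertices inside this triangle, and `0`
for the other vertices. -/
noncomputable def depth (w : Word) : VLabel → ℤ
  | .inl v => if w <+: v then val (fun _ => 0) (v.drop w.length) else 0
  | .inr _ => 0

theorem depth_append (w y : Word) : depth w (.inl (w ++ y)) = val (fun _ => 0) y := by
  rw [depth, if_pos (List.prefix_append _ _), List.drop_left]

theorem depth_of_not_prefix {w v : Word} (h : ¬ w <+: v) : depth w (.inl v) = 0 := by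
  rw [depth, if_neg h]

/-- The corners of `w` are outer or strict prefixes of `w`, so they have depth 0; from there depth
follows the recursion of `typ`. -/
theorem depth_corner_append (w y : Word) (s : Fin 3) :
    depth w (corner (w ++ y) s) = typ (fun _ => 0) y s := by
  induction y using List.reverseRecOn with
  | nil =>
    rw [List.append_nil]
    change _ = 0
    cases e : corner w s with
    | inr i => rfl
    | inl v =>
      obtain ⟨y, hy, -⟩ := corner_eq_inl_iff.1 e
      refine depth_of_not_prefix fun hp => ?_
      have h1 := hp.length_le
      have h2 := congrArg List.length hy
      simp only [List.length_append, List.length_cons] at h2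
      omega
  | append_singleton y a ih =>
    rw [← List.append_assoc, corner_snoc, typ_snoc, step]
    split_ifs
    · rw [depth_append]
      rfl
    · exact ih

theorem depth_corner_of_not_prefix {w u : Word} (h : ¬ w <+: u) (s : Fin 3) :
    depth w (corner u s) = 0 := by
  cases e : corner u s with
  | inr i => rfl
  | inl v =>
    obtain ⟨y, rfl, -⟩ := corner_eq_inl_iff.1 e
    exact depth_of_not_prefix fun hp => h (hp.trans (List.prefix_append _ _))

theorem depth_corner_sub_le (w u : Word) (s s' : Fin 3) :
    depth w (corner u s) - depth w (corner u s') ≤ 1 := by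
  by_cases h : w <+: u
  · obtain ⟨y, rfl⟩ := h
    rw [depth_corner_append, depth_corner_append]
    have h1 := typ_le_lo (c := fun _ => 0) (fun _ => Nat.zero_le _) y s
    have h2 := lo_le (typ (fun _ => 0) y) s'
    omega
  · rw [depth_corner_of_not_prefix h, depth_corner_of_not_prefix h]
    norm_num

theorem not_prefix_of_ne {w u : Word} {a b : ℕ} (hab : a ≠ b) (h : w ++ [a] <+: u) :
    ¬ w ++ [b] <+: u := by
  obtain ⟨x, rfl⟩ := h
  rintro ⟨y, hy⟩
  rw [List.append_assoc, List.append_assoc, List.append_cancel_left_eq] at hy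
  exact hab (List.cons.inj hy).1.symm

/-- The vertex `w` is itself a corner of its child, and every corner of that child is within one of
it. The lower bound is the variation of `depth`. -/
theorem dist_ancestor_bounds (h : Coding m t lab) (ht : Tern t) {w y : Word} {a : ℕ}
    {d d' : m.Dart} (hy : w ++ a :: y ∈ internalNodes t) (hd : org (lab d) = .inl w)
    (hd' : org (lab d') = .inl (w ++ a :: y)) :
    val (fun _ => 0) y ≤ m.dist (m.origin d) (m.origin d') ∧
      m.dist (m.origin d) (m.origin d') ≤ val (fun _ => 0) y + 1 := by
  rw [List.append_cons] at hy hd'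
  constructor
  · have := h.sub_le_dist (F := depth (w ++ [a])) (fun u _ => depth_corner_sub_le _ u)
      (fun i j => by simp [depth]) d' d
    rw [hd, hd', depth_append, depth_of_not_prefix, dist_comm] at this
    · omega
    · exact fun hp => by simpa using hp.length_le
  · obtain ⟨s₀, z, hz, hle⟩ := h.exists_corner_dist_node_le ht (fun _ => 0) hy hd'
    obtain ⟨r, rfl⟩ := ht.exists_letter (ht.prefix_mem hy.1)
    have h1 := h.dist_corner_le_one ht (ht.prefix_mem hy.1)
      (hd.trans (corner_snoc_self w r).symm) hz
    have h2 := dist_triangle (m.origin d) (m.origin z) (m.origin d')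
    omega

/-- The two vertices lie in different children of `w`, and `w` is a corner of both: a path through
`w` pays at most one extra step on each side. The lower bound uses the difference of the two depths.
-/
theorem dist_separated_bounds (h : Coding m t lab) (ht : Tern t) {w y y' : Word} {a a' : ℕ}
    (haa' : a ≠ a') {d d' : m.Dart} (hy : w ++ a :: y ∈ internalNodes t)
    (hy' : w ++ a' :: y' ∈ internalNodes t) (hd : org (lab d) = .inl (w ++ a :: y))
    (hd' : org (lab d') = .inl (w ++ a' :: y')) :
    val (fun _ => 0) y + val (fun _ => 0) y' ≤ m.dist (m.origin d) (m.origin d') ∧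
      m.dist (m.origin d) (m.origin d') ≤ val (fun _ => 0) y + val (fun _ => 0) y' + 2 := by
  have hw : w ∈ internalNodes t := ht.mem_internalNodes_of_append hy.1
  rw [List.append_cons] at hy hd hy' hd'
  constructor
  · have := h.sub_le_dist (F := fun x => depth (w ++ [a]) x - depth (w ++ [a']) x)
      (fun u _ s s' => ?_) (fun i j => by simp [depth]) d d'
    · simp only [hd, hd'] at this
      rw [depth_append, depth_append, depth_of_not_prefix, depth_of_not_prefix] at this
      · omega
      · exact not_prefix_of_ne haa'.symm (List.prefix_append _ _)
      · exact not_prefix_of_ne haa' (List.prefix_append _ _)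
    · have h1 := depth_corner_sub_le (w ++ [a]) u s s'
      have h2 := depth_corner_sub_le (w ++ [a']) u s' s
      -- A face lies below at most one of the two children, so one of the depths vanishes on its
      -- corners and the difference still varies by at most one.
      by_cases hp : w ++ [a] <+: u
      · have h3 := depth_corner_of_not_prefix (not_prefix_of_ne haa' hp)
        simp only [h3]
        linarith
      · have h3 := depth_corner_of_not_prefix hp
        simp only [h3]
        linarith
  · obtain ⟨x, hx⟩ := h.exists_dart_internal ht hw
    obtain ⟨s₀, z, hz, hle⟩ := h.exists_corner_dist_node_le ht (fun _ => 0) hy hd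
    obtain ⟨s₀', z', hz', hle'⟩ := h.exists_corner_dist_node_le ht (fun _ => 0) hy' hd'
    obtain ⟨r, rfl⟩ := ht.exists_letter (ht.prefix_mem hy.1)
    obtain ⟨r', rfl⟩ := ht.exists_letter (ht.prefix_mem hy'.1)
    have h1 := h.dist_corner_le_one ht (ht.prefix_mem hy.1) hz
      (hx.trans (corner_snoc_self w r).symm)
    have h2 := h.dist_corner_le_one ht (ht.prefix_mem hy'.1)
      (hx.trans (corner_snoc_self w r').symm) hz'
    have h3 := dist_triangle (m.origin d) (m.origin z) (m.origin d')
    have h4 := dist_triangle (m.origin z) (m.origin x) (m.origin d')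
    have h5 := dist_triangle (m.origin x) (m.origin z') (m.origin d')
    have h6 := dist_comm (m.origin d) (m.origin z)
    omega

theorem abs_dist_sub_passage₂_le (h : Coding m t lab) (ht : Tern t) {u v : Word} {d d' : m.Dart}
    (hu : u ∈ internalNodes t) (hv : v ∈ internalNodes t) (hd : org (lab d) = .inl u)
    (hd' : org (lab d') = .inl v) :
    |(m.dist (m.origin d) (m.origin d') : ℤ) - (passage₂ u v : ℤ)| ≤ 4 := by
  obtain ⟨w, x, y, rfl, rfl, hne, hp⟩ := exists_passage₂_eq u v
  rw [hp, abs_le]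
  -- Distance and passage number are each known up to 2 or better. As `passage []` is 1 and not 0,
  -- equal vertices already give a discrepancy of 2; every case stays within 2.
  rcases x with _ | ⟨a, x⟩ <;> rcases y with _ | ⟨b, y⟩
  · rw [h.vert d d' (by rw [hd, hd']), dist_self, passage_nil]
    norm_num
  · rw [List.append_nil] at hd
    have h1 := h.dist_ancestor_bounds ht hv hd hd'
    have h2 := passage_cons_bounds b y
    rw [passage_nil]
    omega
  · rw [List.append_nil] at hd'
    have h1 := h.dist_ancestor_bounds ht hu hd' hd
    have h2 := passage_cons_bounds a x
    rw [passage_nil, dist_comm]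
    omega
  · have h1 := h.dist_separated_bounds ht (hne a x b y rfl rfl) hu hv hd hd'
    have h2 := passage_cons_bounds a x
    have h3 := passage_cons_bounds b y
    omega

end Coding

/-! ### Faces and internal vertices of a coded map -/

namespace Coding

variable {m : RootedMap} {t : Set Word} {lab : m.Dart → Option Word × Fin 3}

theorem origin_mem_internalVertices_iff (h : Coding m t lab) {d : m.Dart} :
    m.origin d ∈ m.internalVertices ↔ ∃ w, org (lab d) = .inl w := by
  constructor
  · intro hd
    cases e : org (lab d) with
    | inl w => exact ⟨w, rfl⟩
    | inr s =>
      obtain ⟨x, hx⟩ := h.exists_dart (none_mem_labels (s := -s))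
      have h1 : m.origin x = m.origin d := h.vert _ _ (by rw [hx, e]; simp [org])
      obtain ⟨u, hu⟩ := h.ne_outerFace_iff.1 (hd x h1)
      rw [hx] at hu
      cases hu
  · rintro ⟨w, hw⟩ x hx
    rw [h.ne_outerFace_iff, ← Option.ne_none_iff_exists']
    intro e
    rw [← h.origin_eq_iff.1 hx, show lab x = (none, (lab x).2) from Prod.ext e rfl] at hw
    cases hw

theorem faceDegree_eq (h : Coding m t lab) (f : m.Face) : m.faceDegree f = 3 := by
  obtain ⟨d, rfl⟩ := faceOf_surjective f
  have : Function.Bijective fun x : {x // m.faceOf x = m.faceOf d} => (lab x).2 := by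
    constructor
    · rintro ⟨x, hx⟩ ⟨y, hy⟩ hxy
      exact Subtype.ext (h.injective (Prod.ext (h.faceOf_eq_iff.1 (hx.trans hy.symm)) hxy))
    · intro s
      have hmem : ((lab d).1, s) ∈ labels t := h.mem d
      obtain ⟨x, hx⟩ := h.exists_dart hmem
      exact ⟨⟨x, h.faceOf_eq_iff.2 (by rw [hx])⟩, by simp only [hx]⟩
  rw [RootedMap.faceDegree, Nat.card_congr (Equiv.ofBijective _ this)]
  simp

end Coding

/-- Each growth adds three nodes and, in balance, two leaves. -/
theorem ncard_leaves {t : Set Word} (ht : Tern t) : 3 * (leaves t).ncard = 2 * t.ncard + 1 := by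
  refine ht.induction (P := fun t => 3 * (leaves t).ncard = 2 * t.ncard + 1) ?_ ?_
  · have : leaves {[]} = {[]} := by
      ext v
      rw [mem_leaves_iff]
      simp
    rw [this]
    simp
  · intro t u ht hu ih
    have h1 : leaves (growTree t u) = (leaves t \ {u}) ∪ Set.range fun s => u ++ [letter s] := by
      ext v
      rw [leaves_growTree ht hu]
      exact or_congr Iff.rfl (exists_congr fun s => eq_comm)
    have hfin : (leaves t).Finite := ht.finite.subset fun v hv => hv.1
    have h2 : (Set.range fun s => u ++ [letter s]).ncard = 3 := by
      rw [← Set.image_univ, Set.ncard_image_of_injective _ fun a b h => by simpa using h]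
      simp
    have h3 : (leaves (growTree t u)).ncard = (leaves t).ncard - 1 + 3 := by
      rw [h1, Set.ncard_union_eq _ hfin.sdiff (Set.finite_range _), h2,
        Set.ncard_sdiff_singleton_of_mem hu]
      rw [Set.disjoint_left]
      rintro _ hv ⟨s, rfl⟩
      exact (mem_leaves_iff.1 hu).2 _ hv.1.1
    have h4 : (growTree t u).ncard = t.ncard + 3 := by
      have := encard_growTree hu
      rw [← (ht.growTree hu).finite.cast_ncard_eq, ← ht.finite.cast_ncard_eq] at this
      exact_mod_cast this
    have h5 : 0 < (leaves t).ncard := (Set.ncard_pos hfin).2 ⟨u, hu⟩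
    omega

theorem tern_of_mem_ternaryTrees {t : Set Word} {n : ℕ} (h : t ∈ ternaryTrees n) : Tern t :=
  ⟨h.1, h.2.1, Set.finite_of_encard_eq_coe h.2.2⟩

theorem growTree_mem_ternaryTrees {t : Set Word} {n : ℕ} (h : t ∈ ternaryTrees n) {u : Word}
    (hu : u ∈ leaves t) : growTree t u ∈ ternaryTrees (n + 3) := by
  have := (tern_of_mem_ternaryTrees h).growTree hu
  refine ⟨this.planar, this.kids, ?_⟩
  rw [encard_growTree hu, h.2.2]
  norm_cast

theorem singleton_mem_ternaryTrees : {[]} ∈ ternaryTrees 1 :=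
  ⟨Tern.singleton.planar, Tern.singleton.kids, by simp⟩

/-! ### The bijection between maps and trees -/

/-- The class `c` consists of maps coded by `t`. -/
def IsCodedBy (c : MapClass) (t : Set Word) : Prop :=
  ∃ (m : RootedMap) (lab : _), Quotient.mk _ m = c ∧ Tern t ∧ Coding m t lab

theorem IsCodedBy.exists_coding {m : RootedMap} {t : Set Word}
    (h : IsCodedBy (Quotient.mk _ m) t) : Tern t ∧ ∃ lab, Coding m t lab := by
  obtain ⟨m', lab, hm, ht, h⟩ := h
  obtain ⟨e, he⟩ := Quotient.exact hm
  exact ⟨ht, _, h.congr he.symm⟩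

theorem IsCodedBy.tree_unique {c : MapClass} {t t' : Set Word} (h : IsCodedBy c t)
    (h' : IsCodedBy c t') : t = t' := by
  induction c using Quotient.inductionOn
  obtain ⟨ht, lab, h⟩ := h.exists_coding
  obtain ⟨ht', lab', h'⟩ := h'.exists_coding
  exact h.tree_unique ht ht' h'

theorem IsCodedBy.class_unique {c c' : MapClass} {t : Set Word} (h : IsCodedBy c t)
    (h' : IsCodedBy c' t) : c = c' := by
  obtain ⟨m, lab, rfl, ht, h⟩ := h
  obtain ⟨m', lab', rfl, -, h'⟩ := h'
  obtain ⟨e, he, -⟩ := h.exists_iso ht h'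
  exact Quotient.sound ⟨e, he⟩

open Classical in
/-- The tree that codes a map. -/
noncomputable def treeOf (c : MapClass) : Set Word :=
  if h : ∃ t, IsCodedBy c t then h.choose else ∅

theorem IsCodedBy.treeOf_eq {c : MapClass} {t : Set Word} (h : IsCodedBy c t) : treeOf c = t := by
  have hex : ∃ t, IsCodedBy c t := ⟨t, h⟩
  rw [treeOf, dif_pos hex]
  exact hex.choose_spec.tree_unique h

open Classical in
/-- The labels of the darts of a map. -/
noncomputable def labOf (m : RootedMap) : m.Dart → Option Word × Fin 3 :=
  if h : ∃ lab, Coding m (treeOf (Quotient.mk _ m)) lab then h.choose else fun _ => (none, 0)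

theorem IsCodedBy.coding_labOf {m : RootedMap} {t : Set Word}
    (h : IsCodedBy (Quotient.mk _ m) t) : Coding m t (labOf m) := by
  obtain ⟨-, lab, h'⟩ := h.exists_coding
  have hex : ∃ lab, Coding m (treeOf (Quotient.mk _ m)) lab := ⟨lab, by rwa [h.treeOf_eq]⟩
  rw [labOf, dif_pos hex]
  exact h.treeOf_eq ▸ hex.choose_spec

/-- The node attached to an internal vertex. -/
noncomputable def nodeOf (m : RootedMap) (v : m.Vertex) : Word :=
  -- Outer vertices get a dummy value, which is harmless because only internal vertices are ever
  -- considered.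
  (org (labOf m v.out)).elim id fun _ => []

/-- The leaf attached to a finite face. -/
noncomputable def leafOf (m : RootedMap) (f : m.Face) : Word := (labOf m f.out).1.getD []

section coded

variable {m : RootedMap} {t : Set Word}

theorem IsCodedBy.nodeOf_eq (h : IsCodedBy (Quotient.mk _ m) t) {d : m.Dart} {w : Word}
    (hw : org (labOf m d) = .inl w) : nodeOf m (m.origin d) = w := by
  have : m.origin (m.origin d).out = m.origin d := Quotient.out_eq _
  rw [nodeOf, h.coding_labOf.origin_eq_iff.1 this, hw]
  rfl

theorem IsCodedBy.leafOf_eq (h : IsCodedBy (Quotient.mk _ m) t) {d : m.Dart} {u : Word}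
    (hu : (labOf m d).1 = some u) : leafOf m (m.faceOf d) = u := by
  have : m.faceOf (m.faceOf d).out = m.faceOf d := Quotient.out_eq _
  rw [leafOf, h.coding_labOf.faceOf_eq_iff.1 this, hu]
  rfl

theorem IsCodedBy.exists_nodeOf (h : IsCodedBy (Quotient.mk _ m) t) {v : m.Vertex}
    (hv : v ∈ m.internalVertices) :
    ∃ d, m.origin d = v ∧ org (labOf m d) = .inl (nodeOf m v) ∧
      nodeOf m v ∈ internalNodes t := by
  obtain ⟨d, rfl⟩ := origin_surjective v
  obtain ⟨w, hw⟩ := h.coding_labOf.origin_mem_internalVertices_iff.1 hv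
  rw [h.nodeOf_eq hw]
  exact ⟨d, rfl, hw, mem_internalNodes_of_org h.exists_coding.1 (h.coding_labOf.mem d) hw⟩

theorem IsCodedBy.exists_leafOf (h : IsCodedBy (Quotient.mk _ m) t) {f : m.Face}
    (hf : f ∈ m.finiteFaces) :
    leafOf m f ∈ leaves t ∧ ∀ d, m.faceOf d = f ↔ (labOf m d).1 = some (leafOf m f) := by
  obtain ⟨u, hu, hfu⟩ := h.coding_labOf.exists_label hf
  obtain ⟨d, rfl⟩ := faceOf_surjective f
  rw [h.leafOf_eq ((hfu d).1 rfl)]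
  exact ⟨hu, hfu⟩

theorem IsCodedBy.bijOn_nodeOf (h : IsCodedBy (Quotient.mk _ m) t) :
    Set.BijOn (nodeOf m) m.internalVertices (internalNodes t) := by
  have hc := h.coding_labOf
  have ht := h.exists_coding.1
  refine ⟨fun v hv => ?_, fun v hv v' hv' e => ?_, fun w hw => ?_⟩
  · obtain ⟨-, -, -, h'⟩ := h.exists_nodeOf hv
    exact h'
  · obtain ⟨d, rfl, hd, -⟩ := h.exists_nodeOf hv
    obtain ⟨d', rfl, hd', -⟩ := h.exists_nodeOf hv'
    exact hc.vert _ _ (by rw [hd, hd', e])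
  · obtain ⟨d, hd⟩ := hc.exists_dart_internal ht hw
    exact ⟨m.origin d, hc.origin_mem_internalVertices_iff.2 ⟨w, hd⟩, h.nodeOf_eq hd⟩

theorem IsCodedBy.bijOn_leafOf (h : IsCodedBy (Quotient.mk _ m) t) :
    Set.BijOn (leafOf m) m.finiteFaces (leaves t) := by
  refine ⟨fun f hf => (h.exists_leafOf hf).1, fun f hf f' hf' e => ?_, fun u hu => ?_⟩
  · obtain ⟨d, rfl⟩ := faceOf_surjective f
    have := ((h.exists_leafOf hf).2 d).1 rfl
    rw [e] at this
    exact ((h.exists_leafOf hf').2 d).2 this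
  · obtain ⟨f, hf, hfu⟩ := h.coding_labOf.exists_face hu
    obtain ⟨d, rfl⟩ := faceOf_surjective f
    exact ⟨_, hf, h.leafOf_eq ((hfu d).1 rfl)⟩

theorem IsCodedBy.card_face (h : IsCodedBy (Quotient.mk _ m) t) :
    Nat.card m.Face = (leaves t).ncard + 1 := by
  have := m.finite_dart
  have : Finite m.Face := Finite.of_surjective m.faceOf faceOf_surjective
  have h1 : m.finiteFaces.ncard = (leaves t).ncard := by
    rw [← h.bijOn_leafOf.image_eq, h.bijOn_leafOf.injOn.ncard_image]
  have h2 : m.finiteFaces = Set.univ \ {m.outerFace} := by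
    ext f
    simp [RootedMap.finiteFaces]
  rw [← h1, h2, Set.ncard_sdiff_singleton_add_one (Set.mem_univ _), Set.ncard_univ]

end coded

/-- The leaf attached to the distinguished face of a marked map. -/
noncomputable def markOf (M : MarkedClass) : Word := leafOf M.out.map M.out.face

/-- An isomorphism of marked maps transports the labelling, and labellings are unique, so the leaf
does not depend on the representative. -/
theorem IsCodedBy.markOf_eq {A : MarkedMap} {t : Set Word}
    (h : IsCodedBy (Quotient.mk _ A.map) t) :
    markOf (Quotient.mk _ A) = leafOf A.map A.face := by
  have hout : (Quotient.mk _ A : MarkedClass).out ≈ A := Quotient.mk_out A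
  set B := (Quotient.mk _ A : MarkedClass).out with hB
  obtain ⟨e, he, hf⟩ := hout
  have hB' : IsCodedBy (Quotient.mk _ B.map) t := by
    have : (Quotient.mk _ B.map : MapClass) = Quotient.mk _ A.map := Quotient.sound ⟨e, he⟩
    rwa [this]
  have hlab := hB'.coding_labOf.lab_unique h.exists_coding.1 (h.coding_labOf.congr he)
  obtain ⟨d, hd⟩ := faceOf_surjective B.face
  have h1 := ((h.exists_leafOf A.finite_face).2 (e d)).1 ((hf d).1 hd)
  have h2 : (labOf B.map d).1 = some (leafOf A.map A.face) := by
    rw [hlab]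
    exact h1
  have := hB'.leafOf_eq h2
  rwa [hd] at this

theorem IsCodedBy.markOf_mem {M : MarkedClass} {t : Set Word} (h : IsCodedBy M.map t) :
    markOf M ∈ leaves t := by
  induction M using Quotient.inductionOn with
  | _ A =>
    rw [IsCodedBy.markOf_eq h]
    exact (IsCodedBy.exists_leafOf h A.finite_face).1

theorem IsCodedBy.grow {M : MarkedClass} {t : Set Word} (h : IsCodedBy M.map t) :
    IsCodedBy M.grow (growTree t (markOf M)) := by
  have hmem := h.markOf_mem
  induction M using Quotient.inductionOn with
  | _ A =>
    change IsCodedBy (Quotient.mk _ A.map) t at h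
    have ht := h.exists_coding.1
    refine ⟨A.map.insert A.face, _, rfl, ht.growTree hmem, h.coding_labOf.insert ht hmem ?_⟩
    rw [h.markOf_eq]
    exact (h.exists_leafOf A.finite_face).2

theorem IsCodedBy.marked_unique {M M' : MarkedClass} {t : Set Word} (h : IsCodedBy M.map t)
    (h' : IsCodedBy M'.map t) (hmark : markOf M = markOf M') : M = M' := by
  induction M using Quotient.inductionOn with
  | _ A =>
  induction M' using Quotient.inductionOn with
  | _ B =>
    change IsCodedBy (Quotient.mk _ A.map) t at h
    change IsCodedBy (Quotient.mk _ B.map) t at h'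
    rw [h.markOf_eq, h'.markOf_eq] at hmark
    obtain ⟨e, he, hlab⟩ := h.coding_labOf.exists_iso h.exists_coding.1 h'.coding_labOf
    refine Quotient.sound ⟨e, he, fun d => ?_⟩
    rw [(h.exists_leafOf A.finite_face).2, (h'.exists_leafOf B.finite_face).2, hlab, hmark]

theorem IsCodedBy.exists_marked {c : MapClass} {t : Set Word} (h : IsCodedBy c t) {u : Word}
    (hu : u ∈ leaves t) : ∃ M : MarkedClass, M.map = c ∧ markOf M = u := by
  induction c using Quotient.inductionOn with
  | _ m =>
    obtain ⟨f, hf, e⟩ := h.bijOn_leafOf.surjOn hu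
    refine ⟨Quotient.mk _ ⟨m, f, hf⟩, rfl, ?_⟩
    rw [IsCodedBy.markOf_eq (A := ⟨m, f, hf⟩) h, e]

/-! ### Stack-triangulations -/

theorem isCodedBy_triangle : IsCodedBy (Quotient.mk _ RootedMap.triangle) {[]} :=
  ⟨_, _, rfl, Tern.singleton, Coding.triangle⟩

theorem exists_isCodedBy {K : ℕ} {c : MapClass} (hc : c ∈ stackTriangulations (K + 1)) :
    ∃ t ∈ ternaryTrees (3 * (K + 1) - 2), IsCodedBy c t := by
  induction K generalizing c with
  | zero =>
    obtain rfl : c = _ := hc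
    exact ⟨{[]}, singleton_mem_ternaryTrees, isCodedBy_triangle⟩
  | succ K ih =>
    obtain ⟨M, hM, rfl⟩ := hc
    obtain ⟨t, ht, h⟩ := ih hM
    exact ⟨_, growTree_mem_ternaryTrees ht h.markOf_mem, h.grow⟩

theorem isCodedBy_treeOf {K : ℕ} {c : MapClass} (hc : c ∈ stackTriangulations (K + 1)) :
    IsCodedBy c (treeOf c) := by
  obtain ⟨t, -, h⟩ := exists_isCodedBy hc
  rwa [h.treeOf_eq]

theorem treeOf_mem {K : ℕ} {c : MapClass} (hc : c ∈ stackTriangulations (K + 1)) :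
    treeOf c ∈ ternaryTrees (3 * (K + 1) - 2) := by
  obtain ⟨t, ht, h⟩ := exists_isCodedBy hc
  rwa [h.treeOf_eq]

/-- Cut the children of a deepest internal node, realize the smaller tree, mark the face of the leaf
so created, and insert a vertex there. -/
theorem exists_stack_of_tree {K : ℕ} {t : Set Word} (ht : t ∈ ternaryTrees (3 * (K + 1) - 2)) :
    ∃ c ∈ stackTriangulations (K + 1), IsCodedBy c t := by
  induction K generalizing t with
  | zero =>
    obtain ⟨x, rfl⟩ := Set.encard_eq_one.1 (show t.encard = 1 from ht.2.2)
    obtain rfl : [] = x := (tern_of_mem_ternaryTrees ht).nil_mem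
    exact ⟨_, rfl, isCodedBy_triangle⟩
  | succ K ih =>
    have htern := tern_of_mem_ternaryTrees ht
    have hcard : t.encard = ((3 * K + 1 : ℕ) : ℕ∞) + 3 := by
      rw [ht.2.2, show 3 * (K + 1 + 1) - 2 = 3 * K + 1 + 3 by omega]
      norm_cast
    have hne : (internalNodes t).Nonempty := by
      by_contra he
      rw [Set.not_nonempty_iff_eq_empty] at he
      rw [htern.eq_singleton he, Set.encard_singleton] at hcard
      have : 1 = 3 * K + 1 + 3 := by exact_mod_cast hcard
      omega
    obtain ⟨t₀, w, ht₀, hw, rfl⟩ := htern.exists_eq_growTree_of_nonempty hne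
    rw [encard_growTree hw, ← ht₀.finite.cast_ncard_eq] at hcard
    have hcard' : t₀.ncard + 3 = 3 * K + 1 + 3 := by exact_mod_cast hcard
    obtain ⟨c, hc, h⟩ := ih (t := t₀) ⟨ht₀.planar, ht₀.kids, by
      rw [← ht₀.finite.cast_ncard_eq, show t₀.ncard = 3 * (K + 1) - 2 by omega]⟩
    obtain ⟨M, rfl, rfl⟩ := h.exists_marked hw
    exact ⟨M.grow, ⟨M, hc, rfl⟩, h.grow⟩

theorem bijOn_treeOf (K : ℕ) :
    Set.BijOn treeOf (stackTriangulations (K + 1)) (ternaryTrees (3 * (K + 1) - 2)) := by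
  refine ⟨fun c hc => treeOf_mem hc, fun c hc c' hc' e => ?_, fun t ht => ?_⟩
  · have h := isCodedBy_treeOf hc
    rw [e] at h
    exact h.class_unique (isCodedBy_treeOf hc')
  · obtain ⟨c, hc, h⟩ := exists_stack_of_tree ht
    exact ⟨c, hc, h.treeOf_eq⟩

/-! ### Histories -/

/-- The pair of a tree and a leaf attached to a marked map. -/
noncomputable def pairOf (M : MarkedClass) : Set Word × Word := (treeOf M.map, markOf M)

theorem mem_stack_of_history {h : List MarkedClass} {c : MapClass} (hh : IsMapHistory h c) :
    c ∈ stackTriangulations (h.length + 1) ∧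
      ∀ M ∈ h, ∃ K, M.map ∈ stackTriangulations (K + 1) := by
  induction hh with
  | nil => exact ⟨rfl, by simp⟩
  | snoc h M _ ih =>
    rw [List.length_append]
    refine ⟨⟨M, ih.1, rfl⟩, fun N hN => ?_⟩
    rcases List.mem_append.1 hN with hN | hN
    · exact ih.2 N hN
    · obtain rfl := List.mem_singleton.1 hN
      exact ⟨_, ih.1⟩

theorem isTreeHistory_map {h : List MarkedClass} {c : MapClass} (hh : IsMapHistory h c) :
    IsTreeHistory (h.map pairOf) (treeOf c) := by
  induction hh with
  | nil =>
    rw [isCodedBy_triangle.treeOf_eq]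
    exact .nil
  | snoc h M hM ih =>
    have hc := isCodedBy_treeOf (mem_stack_of_history hM).1
    rw [hc.grow.treeOf_eq, List.map_append]
    exact .snoc _ _ _ ih hc.markOf_mem

/-- Every leaf of a coded tree is the mark of some finite face, so each growth can be lifted to an
insertion. -/
theorem exists_mapHistory {h' : List (Set Word × Word)} {t : Set Word}
    (hh : IsTreeHistory h' t) :
    ∃ h c, IsMapHistory h c ∧ h.map pairOf = h' ∧ treeOf c = t := by
  induction hh with
  | nil => exact ⟨[], _, .nil, rfl, isCodedBy_triangle.treeOf_eq⟩
  | snoc h' t u _ hu ih =>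
    obtain ⟨h, c, hc, rfl, rfl⟩ := ih
    have hcode := isCodedBy_treeOf (mem_stack_of_history hc).1
    obtain ⟨M, rfl, rfl⟩ := hcode.exists_marked hu
    exact ⟨h ++ [M], _, .snoc h M hc, by rw [List.map_append]; rfl, hcode.grow.treeOf_eq⟩

theorem isTreeHistory_cases {h : List (Set Word × Word)} {t : Set Word} (hh : IsTreeHistory h t) :
    (h = [] ∧ t = {[]}) ∨ ∃ h₀ t₀ u, h = h₀ ++ [(t₀, u)] ∧ t = growTree t₀ u := by
  cases hh with
  | nil => exact .inl ⟨rfl, rfl⟩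
  | snoc h t u _ _ => exact .inr ⟨h, t, u, rfl, rfl⟩

theorem isTreeHistory_unique {h : List (Set Word × Word)} {t t' : Set Word}
    (hh : IsTreeHistory h t) (hh' : IsTreeHistory h t') : t = t' := by
  rcases isTreeHistory_cases hh with ⟨rfl, rfl⟩ | ⟨h₀, t₀, u, rfl, rfl⟩ <;>
    rcases isTreeHistory_cases hh' with ⟨e, rfl⟩ | ⟨h₁, t₁, u₁, e, rfl⟩
  · rfl
  · simp at e
  · simp at e
  · obtain ⟨-, e⟩ := List.append_inj' e rfl
    cases e
    rfl

theorem map_injOn {α β : Type*} {f : α → β} {S : Set α} (hf : Set.InjOn f S) {l l' : List α}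
    (hl : ∀ a ∈ l, a ∈ S) (hl' : ∀ a ∈ l', a ∈ S) (h : l.map f = l'.map f) : l = l' := by
  induction l generalizing l' with
  | nil => simpa [eq_comm] using h
  | cons a l ih =>
    cases l' with
    | nil => simp at h
    | cons b l' =>
      rw [List.map_cons, List.map_cons, List.cons.injEq] at h
      rw [hf (hl a (by simp)) (hl' b (by simp)) h.1,
        ih (fun x hx => hl x (by simp [hx])) (fun x hx => hl' x (by simp [hx])) h.2]

theorem injOn_pairOf : Set.InjOn pairOf {M | ∃ K, M.map ∈ stackTriangulations (K + 1)} := by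
  rintro M ⟨K, hM⟩ M' ⟨K', hM'⟩ e
  have h := isCodedBy_treeOf hM
  rw [show treeOf M.map = treeOf M'.map from (Prod.ext_iff.1 e).1] at h
  exact h.marked_unique (isCodedBy_treeOf hM') (Prod.ext_iff.1 e).2

theorem bijOn_map_pairOf (K : ℕ) :
    Set.BijOn (List.map pairOf) (mapHistories (K + 1)) (treeHistories (K + 1)) := by
  refine ⟨?_, ?_, ?_⟩
  · rintro h ⟨c, hc, hh⟩
    exact ⟨_, treeOf_mem hc, isTreeHistory_map hh⟩
  · rintro h ⟨c, -, hh⟩ h' ⟨c', -, hh'⟩ e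
    exact map_injOn injOn_pairOf (mem_stack_of_history hh).2 (mem_stack_of_history hh').2 e
  · rintro h' ⟨t, ht, hh⟩
    obtain ⟨h, c, hc, rfl, rfl⟩ := exists_mapHistory hh
    have hstack := (mem_stack_of_history hc).1
    have h1 := (treeOf_mem hstack).2.2
    rw [ht.2.2] at h1
    -- The number of nodes fixes the length of the history, hence the size of the lifted map.
    have h2 : 3 * (K + 1) - 2 = 3 * (h.length + 1) - 2 := by exact_mod_cast h1
    obtain rfl : K = h.length := by omega
    exact ⟨h, ⟨c, hstack, hc⟩, rfl⟩

end StackTri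

/-! ### The main theorem. -/

open StackTri in
theorem proposition1 :
    ∃ (Ψ : MapClass → Set Word) (ψ : List MarkedClass → List (Set Word × Word))
      (ν : ∀ m : RootedMap, m.Vertex → Word) (ℓ : ∀ m : RootedMap, m.Face → Word),
      ∀ K : ℕ, 1 ≤ K →
        -- `Ψ` is a bijection from stack-triangulations to ternary trees
        Set.BijOn Ψ (stackTriangulations K) (ternaryTrees (3 * K - 2)) ∧
        (∀ m : RootedMap, (Quotient.mk _ m : MapClass) ∈ stackTriangulations K →
          -- internal vertices correspond to internal nodes
          Set.BijOn (ν m) m.internalVertices (internalNodes (Ψ (Quotient.mk _ m))) ∧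
          -- finite faces, all of them triangular, correspond to leaves; there are `2 K` faces
          Set.BijOn (ℓ m) m.finiteFaces (leaves (Ψ (Quotient.mk _ m))) ∧
          (∀ f : m.Face, m.faceDegree f = 3) ∧ Nat.card m.Face = 2 * K ∧
          -- distances to the root vertex
          (∀ u ∈ m.internalVertices, passage (ν m u) = m.dist m.rootVertex u) ∧
          -- distances between internal vertices
          (∀ u ∈ m.internalVertices, ∀ v ∈ m.internalVertices,
            |(m.dist u v : ℤ) - (passage₂ (ν m u) (ν m v) : ℤ)| ≤ 4) ∧
          -- degrees
          (∀ u ∈ m.internalVertices, m.degree u =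
            3 + (binaryForest (internalNodes (Ψ (Quotient.mk _ m))) (ν m u)).ncard)) ∧
        -- `ψ` is a bijection between histories
        Set.BijOn ψ (mapHistories K) (treeHistories K) ∧
        -- a history of a map is sent to a history of the corresponding tree, step by step
        (∀ h ∈ mapHistories K, ∀ c, IsMapHistory h c → IsTreeHistory (ψ h) (Ψ c)) ∧
        (∀ h ∈ mapHistories K, ∀ (i : ℕ) (M : MarkedMap), h[i]? = some (Quotient.mk _ M) →
          (ψ h)[i]? = some (Ψ (Quotient.mk _ M.map), ℓ M.map M.face)) ∧
        -- consistency
        (∀ h ∈ mapHistories K, ∀ j, 1 ≤ j → j ≤ K → ψ (h.take (j - 1)) = (ψ h).take (j - 1)) ∧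
        -- robustness
        (∀ h₁ ∈ mapHistories K, ∀ h₂ ∈ mapHistories K,
          (∃ c, IsMapHistory h₁ c ∧ IsMapHistory h₂ c) ↔
            ∃ t, IsTreeHistory (ψ h₁) t ∧ IsTreeHistory (ψ h₂) t) := by
  refine ⟨treeOf, List.map pairOf, nodeOf, leafOf, fun K hK => ?_⟩
  obtain ⟨K, rfl⟩ : ∃ k, K = k + 1 := ⟨K - 1, by omega⟩
  refine ⟨bijOn_treeOf K, fun m hm => ?_, bijOn_map_pairOf K, ?_, ?_, ?_, ?_⟩
  · have h := isCodedBy_treeOf hm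
    have ht := h.exists_coding.1
    have hc := h.coding_labOf
    refine ⟨h.bijOn_nodeOf, h.bijOn_leafOf, hc.faceDegree_eq, ?_, fun u hu => ?_,
      fun u hu v hv => ?_, fun u hu => ?_⟩
    · have h1 := ncard_leaves ht
      have h2 := (treeOf_mem hm).2.2
      rw [← ht.finite.cast_ncard_eq] at h2
      have h3 : (treeOf (Quotient.mk _ m)).ncard = 3 * (K + 1) - 2 := by exact_mod_cast h2
      rw [h.card_face]
      omega
    · obtain ⟨d, rfl, hd, hmem⟩ := h.exists_nodeOf hu
      rw [passage_eq_val, hc.dist_root ht hmem hd]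
    · obtain ⟨d, rfl, hd, hmem⟩ := h.exists_nodeOf hu
      obtain ⟨d', rfl, hd', hmem'⟩ := h.exists_nodeOf hv
      exact hc.abs_dist_sub_passage₂_le ht hmem hmem' hd hd'
    · obtain ⟨d, rfl, hd, hmem⟩ := h.exists_nodeOf hu
      exact hc.degree_eq ht hd hmem
  · exact fun h _ c hh => isTreeHistory_map hh
  · rintro h ⟨c, -, hh⟩ i M hM
    obtain ⟨k, hk⟩ := (mem_stack_of_history hh).2 _ (List.mem_of_getElem? hM)
    rw [List.getElem?_map, hM, Option.map_some, pairOf, IsCodedBy.markOf_eq (isCodedBy_treeOf hk)]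
    rfl
  -- The same termwise map serves for all sizes, so it commutes with truncation.
  · exact fun h _ j _ _ => List.map_take
  · rintro h₁ ⟨c₁, hc₁, hh₁⟩ h₂ ⟨c₂, hc₂, hh₂⟩
    constructor
    · rintro ⟨c, hc, hc'⟩
      exact ⟨_, isTreeHistory_map hc, isTreeHistory_map hc'⟩
    · rintro ⟨t, ht, ht'⟩
      -- A tree history determines its final tree, so both maps have the tree `t` and injectivity
      -- identifies them.
      have e₁ := isTreeHistory_unique (isTreeHistory_map hh₁) ht
      have e₂ := isTreeHistory_unique (isTreeHistory_map hh₂) ht'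
      obtain rfl := (bijOn_treeOf K).injOn hc₁ hc₂ (e₁.trans e₂.symm)
      exact ⟨c₁, hh₁, hh₂⟩
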